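/- **Setting.** Let $(\mathfrak g,\sigma,\Omega=\delta\xi)$ be an elementary solvable exact triple: $\mathfrak g=\mathfrak b\oplus\mathfrak a$ is a finite-dimensional real Lie algebra that is a split extension of an Abelian subalgebra $\mathfrak a$ by an Abelian ideal $\mathfrak b$; $\sigma$ is an involutive automorphism of $\mathfrak g$ preserving $\mathfrak a$ and $\mathfrak b$, with $\pm1$-eigenspaces $\mathfrak k,\mathfrak p$ satisfying $[\mathfrak p,\mathfrak p]=\mathfrak k$; $\xi\in\mathfrak g^*$, and $\Omega(X,Y)=\xi([X,Y])$ satisfies $i(\mathfrak k)\Omega=0$ and is nondegenerate on $\mathfrak p\times\mathfrak p$. Put $\mathcal L=\mathfrak b\cap\mathfrak p$, so that $\mathfrak p=\mathfrak a\oplus\mathcal L$; $\rho(a)=\mathrm{ad}(a)|_{\mathfrak b}$, $\sinh a=\tfrac12(e^{\rho(a)}-e^{-\rho(a)})$ and $\cosh a=\tfrac12(e^{\rho(a)}+e^{-\rho(a)})$. The associated elementary solvable symplectic symmetric space is $M=\mathfrak a\times\mathcal L$ with symplectic form $\Omega|_{\mathfrak p\times\mathfrak p}$ and symmetries $$s_{(a,l)}(a',l')=(2a-a',\,2\cosh(a-a')l-l').$$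 Its transvection group $G$ is the group generated by all $s_x\circ s_y$. Assume that $M$ has a globally defined midpoint map: there is a map $x\mapsto \frac x2$ with $s_{x/2}(0,0)=x$ for all $x\in M$. The twisting map $\phi:\mathfrak a\to\mathfrak a$, defined by $\Omega(\phi(a),l)=\xi(\sinh(a)l)$ for all $l\in\mathcal L$, is then a diffeomorphism. Fix $\hbar>0$, Haar measures on $\mathfrak a$ and $\mathcal L$, and the product measure $dx$ on $M$. Let $\mathcal D\subset\mathcal S\subset\mathcal S'$ be the smooth compactly supported functions, the Schwartz functions and the tempered distributions on $M$ (a function being identified with a distribution through $dx$). Let $F$ be the partial Fourier transform $Fu(a,\alpha)=\int_{\mathcal L}e^{-i\Omega(\alpha,l)}u(a,l)\,dl$, extended to $\mathcal S'$, and $\varphi_\hbar(a,\alpha)=(a,\tfrac2\hbar\phi(\tfrac\hbar2\alpha))$. The formula $$\tau=F^{-1}\circ(\varphi_\hbar^{-1})^\star\circ F:\mathcal S\to\mathcal S'$$ defines an injective linear map; put $\mathcal E=\tau(\mathcal S)$ and $T=\tau^{-1}:\mathcal E\to\mathcal S$. Equip $\mathcal E$ with the inner product $(a,b)_{\mathcal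 E}=\int_M Ta\,\overline{Tb}\,dx$, with Hilbert completion $\mathcal H$, and with the product $a\star b=\tau(Ta\star^0Tb)$, where $$(u\star^0v)(x)=\kappa\int_{M\times M}u(y)v(z)\,e^{-\frac{2i}{\hbar}(\Omega(x,y)+\Omega(y,z)+\Omega(z,x))}\,dy\,dz$$ is the Weyl product and $\kappa>0$ is any fixed normalization constant. **Proposition.** 1. One has $\mathcal D\subset\mathcal S\subset\mathcal E\subset\mathcal H$, and these inclusions are dense: $\mathcal D$ is dense in $\mathcal S$ for the Schwartz topology, and $\mathcal D$ and $\mathcal S$ are dense in $\mathcal E$, and $\mathcal E$ in $\mathcal H$, for the norm of $(\cdot,\cdot)_{\mathcal E}$. 2. For all $x\in M$ and $u,v\in\mathcal D$, $(s_x^\star u,s_x^\star v)_{\mathcal E}=(u,v)_{\mathcal E}$. In particular the action $g\cdot u=u\circ g^{-1}$ of $G$ on $\mathcal D$ extends to a unitary action of $G$ on $\mathcal H$. 3. $\mathcal E$ is closed under $\star$, and $\star$ extends to a jointly continuous bilinear associative product on $\mathcal H$, so that $(\mathcal H,\star)$ is an associative topological algebra. 4. $G$ acts on $(\mathcal H,\star)$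 by algebra automorphisms. -/

import Mathlib

open MeasureTheory
open scoped SchwartzMap ContDiff

set_option linter.unusedSectionVars false

noncomputable section

/-! ### Elementary solvable exact triples -/

section Triples

variable (𝔤 𝔞 𝔟 : Type*) [LieRing 𝔤] [LieAlgebra ℝ 𝔤]
  [NormedAddCommGroup 𝔞] [NormedSpace ℝ 𝔞] [FiniteDimensional ℝ 𝔞]
  [NormedAddCommGroup 𝔟] [NormedSpace ℝ 𝔟] [FiniteDimensional ℝ 𝔟]

/-- An elementary solvable exact triple `(𝔤, σ, Ω = δξ)`. The finite dimensional real Lie algebra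
`𝔤 = 𝔟 ⊕ 𝔞` is a split extension of the Abelian Lie algebra `𝔞` by the Abelian Lie algebra `𝔟`
(`𝔟` is an Abelian ideal and `𝔞` an Abelian subalgebra; the vector spaces `𝔞` and `𝔟` are embedded
in `𝔤` through `e`), `σ` is an involutive automorphism which preserves the splitting,
and `Ω x y = ξ ⁅x, y⁆`. -/
structure ESET where
  /-- the vector space splitting of `𝔤` -/
  e : (𝔞 × 𝔟) ≃ₗ[ℝ] 𝔤
  a_abelian : ∀ a a' : 𝔞, ⁅e (a, 0), e (a', 0)⁆ = 0
  b_abelian : ∀ b b' : 𝔟, ⁅e (0, b), e (0, b')⁆ = 0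
  b_ideal : ∀ (a : 𝔞) (b : 𝔟), ∃ b' : 𝔟, ⁅e (a, 0), e (0, b)⁆ = e (0, b')
  /-- the involution -/
  σ : 𝔤 →ₗ⁅ℝ⁆ 𝔤
  σ_involutive : ∀ x, σ (σ x) = x
  σ_a : ∀ a : 𝔞, ∃ a' : 𝔞, σ (e (a, 0)) = e (a', 0)
  σ_b : ∀ b : 𝔟, ∃ b' : 𝔟, σ (e (0, b)) = e (0, b')
  /-- `[𝔭, 𝔭] = 𝔨`, where `𝔨` and `𝔭` are the `+1` and `-1` eigenspaces of `σ` -/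
  bracket_p_p : ∀ x, σ x = x ↔
    x ∈ Submodule.span ℝ {z | ∃ y y' : 𝔤, σ y = -y ∧ σ y' = -y' ∧ z = ⁅y, y'⁆}
  /-- the linear form whose coboundary is `Ω` -/
  ξ : Module.Dual ℝ 𝔤
  /-- `i(𝔨) Ω = 0` -/
  Ω_k : ∀ x y : 𝔤, σ x = x → ξ ⁅x, y⁆ = 0
  /-- `Ω` is nondegenerate on `𝔭 × 𝔭` -/
  Ω_nondegenerate : ∀ x : 𝔤, σ x = -x → (∀ y : 𝔤, σ y = -y → ξ ⁅x, y⁆ = 0) → x = 0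

end Triples

namespace ESET

variable {𝔤 𝔞 𝔟 : Type*} [LieRing 𝔤] [LieAlgebra ℝ 𝔤]
  [NormedAddCommGroup 𝔞] [NormedSpace ℝ 𝔞] [FiniteDimensional ℝ 𝔞]
  [NormedAddCommGroup 𝔟] [NormedSpace ℝ 𝔟] [FiniteDimensional ℝ 𝔟]
  (X : ESET 𝔤 𝔞 𝔟)

/-- The embedding of `𝔞` in `𝔤`. -/
def inA : 𝔞 →ₗ[ℝ] 𝔤 := X.e.toLinearMap ∘ₗ LinearMap.inl ℝ 𝔞 𝔟

/-- The embedding of `𝔟` in `𝔤`. -/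
def inB : 𝔟 →ₗ[ℝ] 𝔤 := X.e.toLinearMap ∘ₗ LinearMap.inr ℝ 𝔞 𝔟

/-- The projection of `𝔤 = 𝔟 ⊕ 𝔞` onto `𝔟`. -/
def prB : 𝔤 →ₗ[ℝ] 𝔟 := LinearMap.snd ℝ 𝔞 𝔟 ∘ₗ X.e.symm.toLinearMap

/-- The splitting homomorphism `ρ : 𝔞 → End 𝔟`, `ρ(a) b = [a, b]`. -/
def ρ (a : 𝔞) : 𝔟 →L[ℝ] 𝔟 :=
  LinearMap.toContinuousLinearMap
    (X.prB ∘ₗ (LieModule.toEnd ℝ 𝔤 𝔤 (X.inA a)) ∘ₗ X.inB)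

/-- `sinh a = (exp ρ(a) - exp ρ(-a)) / 2`. -/
def sinh (a : 𝔞) : 𝔟 →L[ℝ] 𝔟 :=
  (1 / 2 : ℝ) • (NormedSpace.exp (X.ρ a) - NormedSpace.exp (X.ρ (-a)))

/-- `cosh a = (exp ρ(a) + exp ρ(-a)) / 2`. -/
def cosh (a : 𝔞) : 𝔟 →L[ℝ] 𝔟 :=
  (1 / 2 : ℝ) • (NormedSpace.exp (X.ρ a) + NormedSpace.exp (X.ρ (-a)))

/-- `𝓛 = 𝔟 ∩ 𝔭`. -/
def L : Submodule ℝ 𝔟 where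
  carrier := {b | X.σ (X.inB b) = -X.inB b}
  add_mem' := by
    intro a b ha hb
    simp only [Set.mem_ofPred_eq, map_add] at *
    rw [ha, hb]; abel
  zero_mem' := by simp
  smul_mem' := by
    intro c b hb
    simp only [Set.mem_ofPred_eq, map_smul] at *
    rw [hb, smul_neg]

/-- The symplectic symmetric space `M = 𝔭 = 𝔞 × 𝓛` in its global Darboux chart. -/
abbrev M : Type _ := 𝔞 × X.L

/-- The symplectic form `Ω` restricted to `𝔭 = 𝔞 × 𝓛`. -/
def Ω (x y : X.M) : ℝ := X.ξ ⁅X.inA x.1 + X.inB x.2, X.inA y.1 + X.inB y.2⁆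

/-! #### Auxiliary facts -/

lemma e_eq (a : 𝔞) (b : 𝔟) : X.e (a, b) = X.inA a + X.inB b := by
  simp [inA, inB, ← map_add]

lemma exists_eq (x : 𝔤) : ∃ a b, x = X.inA a + X.inB b :=
  ⟨(X.e.symm x).1, (X.e.symm x).2, by rw [← e_eq]; simp⟩

lemma prB_inB (b : 𝔟) : X.prB (X.inB b) = b := by simp [prB, inB]

lemma add_inj {a a' : 𝔞} {b b' : 𝔟} (h : X.inA a + X.inB b = X.inA a' + X.inB b') :
    a = a' ∧ b = b' := by
  rw [← e_eq, ← e_eq] at h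
  simpa using X.e.injective h

lemma lie_inA_inB (a : 𝔞) (b : 𝔟) : ⁅X.inA a, X.inB b⁆ = X.inB (X.ρ a b) := by
  obtain ⟨b', hb'⟩ := X.b_ideal a b
  have h : ⁅X.inA a, X.inB b⁆ = X.inB b' := hb'
  have : X.ρ a b = b' := by
    change X.prB ⁅X.inA a, X.inB b⁆ = b'
    rw [h, prB_inB]
  rw [this, h]

lemma lie_mem (x y : 𝔤) : ⁅x, y⁆ ∈ LinearMap.range X.inB := by
  obtain ⟨a, b, rfl⟩ := X.exists_eq x
  obtain ⟨a', b', rfl⟩ := X.exists_eq y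
  have h1 : ⁅X.inA a, X.inA a'⁆ = 0 := X.a_abelian a a'
  have h2 : ⁅X.inB b, X.inB b'⁆ = 0 := X.b_abelian b b'
  have h3 : ⁅X.inB b, X.inA a'⁆ = -⁅X.inA a', X.inB b⁆ := (lie_skew _ _).symm
  refine ⟨X.ρ a b' - X.ρ a' b, ?_⟩
  rw [add_lie, lie_add, lie_add, h1, h2, h3, lie_inA_inB, lie_inA_inB, map_sub]
  abel

lemma σ_inA (a : 𝔞) : X.σ (X.inA a) = -X.inA a := by
  obtain ⟨a', ha'⟩ := X.σ_a a
  have h : X.σ (X.inA a) = X.inA a' := ha'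
  have hk : X.σ (X.inA a + X.inA a') = X.inA a + X.inA a' := by
    rw [← h, map_add, X.σ_involutive, add_comm]
  have hspan : Submodule.span ℝ {z | ∃ y y' : 𝔤, X.σ y = -y ∧ X.σ y' = -y' ∧ z = ⁅y, y'⁆}
      ≤ LinearMap.range X.inB := by
    refine Submodule.span_le.2 ?_
    rintro _ ⟨y, y', -, -, rfl⟩
    exact X.lie_mem y y'
  obtain ⟨b, hb⟩ := hspan ((X.bracket_p_p _).1 hk)
  have := X.add_inj (a := a + a') (a' := 0) (b := 0) (b' := b) (by simp [hb])
  rw [h, ← map_neg]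
  congr 1
  exact (neg_eq_of_add_eq_zero_right this.1).symm

lemma mem_p {x : 𝔤} (hx : X.σ x = -x) : ∃ (a : 𝔞) (l : X.L), x = X.inA a + X.inB l := by
  obtain ⟨a, b, rfl⟩ := X.exists_eq x
  refine ⟨a, ⟨b, ?_⟩, rfl⟩
  rw [map_add, σ_inA, neg_add] at hx
  exact add_left_cancel hx

/-- The symplectic pairing `𝔞 × 𝓛 → ℝ`, `(a, l) ↦ Ω(a, l)`, as a map from `𝔞` to the dual
of `𝓛`. -/
def pairing : 𝔞 →ₗ[ℝ] Module.Dual ℝ X.L :=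
  LinearMap.mk₂ ℝ (fun (a : 𝔞) (l : X.L) => X.ξ ⁅X.inA a, X.inB l⁆)
    (by intros; simp [add_lie]) (by intros; simp) (by intros; simp) (by intros; simp)

lemma pairing_apply (a : 𝔞) (l : X.L) : X.pairing a l = X.Ω (a, 0) (0, l) := by
  simp [pairing, Ω]

lemma lie_inB_inA (a : 𝔞) (l : X.L) : X.ξ ⁅X.inB (l : 𝔟), X.inA a⁆ = -X.pairing a l := by
  rw [← lie_skew, map_neg]; rfl

lemma pairing_injective : Function.Injective X.pairing := by
  refine (injective_iff_map_eq_zero _).2 fun a ha => ?_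
  have h0 : X.inA a = 0 := by
    refine X.Ω_nondegenerate _ (X.σ_inA a) fun y hy => ?_
    obtain ⟨a', l, rfl⟩ := X.mem_p hy
    have h1 : ⁅X.inA a, X.inA a'⁆ = 0 := X.a_abelian a a'
    have h2 : X.ξ ⁅X.inA a, X.inB (l : 𝔟)⁆ = X.pairing a l := rfl
    rw [lie_add, h1, zero_add, h2, ha]; rfl
  exact (X.add_inj (a := a) (a' := 0) (b := 0) (b' := 0) (by simp [h0])).1

lemma pairing_flip_injective : Function.Injective X.pairing.flip := by
  refine (injective_iff_map_eq_zero _).2 fun l hl => ?_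
  have h0 : X.inB (l : 𝔟) = 0 := by
    refine X.Ω_nondegenerate _ l.2 fun y hy => ?_
    obtain ⟨a', l', rfl⟩ := X.mem_p hy
    have h1 : ⁅X.inB (l : 𝔟), X.inB (l' : 𝔟)⁆ = 0 := X.b_abelian _ _
    have h2 : X.pairing a' l = 0 := by
      have := LinearMap.congr_fun hl a'
      simpa using this
    rw [lie_add, h1, add_zero, lie_inB_inA, h2, neg_zero]
  exact Subtype.ext (X.add_inj (a := 0) (a' := 0) (b := l) (b' := 0) (by simp [h0])).2

lemma pairing_bijective : Function.Bijective X.pairing := by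
  refine ⟨X.pairing_injective, ?_⟩
  have h1 := LinearMap.finrank_le_finrank_of_injective X.pairing_injective
  have h2 := LinearMap.finrank_le_finrank_of_injective X.pairing_flip_injective
  rw [Subspace.dual_finrank_eq] at h1 h2
  refine (LinearMap.injective_iff_surjective_of_finrank_eq_finrank ?_).1 X.pairing_injective
  rw [Subspace.dual_finrank_eq]
  exact le_antisymm h1 h2

lemma ρ_add (a a' : 𝔞) : X.ρ (a + a') = X.ρ a + X.ρ a' := by
  ext b; simp [ρ]

lemma ρ_smul (c : ℝ) (a : 𝔞) : X.ρ (c • a) = c • X.ρ a := by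
  ext b; simp [ρ]

/-- `ρ` as a continuous linear map. -/
def ρL : 𝔞 →L[ℝ] (𝔟 →L[ℝ] 𝔟) :=
  LinearMap.toContinuousLinearMap { toFun := X.ρ, map_add' := X.ρ_add, map_smul' := X.ρ_smul }

lemma ρL_apply (a : 𝔞) : X.ρL a = X.ρ a := rfl

lemma ρ_neg (a : 𝔞) : X.ρ (-a) = -X.ρ a := by
  rw [← ρL_apply, map_neg]; rfl

/-- `σ` restricted to `𝔟`. -/
def σB : 𝔟 →L[ℝ] 𝔟 :=
  LinearMap.toContinuousLinearMap (X.prB ∘ₗ (X.σ : 𝔤 →ₗ[ℝ] 𝔤) ∘ₗ X.inB)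

lemma inB_σB (b : 𝔟) : X.inB (X.σB b) = X.σ (X.inB b) := by
  obtain ⟨b', hb'⟩ := X.σ_b b
  have h : X.σ (X.inB b) = X.inB b' := hb'
  have : X.σB b = b' := by
    change X.prB (X.σ (X.inB b)) = b'
    rw [h, prB_inB]
  rw [this, h]

lemma inB_injective : Function.Injective X.inB := fun b b' h => by
  rw [← X.prB_inB b, h, prB_inB]

lemma σB_σB : X.σB * X.σB = 1 := by
  ext b
  apply X.inB_injective
  simp [inB_σB, X.σ_involutive]

lemma σB_ρ (a : 𝔞) : X.σB * X.ρ a * X.σB = X.ρ (-a) := by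
  ext b
  apply X.inB_injective
  change X.inB (X.σB (X.ρ a (X.σB b))) = X.inB (X.ρ (-a) b)
  rw [inB_σB, ← lie_inA_inB, LieHom.map_lie, σ_inA, inB_σB, X.σ_involutive, ← lie_inA_inB, map_neg]

lemma mem_L_iff (b : 𝔟) : b ∈ X.L ↔ X.σB b = -b := by
  rw [← X.inB_injective.eq_iff, inB_σB, map_neg]; rfl

lemma σB_cosh (a : 𝔞) : X.σB * X.cosh a = X.cosh a * X.σB := by
  have : CompleteSpace 𝔟 := FiniteDimensional.complete ℝ 𝔟
  let _ : NormedAlgebra ℚ (𝔟 →L[ℝ] 𝔟) := NormedAlgebra.restrictScalars ℚ ℝ _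
  let u : (𝔟 →L[ℝ] 𝔟)ˣ := ⟨X.σB, X.σB, X.σB_σB, X.σB_σB⟩
  have key : ∀ a, X.σB * NormedSpace.exp (X.ρ a) * X.σB = NormedSpace.exp (X.ρ (-a)) := by
    intro a
    rw [← X.σB_ρ a]
    exact (NormedSpace.exp_units_conj u (X.ρ a)).symm
  have h : X.σB * X.cosh a * X.σB = X.cosh a := by
    rw [cosh, mul_smul_comm, smul_mul_assoc, mul_add, add_mul, key, key, neg_neg, add_comm]
  calc X.σB * X.cosh a = X.σB * X.cosh a * (X.σB * X.σB) := by rw [σB_σB, mul_one]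
    _ = X.cosh a * X.σB := by rw [← mul_assoc, h]

lemma cosh_mem (a : 𝔞) {l : 𝔟} (hl : l ∈ X.L) : X.cosh a l ∈ X.L := by
  rw [mem_L_iff] at hl ⊢
  have := congrArg (fun f : 𝔟 →L[ℝ] 𝔟 => f l) (X.σB_cosh a)
  change X.σB (X.cosh a l) = X.cosh a (X.σB l) at this
  rw [this, hl, map_neg]

lemma cosh_neg (a : 𝔞) : X.cosh (-a) = X.cosh a := by
  rw [cosh, cosh, neg_neg, add_comm]

lemma contDiff_cosh : ContDiff ℝ ∞ X.cosh := by
  have : CompleteSpace 𝔟 := FiniteDimensional.complete ℝ 𝔟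
  have h : ContDiff ℝ ∞ (NormedSpace.exp : (𝔟 →L[ℝ] 𝔟) → (𝔟 →L[ℝ] 𝔟)) :=
    contDiff_iff_contDiffAt.2 fun x =>
      (NormedSpace.exp_analytic (𝕂 := ℝ) (𝔸 := 𝔟 →L[ℝ] 𝔟) x).contDiffAt
  have h1 : ContDiff ℝ ∞ fun a => NormedSpace.exp (X.ρ a) := h.comp X.ρL.contDiff
  have h2 : ContDiff ℝ ∞ fun a => NormedSpace.exp (X.ρ (-a)) := h1.comp contDiff_neg
  exact (h1.add h2).const_smul (1 / 2 : ℝ)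

/-! #### The twisting map, the symmetries and the transvection group -/

/-- The twisting map `φ : 𝔞 → 𝔞`, defined by `Ω(φ(a), l) = ξ(sinh(a) l)` for all `l ∈ 𝓛`. -/
def twistingMap (a : 𝔞) : 𝔞 :=
  (LinearEquiv.ofBijective X.pairing X.pairing_bijective).symm
    (X.ξ ∘ₗ X.inB ∘ₗ (X.sinh a : 𝔟 →ₗ[ℝ] 𝔟) ∘ₗ X.L.subtype)

lemma Ω_twistingMap (a : 𝔞) (l : X.L) :
    X.Ω (X.twistingMap a, 0) (0, l) = X.ξ (X.inB (X.sinh a l)) := by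
  have h := LinearEquiv.apply_symm_apply (LinearEquiv.ofBijective X.pairing X.pairing_bijective)
    (X.ξ ∘ₗ X.inB ∘ₗ (X.sinh a : 𝔟 →ₗ[ℝ] 𝔟) ∘ₗ X.L.subtype)
  rw [← pairing_apply]
  exact LinearMap.congr_fun h l

/-- The symmetry at `x = (a, l)`: `s_x (a', l') = (2a - a', 2 cosh(a - a') l - l')`. -/
def symm (x y : X.M) : X.M :=
  ((2 : ℝ) • x.1 - y.1,
    (2 : ℝ) • (⟨X.cosh (x.1 - y.1) x.2, X.cosh_mem _ x.2.2⟩ : X.L) - y.2)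

lemma symm_symm (x y : X.M) : X.symm x (X.symm x y) = y := by
  have h : x.1 - ((2 : ℝ) • x.1 - y.1) = -(x.1 - y.1) := by rw [two_smul]; abel
  ext
  · simp [symm]
  · simp only [symm, h, cosh_neg, sub_sub_cancel]

lemma contDiff_symm (x : X.M) : ContDiff ℝ ∞ (X.symm x) := by
  have hL : ∀ b : 𝔟, (1 / 2 : ℝ) • (b - X.σB b) ∈ X.L := by
    intro b
    have : X.σB (X.σB b) = b := congrArg (fun f : 𝔟 →L[ℝ] 𝔟 => f b) X.σB_σB
    rw [mem_L_iff, map_smul, map_sub, this, ← smul_neg, neg_sub]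
  let p : 𝔟 →L[ℝ] X.L := LinearMap.toContinuousLinearMap
    (((1 / 2 : ℝ) • (LinearMap.id - (X.σB : 𝔟 →ₗ[ℝ] 𝔟))).codRestrict X.L hL)
  have hp : ∀ (b : 𝔟) (hb : b ∈ X.L), p b = ⟨b, hb⟩ := by
    intro b hb
    ext
    change (1 / 2 : ℝ) • (b - X.σB b) = b
    rw [(X.mem_L_iff b).1 hb, sub_neg_eq_add, ← two_smul ℝ, smul_smul]
    norm_num
  have h1 : ContDiff ℝ ∞ fun y : X.M => X.cosh (x.1 - y.1) :=
    X.contDiff_cosh.comp (contDiff_const.sub contDiff_fst)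
  have h2 : ContDiff ℝ ∞ fun y : X.M => X.cosh (x.1 - y.1) (x.2 : 𝔟) :=
    h1.clm_apply contDiff_const
  have h3 : ContDiff ℝ ∞ fun y : X.M =>
      (⟨X.cosh (x.1 - y.1) x.2, X.cosh_mem _ x.2.2⟩ : X.L) := by
    have h4 : ContDiff ℝ ∞ fun y : X.M => p (X.cosh (x.1 - y.1) (x.2 : 𝔟)) := p.contDiff.comp h2
    have h5 : (fun y : X.M => p (X.cosh (x.1 - y.1) (x.2 : 𝔟))) = fun y : X.M =>
      (⟨X.cosh (x.1 - y.1) x.2, X.cosh_mem _ x.2.2⟩ : X.L) := funext fun y => hp _ _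
    rwa [h5] at h4
  exact (contDiff_const.sub contDiff_fst).prodMk ((h3.const_smul (2 : ℝ)).sub contDiff_snd)

end ESET

/-! ### Diffeomorphisms and test functions of a vector space -/

section Diffeo

/-- The group of diffeomorphisms of a normed space. -/
def Diffeos (V : Type*) [NormedAddCommGroup V] [NormedSpace ℝ V] : Subgroup (Equiv.Perm V) where
  carrier := {g | ContDiff ℝ ∞ g ∧ ContDiff ℝ ∞ g.symm}
  mul_mem' := fun ha hb => ⟨ha.1.comp hb.1, hb.2.comp ha.2⟩
  one_mem' := ⟨contDiff_id, contDiff_id⟩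
  inv_mem' := fun h => ⟨h.2, h.1⟩

variable (V : Type*) [NormedAddCommGroup V] [NormedSpace ℝ V]

/-- The space `𝓓(V)` of smooth compactly supported complex functions, inside `𝓢(V)`. -/
def testFunctions : Submodule ℂ 𝓢(V, ℂ) where
  carrier := {u | HasCompactSupport u}
  add_mem' := fun ha hb => HasCompactSupport.add ha hb
  zero_mem' := HasCompactSupport.zero
  smul_mem' := fun c _ hu => HasCompactSupport.smul_left (f := fun _ => c) hu

variable {V}

/-- The pull-back `g^⋆ u = u ∘ g` of a test function by a diffeomorphism. -/
def pullback (g : Diffeos V) (u : testFunctions V) : testFunctions V :=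
  let hc : HasCompactSupport ((u : 𝓢(V, ℂ)) ∘ (g : Equiv.Perm V)) :=
    HasCompactSupport.comp_homeomorph (f := (u : 𝓢(V, ℂ))) u.2
      (⟨(g : Equiv.Perm V), g.2.1.continuous, g.2.2.continuous⟩ : V ≃ₜ V)
  ⟨hc.toSchwartzMap (((u : 𝓢(V, ℂ)).smooth ⊤).comp g.2.1), hc⟩

end Diffeo

/-! ### Transported pre-Hilbert structure, Weyl product -/

section Transport

variable {V : Type*} [NormedAddCommGroup V] [NormedSpace ℝ V] [FiniteDimensional ℝ V]
  [MeasurableSpace V] [BorelSpace V]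

/-- The Weyl product
`(u ⋆⁰ v)(x) = κ ∫∫ u(y) v(z) exp(-(2i/ħ) (Ω₀(x,y) + Ω₀(y,z) + Ω₀(z,x))) dy dz`;
the constant `κ` stands for the normalization of the measure. -/
def weylProduct (μ : Measure V) (Ω₀ : V → V → ℝ) (ħ κ : ℝ) (u v : V → ℂ) (x : V) : ℂ :=
  κ * ∫ p : V × V, u p.1 * v p.2 *
    Complex.exp (-(2 / ħ * (Ω₀ x p.1 + Ω₀ p.1 p.2 + Ω₀ p.2 x) : ℝ) * Complex.I) ∂(μ.prod μ)

variable (μ : Measure V) [μ.IsAddHaarMeasure]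
  (τ : 𝓢(V, ℂ) →ₗ[ℂ] 𝓢'(V, ℂ)) (hτ : Function.Injective τ)

/-- For an injective linear map `τ : 𝓢(V) → 𝓢'(V)`, the space `𝓔 = τ(𝓢(V)) ⊆ 𝓢'(V)`, to be
equipped with the inner product transported from the `L²` inner product by `T = τ⁻¹`. -/
@[nolint unusedArguments]
def TransportSpace (_ : Measure V) (τ : 𝓢(V, ℂ) →ₗ[ℂ] 𝓢'(V, ℂ)) (_ : Function.Injective τ) :
    Type _ := LinearMap.range τ

namespace TransportSpace

instance : AddCommGroup (TransportSpace μ τ hτ) :=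
  inferInstanceAs (AddCommGroup (LinearMap.range τ))

instance : Module ℂ (TransportSpace μ τ hτ) :=
  inferInstanceAs (Module ℂ (LinearMap.range τ))

/-- The inverse `T : 𝓔 → 𝓢(V)` of `τ`. -/
def T : TransportSpace μ τ hτ ≃ₗ[ℂ] 𝓢(V, ℂ) := (LinearEquiv.ofInjective τ hτ).symm

lemma integral_eq_inner (a b : TransportSpace μ τ hτ) :
    ∫ x, starRingEnd ℂ (T μ τ hτ a x) * T μ τ hτ b x ∂μ =
      inner ℂ (SchwartzMap.toLpCLM ℂ ℂ 2 μ (T μ τ hτ a))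
        (SchwartzMap.toLpCLM ℂ ℂ 2 μ (T μ τ hτ b)) := by
  refine Eq.trans ?_ (SchwartzMap.inner_toL2_toL2_eq (T μ τ hτ a) (T μ τ hτ b) μ).symm
  simp only [RCLike.inner_apply']

/-- The inner product `∫ conj(T a) T b` of `𝓔` (conjugate linear in the first variable). -/
@[reducible]
def core : InnerProductSpace.Core ℂ (TransportSpace μ τ hτ) where
  inner a b := ∫ x, starRingEnd ℂ (T μ τ hτ a x) * T μ τ hτ b x ∂μ
  conj_inner_symm a b := by rw [integral_eq_inner, integral_eq_inner, inner_conj_symm]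
  re_inner_nonneg a := by rw [integral_eq_inner]; exact inner_self_nonneg
  add_left a b c := by
    rw [integral_eq_inner, integral_eq_inner, integral_eq_inner, map_add, map_add, inner_add_left]
  smul_left a b c := by
    rw [integral_eq_inner, integral_eq_inner, map_smul, map_smul, inner_smul_left]
  definite a ha := by
    rw [integral_eq_inner, inner_self_eq_zero] at ha
    have h : T μ τ hτ a = 0 := by
      refine SchwartzMap.injective_toLp 2 μ (ha.trans ?_)
      exact (map_zero (SchwartzMap.toLpCLM ℂ ℂ 2 μ)).symm
    simpa using h

instance : NormedAddCommGroup (TransportSpace μ τ hτ) :=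
  (core μ τ hτ).toNormedAddCommGroup

instance : InnerProductSpace ℂ (TransportSpace μ τ hτ) :=
  InnerProductSpace.ofCore (core μ τ hτ).toCore

lemma inner_eq (a b : TransportSpace μ τ hτ) :
    inner ℂ a b = ∫ x, starRingEnd ℂ (T μ τ hτ a x) * T μ τ hτ b x ∂μ := rfl

/-- The inclusion `𝓢(V) ⊆ 𝓔`, when every Schwartz function `u`, regarded as the tempered
distribution `w ↦ ∫ u w`, belongs to `𝓔`. -/
def incl (h : ∀ u : 𝓢(V, ℂ), SchwartzMap.toTemperedDistributionCLM V ℂ μ u ∈ LinearMap.range τ) :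
    𝓢(V, ℂ) →ₗ[ℂ] TransportSpace μ τ hτ :=
  LinearMap.codRestrict (LinearMap.range τ)
    (SchwartzMap.toTemperedDistributionCLM V ℂ μ : 𝓢(V, ℂ) →ₗ[ℂ] 𝓢'(V, ℂ)) h

/-- The Hilbert completion `𝓗` of `𝓔`. -/
abbrev Hilb : Type _ := UniformSpace.Completion (TransportSpace μ τ hτ)

end TransportSpace

end Transport

namespace ESET

variable {𝔤 𝔞 𝔟 : Type*} [LieRing 𝔤] [LieAlgebra ℝ 𝔤]
  [NormedAddCommGroup 𝔞] [NormedSpace ℝ 𝔞] [FiniteDimensional ℝ 𝔞]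
  [NormedAddCommGroup 𝔟] [NormedSpace ℝ 𝔟] [FiniteDimensional ℝ 𝔟]
  (X : ESET 𝔤 𝔞 𝔟)

/-- The symmetry `s_x` as a diffeomorphism of `M`. -/
def symmetry (x : X.M) : Diffeos X.M :=
  ⟨⟨X.symm x, X.symm x, X.symm_symm x, X.symm_symm x⟩, X.contDiff_symm x, X.contDiff_symm x⟩

/-- The transvection group, generated by all `s_x ∘ s_y`. -/
def transvectionGroup : Subgroup (Diffeos X.M) :=
  Subgroup.closure {g | ∃ x y : X.M, g = X.symmetry x * X.symmetry y}

/-- There is a globally defined midpoint map `x ↦ x/2`, `s_{x/2}(o) = x`, where `o = (0, 0)`. -/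
def HasMidpointMap : Prop := ∃ m : X.M → X.M, ∀ x, X.symm (m x) 0 = x

variable [MeasurableSpace 𝔞] [BorelSpace 𝔞] [MeasurableSpace 𝔟] [BorelSpace 𝔟]

/-- The partial Fourier transform `F u (a, α) = ∫_𝓛 exp(-i Ω(α, l)) u(a, l) dl`. -/
def partialFourier (μL : Measure X.L) (u : X.M → ℂ) (y : 𝔞 × 𝔞) : ℂ :=
  ∫ l : X.L, Complex.exp (-(X.Ω (y.2, 0) (0, l) : ℝ) * Complex.I) * u (y.1, l) ∂μL

/-- The transposed partial Fourier transform `(a, l) ↦ ∫_𝔞 exp(-i Ω(α, l)) w(a, α) dα`. -/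
def partialFourierTranspose (μa : Measure 𝔞) (w : 𝔞 × 𝔞 → ℂ) (x : X.M) : ℂ :=
  ∫ α : 𝔞, Complex.exp (-(X.Ω (α, 0) (0, x.2) : ℝ) * Complex.I) * w (x.1, α) ∂μa

/-- The partial Fourier transform of the tempered distribution `D` on `M = 𝔞 × 𝓛` is (the
tempered distribution on `𝔞 × 𝔞` given by) the function `f`: `⟨D, Fᵗ w⟩ = ∫ f w` for all
`w ∈ 𝓢(𝔞 × 𝔞)`. -/
def HasPartialFourier (μa : Measure 𝔞) (D : 𝓢'(X.M, ℂ)) (f : 𝔞 × 𝔞 → ℂ) : Prop :=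
  ∀ (w : 𝓢(𝔞 × 𝔞, ℂ)) (v : 𝓢(X.M, ℂ)), (∀ x, v x = X.partialFourierTranspose μa w x) →
    D v = ∫ y, f y * w y ∂(μa.prod μa)

/-- The map `(a, α) ↦ (a, (2/ħ) Φ((ħ/2) α))`. For `Φ = φ` the twisting map this is `φ_ħ`, and
if `φ` is bijective then `Φ = φ⁻¹` gives `φ_ħ⁻¹`. -/
def scaledTwist (ħ : ℝ) (Φ : 𝔞 → 𝔞) (y : 𝔞 × 𝔞) : 𝔞 × 𝔞 :=
  (y.1, (2 / ħ) • Φ ((ħ / 2) • y.2))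

end ESET

end

/-! Two things have to be shown: that composition with the twist φ_ħ preserves Schwartz functions,
so that T is defined on 𝓢, and that T turns the symmetries into unitary conjugations of operators.

For the second point, give a Schwartz function u the kernel K(s,t) = Fu((s+t)/2, (s-t)/ħ). Up to
constants the Weyl product becomes composition of kernels and the L² product becomes the
Hilbert–Schmidt product (`exists_weylConst`, `inner_toLp_eq`). Associativity and continuity of the
product are then Fubini and Cauchy–Schwarz. Pulling u back by s_(a,l) reflects both arguments of Fu
and multiplies Fu(a',α) by exp(-iΩ(α, 2cosh(a-a')l)). In the kernel of Tu the variable α is replaced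
by (2/ħ)φ((s-t)/2), and sinh A - sinh B = 2 sinh((A-B)/2) cosh((A+B)/2) splits the phase as w(s)
times the conjugate of w(t), where w(s) = exp(-(2i/ħ)ξ(sinh(s-a)l)). So s_(a,l) acts on kernels as
conjugation by the unitary operator f ↦ w·f(2a - ·) (`isReflection_kernel_dequantize`), and this
preserves inner products and compositions. The rest is extension from dense subspaces.

For the first point, a and all derivatives of φ at a must be bounded by powers of 1 + ‖φ(a)‖. The
pairing Ω identifies 𝔞 with the dual of 𝓛 and carries ρ(a)ρ(b)ρ(c) to a symmetric associative triple
product on 𝔞, for which φ is a hyperbolic sine whose derivative C(a), the transpose of cosh a, is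
the hyperbolic cosine. The midpoint map makes every C(a) injective. If the operator y² had a
negative eigenvalue, C(sy) would act as a cosine on an eigenvector and vanish for some s; replacing
y by p(y²)y for real polynomials p excludes non-real eigenvalues as well. Hence det(1 + r y²) ≥ 1
for r ≥ 0, and the resolvents (1 + r y²)⁻¹ grow polynomially in y by Cramer's rule. Averaging them
gives (1 + t²y²)^(-1/2), and integrating that in t gives an explicit inverse of φ (`φ_arsinhCurve`)
together with C = √(1 + φ²). The pair (φ, C) solves a linear differential equation, so these bounds
pass to all derivatives.

Density of 𝓢 in 𝓔 comes from compactly supported functions: they stay compactly supported under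
composition with φ_ħ⁻¹, so T(𝓢) contains their images under F⁻¹. -/

noncomputable section

/-! ### Abstract hyperbolic sines: injectivity and positivity of squares -/

/-- A commutative associative triple product on a vector space, with an abstract hyperbolic
sine `φ`, whose derivative is an abstract hyperbolic cosine `C`. -/
structure TwistSystem (A : Type*) [NormedAddCommGroup A] [NormedSpace ℝ A] where
  /-- the triple product -/
  mul : A →L[ℝ] A →L[ℝ] A →L[ℝ] A
  mul_comm : ∀ a b c, mul a b c = mul b a c
  mul_right_comm : ∀ a b c, mul a b c = mul a c b
  mul_mul : ∀ a b c d e, mul (mul a b c) d e = mul a b (mul c d e)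
  /-- the hyperbolic sine -/
  φ : A → A
  /-- the hyperbolic cosine -/
  C : A → A →L[ℝ] A
  φ_zero : φ 0 = 0
  C_zero : C 0 = 1
  hasFDerivAt_φ : ∀ a, HasFDerivAt φ (C a) a
  hasFDerivAt_C : ∀ a, HasFDerivAt C (mul.flip (φ a)) a
  C_mul : ∀ a b c d, C a (mul b c d) = mul (C a b) c d
  C_injective : ∀ a, Function.Injective (C a)
  -- The only addition formula that is required: the sum-to-product rule for the hyperbolic sine.
  φ_sub : ∀ a b, φ a - φ b
    = (2 : ℝ) • C ((1 / 2 : ℝ) • (a + b)) (φ ((1 / 2 : ℝ) • (a - b)))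

lemma HasDerivAt.apply_vec {A B : Type*} [NormedAddCommGroup A] [NormedSpace ℝ A]
    [NormedAddCommGroup B] [NormedSpace ℝ B] {f : ℝ → A →L[ℝ] B} {f' : A →L[ℝ] B} {s : ℝ}
    (h : HasDerivAt f f' s) (c : A) : HasDerivAt (fun s => f s c) (f' c) s :=
  ((ContinuousLinearMap.apply ℝ B c).hasFDerivAt.comp_hasDerivAt s h)

namespace TwistSystem

variable {A : Type*} [NormedAddCommGroup A] [NormedSpace ℝ A] [FiniteDimensional ℝ A]
  (Y : TwistSystem A)

/-- By `φ_sub` and injectivity of `C`, an equality φ a = φ b produces the zero (a-b)/2 of φ, and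
zeros of φ are stable under halving. A zero c would give zeros c/2ⁿ, so the derivative of φ at 0 in
direction c would vanish; but it is c, because C 0 = 1. -/
lemma φ_injective : Function.Injective Y.φ := by
  have h0 : ∀ c, Y.φ c = 0 → c = 0 := by
    have half : ∀ c, Y.φ c = 0 → Y.φ ((1 / 2 : ℝ) • c) = 0 := by
      intro c hc
      have h := Y.φ_sub c 0
      rw [hc, Y.φ_zero, sub_zero, sub_zero, add_zero] at h
      have h' := (smul_eq_zero.1 h.symm).resolve_left two_ne_zero
      exact Y.C_injective _ (h'.trans (map_zero _).symm)
    intro c hc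
    have hn : ∀ n : ℕ, Y.φ ((1 / 2 : ℝ) ^ n • c) = 0 := by
      intro n
      induction n with
      | zero => simpa using hc
      | succ n ih => rw [pow_succ', mul_smul]; exact half _ ih
    have hd : HasDerivAt (fun t : ℝ => Y.φ (t • c)) c 0 := by
      have h1 : HasFDerivAt Y.φ (Y.C 0) ((0 : ℝ) • c) := by
        rw [zero_smul]; exact Y.hasFDerivAt_φ 0
      have h2 : HasDerivAt (fun t : ℝ => t • c) c 0 := by
        simpa using (hasDerivAt_id (0 : ℝ)).smul_const c
      have := h1.comp_hasDerivAt (0 : ℝ) h2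
      simpa [Y.C_zero, Function.comp_def] using this
    have ht := hd.tendsto_slope_zero
    have hs : Filter.Tendsto (fun n : ℕ => (1 / 2 : ℝ) ^ n) Filter.atTop (nhdsWithin 0 {0}ᶜ) :=
      tendsto_nhdsWithin_iff.2
        ⟨tendsto_pow_atTop_nhds_zero_of_lt_one (by norm_num) (by norm_num),
          Filter.Eventually.of_forall fun n => by simp⟩
    have := ht.comp hs
    simp only [zero_add, zero_smul, Y.φ_zero, sub_zero] at this
    refine (tendsto_nhds_unique this ?_)
    refine tendsto_const_nhds.congr fun n => ?_
    simp only [Function.comp, hn, smul_zero]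
  intro a b hab
  have h := Y.φ_sub a b
  rw [hab, sub_self] at h
  have h' := (smul_eq_zero.1 h.symm).resolve_left two_ne_zero
  have h2 := h0 _ (Y.C_injective _ (h'.trans (map_zero _).symm))
  exact sub_eq_zero.1 ((smul_eq_zero.1 h2).resolve_left (by norm_num))

/-- Multiplication operators `P` for the triple product. -/
def IsMultiplier (P : A →L[ℝ] A) : Prop := ∀ b c d, P (Y.mul b c d) = Y.mul (P b) c d

variable {Y} in
-- The triple product is symmetric in its three slots, so an operator that can be pulled out of the
-- first slot can be pulled out of the last.
lemma IsMultiplier.commute {P : A →L[ℝ] A} (hP : Y.IsMultiplier P) (b c : A) :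
    Commute P (Y.mul b c) := by
  ext d
  change P (Y.mul b c d) = Y.mul b c (P d)
  rw [Y.mul_right_comm, Y.mul_comm, hP, ← Y.mul_comm, Y.mul_right_comm]

lemma isMultiplier_C (a : A) : Y.IsMultiplier (Y.C a) := Y.C_mul a

lemma isMultiplier_mul (a b : A) : Y.IsMultiplier (Y.mul a b) := fun c d e => (Y.mul_mul a b c d e).symm

variable {Y} in
lemma IsMultiplier.mul_left {P : A →L[ℝ] A} (hP : Y.IsMultiplier P) (b c : A) :
    Y.mul (P b) c = P * Y.mul b c := by
  ext d; exact (hP b c d).symm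

variable {Y} in
lemma IsMultiplier.mul_right {P : A →L[ℝ] A} (hP : Y.IsMultiplier P) (b c : A) :
    Y.mul b (P c) = P * Y.mul b c := by
  ext d
  rw [Y.mul_comm, hP.mul_left]
  exact congrArg P (Y.mul_comm c b d)

lemma hasDerivAt_φ {γ : ℝ → A} {γ' : A} {s : ℝ} (h : HasDerivAt γ γ' s) :
    HasDerivAt (fun s => Y.φ (γ s)) (Y.C (γ s) γ') s :=
  (Y.hasFDerivAt_φ (γ s)).comp_hasDerivAt s h

lemma hasDerivAt_C {γ : ℝ → A} {γ' : A} {s : ℝ} (h : HasDerivAt γ γ' s) :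
    HasDerivAt (fun s => Y.C (γ s)) (Y.mul γ' (Y.φ (γ s))) s :=
  (Y.hasFDerivAt_C (γ s)).comp_hasDerivAt s h

lemma hasDerivAt_mul_φ (y : A) {γ : ℝ → A} {γ' : A} {s : ℝ} (h : HasDerivAt γ γ' s) :
    HasDerivAt (fun s => Y.mul y (Y.φ (γ s))) (Y.mul y (Y.C (γ s) γ')) s :=
  (Y.mul y).hasFDerivAt.comp_hasDerivAt s (Y.hasDerivAt_φ h)

/-- The Wronskian of h and cos(μs), a conserved quantity of the oscillator h'' = -μ²h. -/
lemma hasDerivAt_trig_comb {h k : ℝ → A} {μ s : ℝ} (hh : HasDerivAt h (k s) s)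
    (hk : HasDerivAt k (-(μ ^ 2 • h s)) s) :
    HasDerivAt (fun s : ℝ => (μ * Real.sin (μ * s)) • h s + Real.cos (μ * s) • k s) 0 s := by
  have hm : HasDerivAt (fun s : ℝ => μ * s) μ s := by simpa using (hasDerivAt_id s).const_mul μ
  have := ((((Real.hasDerivAt_sin _).comp s hm).const_mul μ).smul hh).add
      (((Real.hasDerivAt_cos _).comp s hm).smul hk)
  refine this.congr_deriv ?_
  simp only [Function.comp_apply, smul_neg, smul_smul, neg_smul, neg_mul]
  rw [show Real.cos (μ * s) * μ ^ 2 = μ * (Real.cos (μ * s) * μ) by ring,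
    _root_.mul_comm μ (Real.sin _)]
  abel

/-- A kernel vector c satisfies y²c = -μ²c with μ² = 1/r. Then h(s) = C(sy)c solves h'' = -μ²h with
h(0) = c and h'(0) = 0, so it vanishes at s = π/(2μ), which injectivity of C(sy) forbids unless c =
0. -/
lemma one_add_smul_mul_self_injective (y : A) {r : ℝ} (hr : 0 ≤ r) :
    Function.Injective (1 + r • Y.mul y y : A →L[ℝ] A) := by
  refine (injective_iff_map_eq_zero _).2 fun c hc => ?_
  replace hc : c + r • Y.mul y y c = 0 := hc
  rcases hr.eq_or_lt with rfl | hr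
  · simpa using hc
  set μ := 1 / √r with hμ
  have hμ0 : 0 < μ := by positivity
  have hrμ : r * μ ^ 2 = 1 := by
    rw [hμ, div_pow, one_pow, Real.sq_sqrt hr.le]; field_simp
  have hS : Y.mul y y c = -(μ ^ 2 • c) := by
    have := congrArg (fun v => μ ^ 2 • v) hc
    simp only [smul_add, smul_smul, smul_zero] at this
    rw [_root_.mul_comm, hrμ, one_smul] at this
    exact eq_neg_of_add_eq_zero_right this
  have hy : ∀ s : ℝ, HasDerivAt (fun s : ℝ => s • y) y s := fun s => by
    simpa using (hasDerivAt_id s).smul_const y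
  have hC : ∀ s : ℝ, HasDerivAt (fun s : ℝ => Y.C (s • y) c) (Y.mul y (Y.φ (s • y)) c) s :=
    fun s => (Y.hasDerivAt_C (hy s)).apply_vec c
  have hk : ∀ s : ℝ, HasDerivAt (fun s : ℝ => Y.mul y (Y.φ (s • y)) c)
      (-(μ ^ 2 • Y.C (s • y) c)) s := fun s => by
    have e : Y.mul y (Y.C (s • y) y) c = -(μ ^ 2 • Y.C (s • y) c) := by
      rw [Y.mul_comm, ← Y.C_mul, hS, map_neg, map_smul]
    rw [← e]
    exact (Y.hasDerivAt_mul_φ y (hy s)).apply_vec c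
  have he := fun s => hasDerivAt_trig_comb (h := fun s => Y.C (s • y) c)
    (k := fun s => Y.mul y (Y.φ (s • y)) c) (hC s) (hk s)
  -- At s = π/(2μ) the conserved quantity is μ·C(sy)c; at s = 0 it is the initial velocity, which is
  -- zero.
  have h0 := is_const_of_deriv_eq_zero (fun s => (he s).differentiableAt) (fun s => (he s).deriv)
    (Real.pi / (2 * μ)) 0
  have hπ : μ * (Real.pi / (2 * μ)) = Real.pi / 2 := by field_simp
  simp only [hπ, Real.sin_pi_div_two, Real.cos_pi_div_two, mul_one, zero_smul, add_zero, mul_zero,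
    Real.sin_zero, Y.φ_zero, map_zero, zero_apply, smul_zero] at h0
  have h1 := (smul_eq_zero.1 h0).resolve_left hμ0.ne'
  exact Y.C_injective _ (h1.trans (map_zero _).symm)

lemma isMultiplier_aeval (y : A) (p : Polynomial ℝ) :
    Y.IsMultiplier (Polynomial.aeval (Y.mul y y) p) := by
  induction p using Polynomial.induction_on' with
  | add p q hp hq =>
    intro b c d
    rw [map_add, add_apply, hp, hq]
    simp
  | monomial n r =>
    rw [Polynomial.aeval_monomial]
    induction n with
    | zero => intro b c d; simp [Algebra.algebraMap_eq_smul_one]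
    | succ n ih =>
      intro b c d
      rw [pow_succ, ← _root_.mul_assoc]
      set Q := (algebraMap ℝ (A →L[ℝ] A)) r * Y.mul y y ^ n
      change Q (Y.mul y y (Y.mul b c d)) = Y.mul (Q (Y.mul y y b)) c d
      rw [Y.isMultiplier_mul y y b c d, ih]

lemma isUnit_one_add_smul (y : A) {r : ℝ} (hr : 0 ≤ r) :
    IsUnit (1 + r • Y.mul y y : A →L[ℝ] A) := by
  rw [ContinuousLinearMap.isUnit_iff_bijective]
  have := Y.one_add_smul_mul_self_injective y hr
  exact ⟨this, (LinearMap.injective_iff_surjective (K := ℝ)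
    (f := ((1 + r • Y.mul y y : A →L[ℝ] A) : A →ₗ[ℝ] A))).1 this⟩

/-- With P = p(y²), a multiplier, y²P² = (Py)². So the operator is 1 + (Py)², to which the case r =
1 applies with Py in place of y. -/
lemma isUnit_aeval (y : A) (p : Polynomial ℝ) :
    IsUnit (Polynomial.aeval (Y.mul y y) (1 + Polynomial.X * p ^ 2)) := by
  have hP := Y.isMultiplier_aeval y p
  set P := Polynomial.aeval (Y.mul y y) p with hPdef
  have h : Polynomial.aeval (Y.mul y y) (1 + Polynomial.X * p ^ 2)
      = 1 + (1 : ℝ) • Y.mul (P y) (P y) := by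
    rw [hP.mul_left, hP.mul_right, one_smul, map_add, map_one, map_mul, map_pow, Polynomial.aeval_X,
      ← _root_.mul_assoc, ← pow_two, ((hP.commute y y).pow_left 2).eq]
  rw [h]
  exact Y.isUnit_one_add_smul (P y) zero_le_one

/-- The complex eigenvalues of the square `mul y y` are nonnegative real numbers. -/
lemma nonneg_of_mem_spectrum (y : A) {ι : Type*} [Fintype ι] [DecidableEq ι]
    (b : Module.Basis ι ℝ A) {z : ℂ}
    (hz : z ∈ spectrum ℂ ((LinearMap.toMatrix b b (Y.mul y y)).map Complex.ofReal)) :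
    z.im = 0 ∧ 0 ≤ z.re := by
  set M := LinearMap.toMatrix b b (Y.mul y y : A →ₗ[ℝ] A) with hM
  -- Since 1 + X p² takes an invertible value at y², it cannot vanish at an eigenvalue z. For z
  -- outside [0, ∞) a polynomial violating this is exhibited below.
  have key : ∀ p : Polynomial ℝ, 1 + z * (p.map (algebraMap ℝ ℂ)).eval z ^ 2 ≠ 0 := by
    intro p h0
    set q : Polynomial ℝ := 1 + Polynomial.X * p ^ 2 with hq
    have hqz : (q.map (algebraMap ℝ ℂ)).eval z = 0 := by
      simpa [hq] using h0
    have h1 := spectrum.subset_polynomial_aeval (M.map Complex.ofReal) (q.map (algebraMap ℝ ℂ))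
      ⟨z, hz, hqz⟩
    rw [spectrum.zero_mem_iff] at h1
    apply h1
    have h2 : Polynomial.aeval (M.map Complex.ofReal) (q.map (algebraMap ℝ ℂ))
        = (Polynomial.aeval M q).map Complex.ofReal := by
      rw [Polynomial.aeval_map_algebraMap]
      exact Polynomial.aeval_algHom_apply (Complex.ofRealAm.mapMatrix) M q
    rw [h2]
    have h3 : IsUnit (Polynomial.aeval M q) := by
      have h4 : Polynomial.aeval M q
          = LinearMap.toMatrix b b (Polynomial.aeval (Y.mul y y : A →ₗ[ℝ] A) q) :=
        Polynomial.aeval_algHom_apply (LinearMap.toMatrixAlgEquiv b).toAlgHom _ q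
      have h5 : IsUnit (Polynomial.aeval (Y.mul y y : A →ₗ[ℝ] A) q) := by
        let t : (A →L[ℝ] A) →ₐ[ℝ] (A →ₗ[ℝ] A) :=
          { ContinuousLinearMap.toLinearMapRingHom with commutes' := fun _ => rfl }
        have h6 : Polynomial.aeval (Y.mul y y : A →ₗ[ℝ] A) q
            = t (Polynomial.aeval (Y.mul y y) q) :=
          Polynomial.aeval_algHom_apply t (Y.mul y y) q
        rw [h6]
        exact (Y.isUnit_aeval y p).map t
      rw [h4]
      exact h5.map (LinearMap.toMatrixAlgEquiv b).toAlgHom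
    exact h3.map (Complex.ofRealAm.mapMatrix)
  have him : z.im = 0 := by
    by_contra him
    -- For non-real z the numbers 1 and z span ℂ over ℝ, so a real affine polynomial takes the
    -- prescribed value w at z, with w² = -1/z.
    obtain ⟨w, hw⟩ := IsAlgClosed.exists_pow_nat_eq (-z⁻¹) (n := 2) two_pos
    refine key (Polynomial.C (w.re - w.im / z.im * z.re)
      + Polynomial.C (w.im / z.im) * Polynomial.X) ?_
    have : ((Polynomial.C (w.re - w.im / z.im * z.re)
      + Polynomial.C (w.im / z.im) * Polynomial.X).map (algebraMap ℝ ℂ)).eval z = w := by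
      simp only [Polynomial.map_add, Polynomial.map_mul, Polynomial.map_C, Polynomial.map_X,
        Polynomial.eval_add, Polynomial.eval_mul, Polynomial.eval_C, Polynomial.eval_X]
      apply Complex.ext
      · simp
      · simp; field_simp
    rw [this, hw]
    have hz0 : z ≠ 0 := fun h => him (by simp [h])
    field_simp
    ring
  refine ⟨him, ?_⟩
  by_contra hre
  push Not at hre
  have hz' : z = (z.re : ℂ) := Complex.ext (by simp) (by simp [him])
  refine key (Polynomial.C (1 / √(-z.re))) ?_
  rw [Polynomial.map_C, Polynomial.eval_C]
  have h1 : z.re * (1 / √(-z.re)) ^ 2 = -1 := by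
    rw [div_pow, one_pow, Real.sq_sqrt (by linarith)]
    field_simp [hre.ne]
  rw [hz']
  simp only [Complex.ofReal_re, Complex.coe_algebraMap]
  rw [← Complex.ofReal_pow, ← Complex.ofReal_mul, h1]
  simp

/-- The determinant is the product of the complex eigenvalues, and by spectral mapping these are 1 +
rz with z ≥ 0 an eigenvalue of y². -/
lemma one_le_det (y : A) {r : ℝ} (hr : 0 ≤ r) :
    1 ≤ LinearMap.det ((1 + r • Y.mul y y : A →L[ℝ] A) : A →ₗ[ℝ] A) := by
  let b := Module.finBasis ℝ A
  set M := LinearMap.toMatrix b b (Y.mul y y : A →ₗ[ℝ] A) with hM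
  set N := LinearMap.toMatrix b b ((1 + r • Y.mul y y : A →L[ℝ] A) : A →ₗ[ℝ] A) with hN
  have hNM : N = 1 + r • M := by
    have : ((1 + r • Y.mul y y : A →L[ℝ] A) : A →ₗ[ℝ] A)
      = 1 + r • (Y.mul y y : A →ₗ[ℝ] A) := rfl
    rw [hN, this, map_add, map_smul, LinearMap.toMatrix_one]
  rw [← LinearMap.det_toMatrix b, ← hN]
  have hNC : N.map Complex.ofReal
      = Polynomial.aeval (M.map Complex.ofReal) (1 + Polynomial.C (r : ℂ) * Polynomial.X) := by
    rw [hNM, map_add, map_one, map_mul, Polynomial.aeval_X, Polynomial.aeval_C]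
    ext i j
    simp [Matrix.one_apply, Algebra.algebraMap_eq_smul_one]
    split_ifs <;> simp
  have hroot : ∀ w ∈ (N.map Complex.ofReal).charpoly.roots, ∃ x : ℝ, 1 ≤ x ∧ w = x := by
    intro w hw
    have h1 : w ∈ spectrum ℂ (N.map Complex.ofReal) := by
      rw [Matrix.mem_spectrum_iff_isRoot_charpoly]
      exact Polynomial.isRoot_of_mem_roots hw
    -- Spectral mapping is applied in its form for a nonempty spectrum; the root w already excludes
    -- dimension zero.
    have hne : (spectrum ℂ (M.map Complex.ofReal)).Nonempty := by
      have : Nonempty (Fin (Module.finrank ℝ A)) := by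
        by_contra hemp
        rw [not_nonempty_iff] at hemp
        rw [spectrum.mem_iff] at h1
        exact h1 (by rw [isUnit_iff_exists_inv]; exact ⟨0, Subsingleton.elim _ _⟩)
      exact spectrum.nonempty_of_isAlgClosed_of_finiteDimensional ℂ _
    rw [hNC, spectrum.map_polynomial_aeval_of_nonempty _ _ hne] at h1
    obtain ⟨z, hz, rfl⟩ := h1
    obtain ⟨him, hre⟩ := Y.nonneg_of_mem_spectrum y b hz
    refine ⟨1 + r * z.re, by nlinarith [mul_nonneg hr hre], ?_⟩
    simp
    left
    exact Complex.ext (by simp) (by simp [him])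
  have hprod : ∀ m : Multiset ℂ, (∀ w ∈ m, ∃ x : ℝ, 1 ≤ x ∧ w = x) →
      ∃ x : ℝ, 1 ≤ x ∧ m.prod = x := by
    intro m
    induction m using Multiset.induction with
    | empty => intro _; exact ⟨1, le_rfl, by simp⟩
    | cons a m ih =>
      intro h
      obtain ⟨x, hx, hx'⟩ := ih fun w hw => h w (Multiset.mem_cons_of_mem hw)
      obtain ⟨x₁, hx₁, hx₁'⟩ := h a (Multiset.mem_cons_self a m)
      exact ⟨x₁ * x, by nlinarith, by rw [Multiset.prod_cons, hx', hx₁']; simp⟩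
  obtain ⟨x, hx, hx'⟩ := hprod _ hroot
  rw [← Matrix.det_eq_prod_roots_charpoly] at hx'
  have h2 : (N.map Complex.ofReal).det = (N.det : ℂ) :=
    (RingHom.map_det (algebraMap ℝ ℂ) N).symm
  rw [h2, Complex.ofReal_inj] at hx'
  rw [hx']; exact hx

end TwistSystem

/-! ### Polynomial bounds for inverses of matrices -/

/-- A continuous homogeneous map on a finite dimensional space is bounded by a power of the norm. -/
lemma exists_bound_of_homogeneous {V W : Type*} [NormedAddCommGroup V] [NormedSpace ℝ V]
    [FiniteDimensional ℝ V] [NormedAddCommGroup W] [NormedSpace ℝ W] {f : V → W} {m : ℕ}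
    (hf : Continuous f) (hm : ∀ (c : ℝ) v, f (c • v) = c ^ m • f v) :
    ∃ K, 0 ≤ K ∧ ∀ v, v ≠ 0 → ‖f v‖ ≤ K * ‖v‖ ^ m := by
  obtain ⟨K, hK⟩ := (isCompact_sphere (0 : V) 1).exists_bound_of_continuousOn hf.continuousOn
  refine ⟨max K 0, le_max_right _ _, fun v hv => ?_⟩
  have hv' : ‖v‖ ≠ 0 := norm_ne_zero_iff.2 hv
  have h1 : v = ‖v‖ • (‖v‖⁻¹ • v) := by rw [smul_smul, mul_inv_cancel₀ hv', one_smul]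
  have h2 : ‖‖v‖⁻¹ • v‖ = 1 := by rw [norm_smul, norm_inv, norm_norm, inv_mul_cancel₀ hv']
  have h3 := hK (‖v‖⁻¹ • v) (by simpa using h2)
  conv_lhs => rw [h1, hm, norm_smul, norm_pow, norm_norm, mul_comm]
  gcongr
  exact h3.trans (le_max_left _ _)

/-- The inverse of an endomorphism of determinant at least one is polynomially bounded. -/
lemma exists_bound_ringInverse (A : Type*) [NormedAddCommGroup A] [NormedSpace ℝ A]
    [FiniteDimensional ℝ A] : ∃ (K : ℝ) (m : ℕ), 0 ≤ K ∧ ∀ T : A →L[ℝ] A,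
      1 ≤ LinearMap.det (T : A →ₗ[ℝ] A) → ‖Ring.inverse T‖ ≤ K * (1 + ‖T‖) ^ m := by
  let b := Module.finBasis ℝ A
  let e : (A →L[ℝ] A) →ₗ[ℝ] Matrix (Fin (Module.finrank ℝ A)) (Fin (Module.finrank ℝ A)) ℝ :=
    (LinearMap.toMatrix b b).toLinearMap ∘ₗ ContinuousLinearMap.coeLM ℝ
  let e' : Matrix (Fin (Module.finrank ℝ A)) (Fin (Module.finrank ℝ A)) ℝ →ₗ[ℝ] (A →L[ℝ] A) :=
    LinearMap.toContinuousLinearMap.toLinearMap ∘ₗ (LinearMap.toMatrix b b).symm.toLinearMap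
  have he : Continuous e := LinearMap.continuous_of_finiteDimensional e
  have he' : Continuous e' := LinearMap.continuous_of_finiteDimensional e'
  -- Cramer's rule: the inverse is adj T / det T, and the adjugate is homogeneous of degree dim A -
  -- 1.
  obtain ⟨K, hK0, hK⟩ := exists_bound_of_homogeneous (f := fun T => e' (e T).adjugate)
    (he'.comp he.matrix_adjugate) (m := Module.finrank ℝ A - 1) (fun c v => by
      rw [map_smul, Matrix.adjugate_smul, map_smul, Fintype.card_fin])
  refine ⟨K, Module.finrank ℝ A - 1, hK0, fun T hT => ?_⟩
  have hT0 : LinearMap.det (T : A →ₗ[ℝ] A) ≠ 0 := by linarith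
  -- The bound on the adjugate covers nonzero T only; T = 0 meets the hypothesis only in dimension
  -- zero.
  rcases eq_or_ne T 0 with rfl | hT1
  · rw [Ring.inverse_zero, norm_zero]; positivity
  have hmul : T * e' (e T).adjugate = (LinearMap.det (T : A →ₗ[ℝ] A)) • 1 := by
    have h1 : (e T) * (e T).adjugate = (LinearMap.det (T : A →ₗ[ℝ] A)) • 1 := by
      rw [Matrix.mul_adjugate, ← LinearMap.det_toMatrix b]; rfl
    apply ContinuousLinearMap.coe_injective
    apply (LinearMap.toMatrix b b).injective
    have h2 : ((T * e' (e T).adjugate : A →L[ℝ] A) : A →ₗ[ℝ] A)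
      = (T : A →ₗ[ℝ] A) * (LinearMap.toMatrix b b).symm (e T).adjugate := rfl
    have h3 : (((LinearMap.det (T : A →ₗ[ℝ] A)) • 1 : A →L[ℝ] A) : A →ₗ[ℝ] A)
      = (LinearMap.det (T : A →ₗ[ℝ] A)) • 1 := rfl
    rw [h2, h3, LinearMap.toMatrix_mul, LinearEquiv.apply_symm_apply, map_smul,
      LinearMap.toMatrix_one]
    exact h1
  have hu : IsUnit T := by
    rw [ContinuousLinearMap.isUnit_iff_bijective]
    have : IsUnit (T : A →ₗ[ℝ] A) := (LinearMap.isUnit_iff_isUnit_det _).2 hT0.isUnit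
    exact (Module.End.isUnit_iff _).1 this
  have hinv : Ring.inverse T = (LinearMap.det (T : A →ₗ[ℝ] A))⁻¹ • e' (e T).adjugate := by
    have := congrArg (fun Z => (LinearMap.det (T : A →ₗ[ℝ] A))⁻¹ • (Ring.inverse T * Z)) hmul
    simp only [← mul_assoc, Ring.inverse_mul_cancel _ hu, one_mul, mul_smul_comm, mul_one,
      smul_smul, inv_mul_cancel₀ hT0, one_smul] at this
    exact this.symm
  rw [hinv, norm_smul, norm_inv, Real.norm_eq_abs, abs_of_nonneg (by linarith)]
  calc (LinearMap.det (T : A →ₗ[ℝ] A))⁻¹ * ‖e' (e T).adjugate‖ ≤ 1 * (K * ‖T‖ ^ _) := by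
        gcongr
        · exact inv_le_one_of_one_le₀ hT
        · exact hK T hT1
    _ ≤ K * (1 + ‖T‖) ^ (Module.finrank ℝ A - 1) := by
        rw [one_mul]; gcongr; linarith

/-! ### Resolvents, the inverse square root, and the explicit inverse of φ -/

namespace TwistSystem

variable {A : Type*} [NormedAddCommGroup A] [NormedSpace ℝ A] [FiniteDimensional ℝ A]
  (Y : TwistSystem A)

/-- The resolvent `(1 + u y²)⁻¹`. -/
def res (y : A) (u : ℝ) : A →L[ℝ] A := Ring.inverse (1 + u • Y.mul y y)

lemma res_mul (y : A) {u : ℝ} (hu : 0 ≤ u) : Y.res y u * (1 + u • Y.mul y y) = 1 :=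
  Ring.inverse_mul_cancel _ (Y.isUnit_one_add_smul y hu)

lemma mul_res (y : A) {u : ℝ} (hu : 0 ≤ u) : (1 + u • Y.mul y y) * Y.res y u = 1 :=
  Ring.mul_inverse_cancel _ (Y.isUnit_one_add_smul y hu)

lemma commute_res (y : A) {u : ℝ} (hu : 0 ≤ u) {P : A →L[ℝ] A} (hP : Commute P (Y.mul y y)) :
    Commute P (Y.res y u) := by
  obtain ⟨w, hw⟩ := Y.isUnit_one_add_smul y hu
  have h : Commute P (w : A →L[ℝ] A) := by
    rw [hw]; exact (Commute.one_right P).add_right (hP.smul_right u)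
  rw [res, ← hw, Ring.inverse_unit]
  exact h.units_inv_right

lemma isMultiplier_res (y : A) {u : ℝ} (hu : 0 ≤ u) : Y.IsMultiplier (Y.res y u) := by
  have h : Y.IsMultiplier (1 + u • Y.mul y y) := fun b c d => by
    simp [Y.isMultiplier_mul y y b c d]
  intro b c d
  have h1 := h (Y.res y u b) c d
  have h2 : (1 + u • Y.mul y y : A →L[ℝ] A) (Y.res y u b) = b :=
    congrArg (fun Z : A →L[ℝ] A => Z b) (Y.mul_res y hu)
  have h3 := congrArg (Y.res y u) h1
  rw [h2] at h3
  rw [← h3]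
  exact congrArg (fun Z : A →L[ℝ] A => Z _) (Y.res_mul y hu)

lemma hasDerivAt_res (y : A) {u : ℝ} (hu : 0 ≤ u) :
    HasDerivAt (Y.res y) (-(Y.mul y y * (Y.res y u * Y.res y u))) u := by
  have : CompleteSpace A := FiniteDimensional.complete ℝ A
  obtain ⟨w, hw⟩ := Y.isUnit_one_add_smul y hu
  have h1 : HasDerivAt (fun u : ℝ => (1 + u • Y.mul y y : A →L[ℝ] A)) (Y.mul y y) u := by
    simpa using ((hasDerivAt_id u).smul_const (Y.mul y y)).const_add 1
  have h2 := hasFDerivAt_ringInverse (𝕜 := ℝ) w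
  rw [hw] at h2
  refine (h2.comp_hasDerivAt u h1).congr_deriv ?_
  have h3 : (↑w⁻¹ : A →L[ℝ] A) = Y.res y u := by rw [res, ← hw, Ring.inverse_unit]
  rw [h3]
  have := (Y.commute_res y hu (Commute.refl (Y.mul y y))).eq
  simp only [neg_apply, ContinuousLinearMap.mulLeftRight_apply, ← _root_.mul_assoc, this]

/-- The operator y² need not be symmetric for any inner product, so no spectral estimate of the
inverse is at hand; the lower bound of the determinant by 1 replaces it. -/
lemma exists_norm_res_le : ∃ (K : ℝ) (m : ℕ), 0 ≤ K ∧ ∀ (y : A) (u : ℝ), 0 ≤ u →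
    ‖Y.res y u‖ ≤ K * (1 + (1 + u) * ‖Y.mul y y‖) ^ m := by
  obtain ⟨K, m, hK0, hK⟩ := exists_bound_ringInverse A
  refine ⟨K * 2 ^ m, m, by positivity, fun y u hu => ?_⟩
  refine (hK _ (Y.one_le_det y hu)).trans ?_
  rw [mul_assoc, ← mul_pow]
  gcongr
  calc 1 + ‖1 + u • Y.mul y y‖ ≤ 1 + (‖(1 : A →L[ℝ] A)‖ + ‖u • Y.mul y y‖) := by
        gcongr; exact norm_add_le _ _
    _ ≤ 1 + (1 + (1 + u) * ‖Y.mul y y‖) := by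
        gcongr
        · exact ContinuousLinearMap.norm_id_le
        · rw [norm_smul, Real.norm_eq_abs, abs_of_nonneg hu]; gcongr; linarith
    _ ≤ _ := by nlinarith [mul_nonneg (add_nonneg zero_le_one hu) (norm_nonneg (Y.mul y y))]

lemma continuousOn_res (y : A) : ContinuousOn (Y.res y) (Set.Ici 0) := fun _ hu =>
  (Y.hasDerivAt_res y hu).continuousAt.continuousWithinAt

lemma continuous_res_comp (y : A) {X : Type*} [TopologicalSpace X] {f : X → ℝ} (hf : Continuous f)
    (h0 : ∀ x, 0 ≤ f x) : Continuous fun x => Y.res y (f x) :=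
  (Y.continuousOn_res y).comp_continuous hf h0

/-- The inverse square root `(1 + t² y²)^(-1/2)`, as an integral of resolvents. -/
def invSqrt (y : A) (t : ℝ) : A →L[ℝ] A :=
  (2 / Real.pi) • ∫ θ in (0 : ℝ)..(Real.pi / 2), Y.res y (t ^ 2 * Real.sin θ ^ 2)

lemma continuous_res_sin (y : A) (t : ℝ) :
    Continuous fun θ : ℝ => Y.res y (t ^ 2 * Real.sin θ ^ 2) :=
  Y.continuous_res_comp y (by fun_prop) fun θ => by positivity

/-- Differentiation under the integral. On the unit ball around t the parameter t² sin²θ is at most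
(|t|+1)², which gives the uniform bound B for all resolvents involved. -/
lemma hasDerivAt_invSqrt_aux (y : A) (t : ℝ) :
    HasDerivAt (Y.invSqrt y) ((2 / Real.pi) • ∫ θ in (0 : ℝ)..(Real.pi / 2),
      (2 * t * Real.sin θ ^ 2) • -(Y.mul y y * (Y.res y (t ^ 2 * Real.sin θ ^ 2) *
        Y.res y (t ^ 2 * Real.sin θ ^ 2)))) t := by
  refine HasDerivAt.const_smul (2 / Real.pi) (f := fun t : ℝ => ∫ θ in (0 : ℝ)..(Real.pi / 2), Y.res y (t ^ 2 * Real.sin θ ^ 2)) ?_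
  obtain ⟨K, m, hK0, hK⟩ := Y.exists_norm_res_le
  set B := K * (1 + (1 + (|t| + 1) ^ 2) * ‖Y.mul y y‖) ^ m with hB
  have hres : ∀ s ∈ Metric.ball t 1, ∀ θ : ℝ, ‖Y.res y (s ^ 2 * Real.sin θ ^ 2)‖ ≤ B := by
    intro s hs θ
    refine (hK y _ (by positivity)).trans ?_
    have h1 : s ^ 2 * Real.sin θ ^ 2 ≤ (|t| + 1) ^ 2 := by
      have h2 : |s| ≤ |t| + 1 := by
        rw [Metric.mem_ball, Real.dist_eq] at hs
        have := abs_sub_abs_le_abs_sub s t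
        linarith
      calc s ^ 2 * Real.sin θ ^ 2 ≤ s ^ 2 * 1 := by
            gcongr; exact Real.sin_sq_le_one θ
        _ = |s| ^ 2 := by rw [mul_one, sq_abs]
        _ ≤ _ := by gcongr
    rw [hB]; gcongr
  refine (intervalIntegral.hasDerivAt_integral_of_dominated_loc_of_deriv_le
    (bound := fun _ => (2 * (|t| + 1)) * (‖Y.mul y y‖ * (B * B)))
    (F' := fun s θ => (2 * s * Real.sin θ ^ 2) • -(Y.mul y y * (Y.res y (s ^ 2 * Real.sin θ ^ 2) *
        Y.res y (s ^ 2 * Real.sin θ ^ 2))))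
    (Metric.ball_mem_nhds t one_pos) ?_ ?_ ?_ ?_ ?_ ?_).2
  · exact Filter.Eventually.of_forall fun s => (Y.continuous_res_sin y s).aestronglyMeasurable
  · exact (Y.continuous_res_sin y t).intervalIntegrable _ _
  · have := Y.continuous_res_sin y t
    exact Continuous.aestronglyMeasurable (by fun_prop)
  · refine Filter.Eventually.of_forall fun θ _ s hs => ?_
    rw [norm_smul, norm_neg]
    have h2 : |s| ≤ |t| + 1 := by
      rw [Metric.mem_ball, Real.dist_eq] at hs
      have := abs_sub_abs_le_abs_sub s t
      linarith
    have hB0 : 0 ≤ B := by positivity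
    gcongr
    · rw [Real.norm_eq_abs, abs_mul, abs_mul, abs_two, abs_of_nonneg (sq_nonneg (Real.sin θ))]
      calc 2 * |s| * Real.sin θ ^ 2 ≤ 2 * (|t| + 1) * 1 := by
            gcongr; exact Real.sin_sq_le_one θ
        _ = _ := mul_one _
    · refine (norm_mul_le _ _).trans ?_
      gcongr
      refine (norm_mul_le _ _).trans ?_
      gcongr <;> exact hres s hs θ
  · exact continuous_const.intervalIntegrable _ _
  · refine Filter.Eventually.of_forall fun θ _ s hs => ?_
    have h1 : HasDerivAt (fun s : ℝ => s ^ 2 * Real.sin θ ^ 2) (2 * s * Real.sin θ ^ 2) s := by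
      simpa using (hasDerivAt_pow 2 s).mul_const (Real.sin θ ^ 2)
    exact (Y.hasDerivAt_res y (by positivity)).scomp s h1

/-- A total derivative whose primitive vanishes at θ = 0 and θ = π/2. Integrating it gives a linear
relation between the integrals of sin²θ Q² and of Q, where Q is the resolvent, and this relation is
the differential equation of `invSqrt`. -/
lemma hasDerivAt_sin_mul_cos_smul_res (y : A) (t θ : ℝ) :
    HasDerivAt (fun θ : ℝ => (Real.sin θ * Real.cos θ) • Y.res y (t ^ 2 * Real.sin θ ^ 2))
      ((1 + t ^ 2 • Y.mul y y) * ((2 * Real.sin θ ^ 2) •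
        -(Y.res y (t ^ 2 * Real.sin θ ^ 2) * Y.res y (t ^ 2 * Real.sin θ ^ 2)))
        + Y.res y (t ^ 2 * Real.sin θ ^ 2)) θ := by
  have hu : 0 ≤ t ^ 2 * Real.sin θ ^ 2 := by positivity
  have h1 : HasDerivAt (fun θ : ℝ => t ^ 2 * Real.sin θ ^ 2)
      (t ^ 2 * (2 * Real.sin θ * Real.cos θ)) θ := by
    simpa using ((Real.hasDerivAt_sin θ).pow 2).const_mul (t ^ 2)
  have h2 := (Y.hasDerivAt_res y hu).scomp θ h1
  have h3 := (Real.hasDerivAt_sin θ).mul (Real.hasDerivAt_cos θ)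
  refine (h3.smul h2).congr_deriv ?_
  simp only [Function.comp_apply]
  set S := Y.mul y y
  set Q := Y.res y (t ^ 2 * Real.sin θ ^ 2) with hQ
  -- The resolvent identity expresses every term through Q² and SQ², after which only trigonometry
  -- remains.
  have hQ1 : Q = Q * Q + (t ^ 2 * Real.sin θ ^ 2) • (S * (Q * Q)) := by
    have := congrArg (· * Q) (Y.mul_res y hu)
    simp only [one_mul] at this
    rw [← hQ] at this
    conv_lhs => rw [← this]
    simp only [add_mul, one_mul, smul_mul_assoc, _root_.mul_assoc]
    rfl
  have hc : Real.cos θ * Real.cos θ = 1 - Real.sin θ ^ 2 := by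
    rw [← pow_two, Real.cos_sq']
  have e1 : (Real.cos θ * Real.cos θ + Real.sin θ * -Real.sin θ) = 1 - 2 * Real.sin θ ^ 2 := by
    rw [hc]; ring
  have e2 : Real.sin θ * Real.cos θ * (t ^ 2 * (2 * Real.sin θ * Real.cos θ))
      = t ^ 2 * (2 * Real.sin θ ^ 2 * (1 - Real.sin θ ^ 2)) := by
    rw [← hc]; ring
  simp only [e1]
  simp only [Pi.mul_apply, smul_smul, e2, add_mul, one_mul, smul_mul_assoc, smul_neg, mul_neg,
    mul_smul_comm]
  generalize S * (Q * Q) = Z at *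
  generalize hQQ : Q * Q = Q2 at *
  rw [hQ1]
  module

/-- The differential equation (1 + t²y²)R' = -t y²R of the inverse square root. -/
lemma hasDerivAt_invSqrt (y : A) (t : ℝ) : HasDerivAt (Y.invSqrt y)
    (-(t • (Y.res y (t ^ 2) * (Y.mul y y * Y.invSqrt y t)))) t := by
  refine (Y.hasDerivAt_invSqrt_aux y t).congr_deriv ?_
  -- It is enough to check the equation multiplied by 1 + t²y², since the resolvent removes this
  -- factor.
  suffices h : ∀ R', (1 + t ^ 2 • Y.mul y y) * R' = -(t • (Y.mul y y * Y.invSqrt y t)) →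
      R' = -(t • (Y.res y (t ^ 2) * (Y.mul y y * Y.invSqrt y t))) by
    apply h
    have hc := Y.continuous_res_sin y t
    have h0 : ∫ θ in (0 : ℝ)..(Real.pi / 2), ((1 + t ^ 2 • Y.mul y y) * ((2 * Real.sin θ ^ 2) •
          -(Y.res y (t ^ 2 * Real.sin θ ^ 2) * Y.res y (t ^ 2 * Real.sin θ ^ 2)))
          + Y.res y (t ^ 2 * Real.sin θ ^ 2)) = 0 := by
      rw [intervalIntegral.integral_eq_sub_of_hasDerivAt
        (fun θ _ => Y.hasDerivAt_sin_mul_cos_smul_res y t θ)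
        (Continuous.intervalIntegrable (by fun_prop) _ _)]
      simp
    have hcl : ∀ (P : A →L[ℝ] A) {f : ℝ → (A →L[ℝ] A)} (hf : Continuous f),
        ∫ θ in (0 : ℝ)..(Real.pi / 2), P * f θ = P * ∫ θ in (0 : ℝ)..(Real.pi / 2), f θ := by
      intro P f hf
      have : CompleteSpace A := FiniteDimensional.complete ℝ A
      exact (ContinuousLinearMap.mul ℝ (A →L[ℝ] A) P).intervalIntegral_comp_comm
        (hf.intervalIntegrable _ _)
    rw [intervalIntegral.integral_add (Continuous.intervalIntegrable (by fun_prop) _ _)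
      (hc.intervalIntegrable _ _), hcl _ (by fun_prop)] at h0
    have h1 : ∀ θ : ℝ, (2 * t * Real.sin θ ^ 2) • -(Y.mul y y * (Y.res y (t ^ 2 * Real.sin θ ^ 2) *
          Y.res y (t ^ 2 * Real.sin θ ^ 2))) = t • (Y.mul y y * ((2 * Real.sin θ ^ 2) •
          -(Y.res y (t ^ 2 * Real.sin θ ^ 2) * Y.res y (t ^ 2 * Real.sin θ ^ 2)))) := by
      intro θ
      rw [mul_smul_comm, smul_smul, mul_neg]
      congr 1
      ring
    simp only [h1]
    rw [intervalIntegral.integral_smul, hcl _ (by fun_prop)]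
    set I := ∫ θ in (0 : ℝ)..(Real.pi / 2), (2 * Real.sin θ ^ 2) •
          -(Y.res y (t ^ 2 * Real.sin θ ^ 2) * Y.res y (t ^ 2 * Real.sin θ ^ 2)) with hI
    set J := ∫ θ in (0 : ℝ)..(Real.pi / 2), Y.res y (t ^ 2 * Real.sin θ ^ 2) with hJ
    have hR : Y.invSqrt y t = (2 / Real.pi) • J := rfl
    have h2 : (1 + t ^ 2 • Y.mul y y) * I = -J := eq_neg_of_add_eq_zero_left h0
    rw [hR]
    have hcomm : (1 + t ^ 2 • Y.mul y y) * Y.mul y y = Y.mul y y * (1 + t ^ 2 • Y.mul y y) := by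
      simp [mul_add, add_mul]
    rw [mul_smul_comm, mul_smul_comm, ← _root_.mul_assoc, hcomm, _root_.mul_assoc, h2,
      mul_smul_comm, mul_neg, smul_comm t]
    simp
  intro R' hR'
  have := congrArg (Y.res y (t ^ 2) * ·) hR'
  simpa only [← _root_.mul_assoc, Y.res_mul y (sq_nonneg t), one_mul, mul_neg, mul_smul_comm]
    using this

lemma invSqrt_zero (y : A) : Y.invSqrt y 0 = 1 := by
  have h : ∀ θ : ℝ, Y.res y (0 ^ 2 * Real.sin θ ^ 2) = 1 := fun θ => by simp [res]
  simp only [invSqrt, h, intervalIntegral.integral_const, sub_zero, smul_smul]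
  rw [show 2 / Real.pi * (Real.pi / 2) = 1 by field_simp, one_smul]

lemma commute_invSqrt (y : A) (t : ℝ) {P : A →L[ℝ] A} (hP : Commute P (Y.mul y y)) :
    Commute P (Y.invSqrt y t) := by
  have : CompleteSpace A := FiniteDimensional.complete ℝ A
  refine Commute.smul_right ?_ _
  have hi := (Y.continuous_res_sin y t).intervalIntegrable (μ := volume) 0 (Real.pi / 2)
  have h1 := (ContinuousLinearMap.mul ℝ (A →L[ℝ] A) P).intervalIntegral_comp_comm hi
  have h2 := ((ContinuousLinearMap.mul ℝ (A →L[ℝ] A)).flip P).intervalIntegral_comp_comm hi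
  simp only [ContinuousLinearMap.mul_apply', ContinuousLinearMap.flip_apply] at h1 h2
  rw [Commute, SemiconjBy, ← h1, ← h2]
  congr 1
  ext1 θ
  exact (Y.commute_res y (by positivity) hP).eq

lemma isMultiplier_invSqrt (y : A) (t : ℝ) : Y.IsMultiplier (Y.invSqrt y t) := by
  have : CompleteSpace A := FiniteDimensional.complete ℝ A
  intro b c d
  have hi := (Y.continuous_res_sin y t).intervalIntegrable (μ := volume) 0 (Real.pi / 2)
  have h1 : ∀ v, (∫ θ in (0 : ℝ)..(Real.pi / 2), Y.res y (t ^ 2 * Real.sin θ ^ 2)) v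
      = ∫ θ in (0 : ℝ)..(Real.pi / 2), Y.res y (t ^ 2 * Real.sin θ ^ 2) v := fun v =>
    ((ContinuousLinearMap.apply ℝ A v).intervalIntegral_comp_comm hi).symm
  have hc : ∀ v, Continuous fun θ : ℝ => Y.res y (t ^ 2 * Real.sin θ ^ 2) v := fun v =>
    (Y.continuous_res_sin y t).clm_apply continuous_const
  have h2 := (((ContinuousLinearMap.apply ℝ A d).comp
    (((ContinuousLinearMap.apply ℝ (A →L[ℝ] A) c).comp Y.mul)))).intervalIntegral_comp_comm
      ((hc b).intervalIntegrable (μ := volume) 0 (Real.pi / 2))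
  simp only [ContinuousLinearMap.comp_apply, ContinuousLinearMap.apply_apply] at h2
  simp only [invSqrt, smul_apply, map_smul, h1]
  rw [← h2]
  congr 2
  ext1 θ
  exact Y.isMultiplier_res y (by positivity) b c d

/-- All operators here commute, so by the differential equation R²(1 + t²y²) has zero derivative; it
equals 1 at t = 0. -/
lemma invSqrt_sq (y : A) (t : ℝ) :
    Y.invSqrt y t * (Y.invSqrt y t * (1 + t ^ 2 • Y.mul y y)) = 1 := by
  have hd : ∀ s, HasDerivAt (fun s => Y.invSqrt y s * (Y.invSqrt y s * (1 + s ^ 2 • Y.mul y y)))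
      0 s := by
    intro s
    have h1 : HasDerivAt (fun s : ℝ => (1 + s ^ 2 • Y.mul y y : A →L[ℝ] A))
        ((2 * s) • Y.mul y y) s := by
      simpa using ((hasDerivAt_pow 2 s).smul_const (Y.mul y y)).const_add 1
    refine ((Y.hasDerivAt_invSqrt y s).mul ((Y.hasDerivAt_invSqrt y s).mul h1)).congr_deriv ?_
    simp only [Pi.mul_apply]
    have hSR := (Y.commute_invSqrt y s (Commute.refl (Y.mul y y))).eq
    have hQR := (Y.commute_invSqrt y s (Y.commute_res y (sq_nonneg s)
      (Commute.refl (Y.mul y y))).symm).eq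
    have hSP : Commute (Y.mul y y) (1 + s ^ 2 • Y.mul y y) :=
      (Commute.one_right _).add_right ((Commute.refl _).smul_right _)
    have hRP := (Y.commute_invSqrt y s hSP.symm).eq
    have hQP := Y.res_mul y (sq_nonneg s)
    replace hSP := hSP.eq
    set P := (1 + s ^ 2 • Y.mul y y : A →L[ℝ] A)
    set Q := Y.res y (s ^ 2)
    set R := Y.invSqrt y s
    set S := Y.mul y y
    have h2 : Q * (S * R) * P = S * R := by
      rw [_root_.mul_assoc, _root_.mul_assoc, ← hRP, ← _root_.mul_assoc S, hSP, _root_.mul_assoc,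
        ← _root_.mul_assoc, hQP, one_mul]
    have h3 : Q * (S * R) * (R * P) = R * (S * R) := by
      rw [← hRP, ← _root_.mul_assoc, h2, ← _root_.mul_assoc, ← hSR]
    simp only [neg_mul, smul_mul_assoc, h2, h3]
    simp only [mul_add, mul_neg, mul_smul_comm, hSR]
    module
  have := is_const_of_deriv_eq_zero (fun s => (hd s).differentiableAt) (fun s => (hd s).deriv) t 0
  simpa [Y.invSqrt_zero] using this

lemma continuous_invSqrt (y : A) : Continuous (Y.invSqrt y) :=
  continuous_iff_continuousAt.2 fun t => (Y.hasDerivAt_invSqrt y t).continuousAt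

/-- The curve along which `φ` is linear. -/
def arsinhCurve (y : A) (t : ℝ) : A := ∫ s in (0 : ℝ)..t, Y.invSqrt y s y

lemma hasDerivAt_arsinhCurve (y : A) (t : ℝ) :
    HasDerivAt (Y.arsinhCurve y) (Y.invSqrt y t y) t := by
  have : CompleteSpace A := FiniteDimensional.complete ℝ A
  have hc : Continuous fun s => Y.invSqrt y s y :=
    (Y.continuous_invSqrt y).clm_apply continuous_const
  exact intervalIntegral.integral_hasDerivAt_right (hc.intervalIntegrable _ _)
    (hc.stronglyMeasurableAtFilter _ _) hc.continuousAt

lemma arsinhCurve_zero (y : A) : Y.arsinhCurve y 0 = 0 := by simp [arsinhCurve]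

/-- The operator `√(1 + t² y²)`. -/
def sqrtOp (y : A) (t : ℝ) : A →L[ℝ] A := Y.invSqrt y t * (1 + t ^ 2 • Y.mul y y)

lemma invSqrt_mul_sqrtOp (y : A) (t : ℝ) : Y.invSqrt y t * Y.sqrtOp y t = 1 := Y.invSqrt_sq y t

lemma hasDerivAt_sqrtOp (y : A) (t : ℝ) :
    HasDerivAt (Y.sqrtOp y) (t • (Y.mul y y * Y.invSqrt y t)) t := by
  have h1 : HasDerivAt (fun s : ℝ => (1 + s ^ 2 • Y.mul y y : A →L[ℝ] A))
      ((2 * t) • Y.mul y y) t := by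
    simpa using ((hasDerivAt_pow 2 t).smul_const (Y.mul y y)).const_add 1
  refine ((Y.hasDerivAt_invSqrt y t).mul h1).congr_deriv ?_
  have hSR := (Y.commute_invSqrt y t (Commute.refl (Y.mul y y))).eq
  have hSP : Commute (Y.mul y y) (1 + t ^ 2 • Y.mul y y) :=
    (Commute.one_right _).add_right ((Commute.refl _).smul_right _)
  have hRP := (Y.commute_invSqrt y t hSP.symm).eq
  have hQP := Y.res_mul y (sq_nonneg t)
  replace hSP := hSP.eq
  set P := (1 + t ^ 2 • Y.mul y y : A →L[ℝ] A)
  set Q := Y.res y (t ^ 2)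
  set R := Y.invSqrt y t
  set S := Y.mul y y
  have h2 : Q * (S * R) * P = S * R := by
    rw [_root_.mul_assoc, _root_.mul_assoc, ← hRP, ← _root_.mul_assoc S, hSP, _root_.mul_assoc,
      ← _root_.mul_assoc, hQP, one_mul]
  simp only [neg_mul, smul_mul_assoc, h2]
  simp only [mul_smul_comm, hSR]
  module

/-- This is cosh(arsinh(ty)) = √(1 + t²y²). With D = √(1 + s²y²) and W = y·φ(γ(s)), the expressions
CD - sW and WD - s y²C are constant along the curve, with values 1 and 0; eliminating W leaves CR =
1. -/
lemma C_arsinhCurve_mul_invSqrt (y : A) (t : ℝ) :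
    Y.C (Y.arsinhCurve y t) * Y.invSqrt y t = 1 := by
  set γ := Y.arsinhCurve y with hγ
  set C := fun s => Y.C (γ s) with hC
  set W := fun s => Y.mul y (Y.φ (γ s)) with hW
  set R := Y.invSqrt y with hR
  set D := Y.sqrtOp y with hD
  set S := Y.mul y y with hS
  have hRD : ∀ s, R s * D s = 1 := Y.invSqrt_mul_sqrtOp y
  have hRm : ∀ s, Y.IsMultiplier (R s) := Y.isMultiplier_invSqrt y
  have hCm : ∀ s, Y.IsMultiplier (C s) := fun s => Y.isMultiplier_C _
  have hCS : ∀ s, C s * S = S * C s := fun s => ((hCm s).commute y y).eq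
  have hCR : ∀ s, C s * R s = R s * C s := fun s =>
    (Y.commute_invSqrt y s ((hCm s).commute y y)).eq
  have hRS : ∀ s, R s * S = S * R s := fun s => ((hRm s).commute y y).eq
  have hRW : ∀ s, R s * W s = W s * R s := fun s => ((hRm s).commute y _).eq
  have hWS : ∀ s, W s * S = S * W s := fun s => ((Y.isMultiplier_mul y (Y.φ (γ s))).commute y y).eq
  have hDR : ∀ s, D s * R s = 1 := fun s => by
    have hRP := (Y.commute_invSqrt y s (P := 1 + s ^ 2 • S)
      ((Commute.one_left _).add_left ((Commute.refl S).smul_left _))).eq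
    calc D s * R s = R s * ((1 + s ^ 2 • S) * R s) := _root_.mul_assoc _ _ _
      _ = R s * D s := by rw [hRP]; rfl
      _ = 1 := hRD s
  have hCd : ∀ s, HasDerivAt C (W s * R s) s := fun s => by
    refine (Y.hasDerivAt_C (Y.hasDerivAt_arsinhCurve y s)).congr_deriv ?_
    rw [(hRm s).mul_left]; exact hRW s
  have hWd : ∀ s, HasDerivAt W (C s * (R s * S)) s := fun s => by
    refine (Y.hasDerivAt_mul_φ y (Y.hasDerivAt_arsinhCurve y s)).congr_deriv ?_
    change Y.mul y (C s (R s y)) = _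
    rw [(hCm s).mul_right, (hRm s).mul_right]
  have hDd : ∀ s, HasDerivAt D (s • (S * R s)) s := Y.hasDerivAt_sqrtOp y
  have hP : ∀ s, HasDerivAt (fun s => C s * D s - s • W s) 0 s := fun s => by
    refine (((hCd s).mul (hDd s)).sub ((hasDerivAt_id s).smul (hWd s))).congr_deriv ?_
    simp only [id, one_smul]
    rw [_root_.mul_assoc (W s), hRD, mul_one, mul_smul_comm, hRS]
    abel
  have hQ : ∀ s, HasDerivAt (fun s => W s * D s - s • (S * C s)) 0 s := fun s => by
    refine (((hWd s).mul (hDd s)).sub ((hasDerivAt_id s).smul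
      ((hCd s).const_mul S))).congr_deriv ?_
    simp only [id, one_smul]
    rw [hRS, _root_.mul_assoc (C s), _root_.mul_assoc S, hRD, mul_one, hCS, mul_smul_comm,
      ← _root_.mul_assoc (W s), hWS, _root_.mul_assoc S]
    abel
  have hP1 := is_const_of_deriv_eq_zero (fun s => (hP s).differentiableAt) (fun s => (hP s).deriv) t 0
  have hQ1 := is_const_of_deriv_eq_zero (fun s => (hQ s).differentiableAt) (fun s => (hQ s).deriv) t 0
  have hC0 : C 0 = 1 := by simp only [hC, hγ, Y.arsinhCurve_zero, Y.C_zero]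
  have hW0 : W 0 = 0 := by simp only [hW, hγ, Y.arsinhCurve_zero, Y.φ_zero, map_zero]
  have hD0 : D 0 = 1 := by simp [hD, sqrtOp, Y.invSqrt_zero]
  simp only [hC0, hW0, hD0, zero_smul, sub_zero, mul_one] at hP1 hQ1
  have hW1 : W t = t • (S * C t * R t) := by
    have := congrArg (· * R t) (sub_eq_zero.1 hQ1)
    simpa only [_root_.mul_assoc, hDR, mul_one, smul_mul_assoc] using this
  have hDe : D t = R t + t ^ 2 • (S * R t) := by
    simp only [hD, sqrtOp, mul_add, mul_one, mul_smul_comm, ← hR, ← hS, hRS]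
  rw [hW1, hDe, mul_add, mul_smul_comm, smul_smul, ← pow_two, ← _root_.mul_assoc (C t), hCS,
    add_sub_cancel_right] at hP1
  exact hP1

/-- Along the curve φ has derivative C(γ)Ry = y. This yields surjectivity of φ and a formula for its
inverse. -/
lemma φ_arsinhCurve (y : A) (t : ℝ) : Y.φ (Y.arsinhCurve y t) = t • y := by
  have hd : ∀ s, HasDerivAt (fun s => Y.φ (Y.arsinhCurve y s) - s • y) 0 s := fun s => by
    refine ((Y.hasDerivAt_φ (Y.hasDerivAt_arsinhCurve y s)).sub
      ((hasDerivAt_id s).smul_const y)).congr_deriv ?_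
    have := congrArg (fun Z : A →L[ℝ] A => Z y) (Y.C_arsinhCurve_mul_invSqrt y s)
    change Y.C (Y.arsinhCurve y s) (Y.invSqrt y s y) = y at this
    rw [this, one_smul, sub_self]
  have := is_const_of_deriv_eq_zero (fun s => (hd s).differentiableAt) (fun s => (hd s).deriv) t 0
  simpa [Y.arsinhCurve_zero, Y.φ_zero, sub_eq_zero] using this

lemma φ_bijective : Function.Bijective Y.φ :=
  ⟨Y.φ_injective, fun y => ⟨Y.arsinhCurve y 1, by rw [φ_arsinhCurve, one_smul]⟩⟩

lemma exists_norm_mul_self_le : ∃ B, 0 ≤ B ∧ ∀ y, ‖Y.mul y y‖ ≤ B * ‖y‖ ^ 2 := by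
  obtain ⟨B, hB0, hB⟩ := exists_bound_of_homogeneous (f := fun y => Y.mul y y) (m := 2)
    (Y.mul.continuous.clm_apply continuous_id) fun c v => by
      simp only [map_smul, smul_apply, smul_smul, pow_two]
  refine ⟨B, hB0, fun y => ?_⟩
  rcases eq_or_ne y 0 with rfl | hy
  · simp
  · exact hB y hy

lemma exists_norm_invSqrt_le : ∃ (K : ℝ) (m : ℕ), 0 ≤ K ∧ ∀ (y : A) (t : ℝ), |t| ≤ 1 →
    ‖Y.invSqrt y t‖ ≤ K * (1 + ‖y‖) ^ m := by
  obtain ⟨K, m, hK0, hK⟩ := Y.exists_norm_res_le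
  obtain ⟨B, hB0, hB⟩ := Y.exists_norm_mul_self_le
  refine ⟨K * (1 + 2 * B) ^ m, 2 * m, by positivity, fun y t ht => ?_⟩
  have hb : ∀ θ : ℝ, ‖Y.res y (t ^ 2 * Real.sin θ ^ 2)‖
      ≤ K * (1 + 2 * B) ^ m * (1 + ‖y‖) ^ (2 * m) := by
    intro θ
    have h1 : t ^ 2 * Real.sin θ ^ 2 ≤ 1 := by
      have := Real.sin_sq_le_one θ
      have : t ^ 2 ≤ 1 := by rw [← sq_abs]; exact pow_le_one₀ (abs_nonneg t) ht
      nlinarith [sq_nonneg t, sq_nonneg (Real.sin θ)]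
    have h2 := hB y
    refine (hK y _ (by positivity)).trans ?_
    rw [_root_.mul_assoc K, pow_mul, ← mul_pow (1 + 2 * B)]
    have h3 : 1 + (1 + t ^ 2 * Real.sin θ ^ 2) * ‖Y.mul y y‖ ≤ (1 + 2 * B) * (1 + ‖y‖) ^ 2 :=
      calc _ ≤ 1 + (1 + 1) * (B * ‖y‖ ^ 2) := by gcongr
        _ ≤ (1 + 2 * B) * (1 + ‖y‖) ^ 2 := by
          nlinarith [norm_nonneg y, mul_nonneg hB0 (norm_nonneg y)]
    exact mul_le_mul_of_nonneg_left (pow_le_pow_left₀ (by positivity) h3 m) hK0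
  have := intervalIntegral.norm_integral_le_of_norm_le_const (a := (0 : ℝ)) (b := Real.pi / 2)
    (f := fun θ => Y.res y (t ^ 2 * Real.sin θ ^ 2)) fun θ _ => hb θ
  rw [invSqrt, norm_smul, Real.norm_of_nonneg (by positivity)]
  rw [sub_zero, abs_of_nonneg (by positivity)] at this
  calc _ ≤ 2 / Real.pi * (K * (1 + 2 * B) ^ m * (1 + ‖y‖) ^ (2 * m) * (Real.pi / 2)) := by
        gcongr
    _ = _ := by field_simp

/-- By injectivity a is the endpoint of the curve attached to y = φ(a), and C(a) = √(1 + y²) there;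
both inherit the polynomial bound of `invSqrt` in y. Thus φ⁻¹ grows at most polynomially, and cosh
is polynomially bounded by sinh. -/
lemma exists_norm_le : ∃ (K : ℝ) (m : ℕ), 0 ≤ K ∧ ∀ a,
    ‖a‖ ≤ K * (1 + ‖Y.φ a‖) ^ m ∧ ‖Y.C a‖ ≤ K * (1 + ‖Y.φ a‖) ^ m := by
  obtain ⟨K, m, hK0, hK⟩ := Y.exists_norm_invSqrt_le
  obtain ⟨B, hB0, hB⟩ := Y.exists_norm_mul_self_le
  refine ⟨K * (1 + B), m + 2, by positivity, fun a => ?_⟩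
  have ha : a = Y.arsinhCurve (Y.φ a) 1 := Y.φ_injective (by rw [φ_arsinhCurve, one_smul])
  have h1 : 1 ≤ 1 + ‖Y.φ a‖ := by linarith [norm_nonneg (Y.φ a)]
  constructor
  · have := intervalIntegral.norm_integral_le_of_norm_le_const (a := (0 : ℝ)) (b := 1)
      (f := fun s => Y.invSqrt (Y.φ a) s (Y.φ a)) (C := K * (1 + ‖Y.φ a‖) ^ m * ‖Y.φ a‖) fun s hs => by
        refine ((Y.invSqrt (Y.φ a) s).le_opNorm _).trans ?_
        gcongr
        apply hK
        rw [Set.uIoc_of_le zero_le_one] at hs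
        rw [abs_of_pos hs.1]; exact hs.2
    rw [sub_zero, abs_one, mul_one] at this
    calc ‖a‖ = ‖Y.arsinhCurve (Y.φ a) 1‖ := by rw [← ha]
      _ ≤ K * (1 + ‖Y.φ a‖) ^ m * ‖Y.φ a‖ := this
      _ ≤ K * (1 + ‖Y.φ a‖) ^ m * ((1 + B) * (1 + ‖Y.φ a‖) ^ 2) := by
          gcongr
          nlinarith [norm_nonneg (Y.φ a), mul_nonneg hB0 (sq_nonneg (1 + ‖Y.φ a‖))]
      _ = _ := by ring
  · have h2 : Y.C a = Y.sqrtOp (Y.φ a) 1 := by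
      have h3 := congrArg (· * Y.sqrtOp (Y.φ a) 1) (Y.C_arsinhCurve_mul_invSqrt (Y.φ a) 1)
      simp only [_root_.mul_assoc, Y.invSqrt_mul_sqrtOp, one_mul, mul_one] at h3
      rw [← h3, ← ha]
    rw [h2, sqrtOp]
    calc _ ≤ ‖Y.invSqrt (Y.φ a) 1‖ * ‖1 + (1 : ℝ) ^ 2 • Y.mul (Y.φ a) (Y.φ a)‖ := norm_mul_le _ _
      _ ≤ K * (1 + ‖Y.φ a‖) ^ m * (1 + B * ‖Y.φ a‖ ^ 2) := by
          gcongr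
          · exact hK _ _ (by simp)
          · rw [one_pow, one_smul]
            refine (norm_add_le _ _).trans ?_
            gcongr
            · exact ContinuousLinearMap.norm_id_le
            · exact hB _
      _ ≤ K * (1 + ‖Y.φ a‖) ^ m * ((1 + B) * (1 + ‖Y.φ a‖) ^ 2) := by
          gcongr
          nlinarith [norm_nonneg (Y.φ a), mul_nonneg hB0 (norm_nonneg (Y.φ a))]
      _ = _ := by ring

set_option maxSynthPendingDepth 3 in
/-- The linear map `𝓛` such that `(φ, C)` solves the linear differential equation `DΨ = 𝓛 Ψ`. -/
def genOp : (A × (A →L[ℝ] A)) →L[ℝ] A →L[ℝ] (A × (A →L[ℝ] A)) :=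
  LinearMap.toContinuousLinearMap
    { toFun := fun z => z.2.prod (Y.mul.flip z.1)
      map_add' := fun z w => by ext <;> simp
      map_smul' := fun c z => by ext <;> simp }

lemma hasFDerivAt_φ_C (a : A) :
    HasFDerivAt (fun a => (Y.φ a, Y.C a)) (Y.genOp (Y.φ a, Y.C a)) a :=
  (Y.hasFDerivAt_φ a).prodMk (Y.hasFDerivAt_C a)

set_option maxSynthPendingDepth 3 in
-- Bootstrap: the derivative of (φ, C) is a continuous linear function of (φ, C) itself.
lemma contDiff_φ_C : ContDiff ℝ ∞ (fun a => (Y.φ a, Y.C a)) := by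
  rw [contDiff_infty]
  intro n
  induction n with
  | zero =>
    exact contDiff_zero.2 (continuous_iff_continuousAt.2 fun a => (Y.hasFDerivAt_φ_C a).continuousAt)
  | succ n ih =>
    rw [show ((n + 1 : ℕ) : WithTop ℕ∞) = n + 1 by norm_cast, contDiff_succ_iff_hasFDerivAt]
    refine ⟨fun a => Y.genOp (Y.φ a, Y.C a), Y.genOp.contDiff.comp ih, Y.hasFDerivAt_φ_C⟩

lemma contDiff_φ : ContDiff ℝ ∞ Y.φ := Y.contDiff_φ_C.fst

set_option maxSynthPendingDepth 3 in
-- Each differentiation of a solution of DΨ = 𝓛Ψ costs one factor ‖𝓛‖, so no derivative grows faster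
-- than (φ, C).
lemma norm_iteratedFDeriv_φ_C_le (n : ℕ) (a : A) :
    ‖iteratedFDeriv ℝ n (fun a => (Y.φ a, Y.C a)) a‖ ≤ ‖Y.genOp‖ ^ n * ‖(Y.φ a, Y.C a)‖ := by
  induction n with
  | zero => simp
  | succ n ih =>
    have h : fderiv ℝ (fun a => (Y.φ a, Y.C a)) = Y.genOp ∘ fun a => (Y.φ a, Y.C a) := by
      ext1 a; exact (Y.hasFDerivAt_φ_C a).fderiv
    rw [← norm_iteratedFDeriv_fderiv, h]
    refine (Y.genOp.norm_iteratedFDeriv_comp_left (Y.contDiff_φ_C.contDiffAt (n := ∞))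
      (mod_cast le_top)).trans ?_
    rw [pow_succ', _root_.mul_assoc]
    gcongr

set_option maxSynthPendingDepth 3 in
/-- All derivatives of `φ` are polynomially bounded in terms of `φ`. -/
lemma exists_norm_iteratedFDeriv_φ_le : ∃ m : ℕ, ∀ n : ℕ, ∃ K : ℝ, ∀ a,
    ‖iteratedFDeriv ℝ n Y.φ a‖ ≤ K * (1 + ‖Y.φ a‖) ^ m := by
  obtain ⟨K, m, hK0, hK⟩ := Y.exists_norm_le
  refine ⟨m + 1, fun n => ⟨‖ContinuousLinearMap.fst ℝ A (A →L[ℝ] A)‖ * (‖Y.genOp‖ ^ n * (1 + K)),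
    fun a => ?_⟩⟩
  have h1 : 1 ≤ 1 + ‖Y.φ a‖ := by linarith [norm_nonneg (Y.φ a)]
  have h2 := (ContinuousLinearMap.fst ℝ A (A →L[ℝ] A)).norm_iteratedFDeriv_comp_left
    (Y.contDiff_φ_C.contDiffAt (n := ∞) (x := a)) (n := n) (mod_cast le_top)
  refine (h2.trans (mul_le_mul_of_nonneg_left (Y.norm_iteratedFDeriv_φ_C_le n a)
    (norm_nonneg _))).trans ?_
  rw [_root_.mul_assoc, _root_.mul_assoc]
  gcongr
  refine (max_le ?_ ?_ : max ‖Y.φ a‖ ‖Y.C a‖ ≤ _)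
  · calc ‖Y.φ a‖ ≤ 1 * (1 + ‖Y.φ a‖) ^ 1 := by linarith
      _ ≤ (1 + K) * (1 + ‖Y.φ a‖) ^ (m + 1) := by gcongr <;> linarith
  · refine (hK a).2.trans ?_
    gcongr <;> linarith

/-- `φ` is a diffeomorphism. -/
lemma exists_diffeo : ∃ Φ : Diffeos A, ∀ a, (Φ : Equiv.Perm A) a = Y.φ a := by
  have : CompleteSpace A := FiniteDimensional.complete ℝ A
  let e : Equiv.Perm A := Equiv.ofBijective Y.φ Y.φ_bijective
  -- In finite dimension the injective derivative `C a` is invertible, so the inverse function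
  -- theorem gives openness of φ and smoothness of its inverse.
  let e' : ∀ a, A ≃L[ℝ] A := fun a =>
    (LinearEquiv.ofInjectiveEndo (Y.C a : A →ₗ[ℝ] A) (Y.C_injective a)).toContinuousLinearEquiv
  have hd : ∀ a, HasFDerivAt Y.φ (e' a : A →L[ℝ] A) a := fun a => by
    have : (e' a : A →L[ℝ] A) = Y.C a := by ext v; rfl
    rw [this]; exact Y.hasFDerivAt_φ a
  have hsd : ∀ a, HasStrictFDerivAt Y.φ (e' a : A →L[ℝ] A) a := fun a =>
    (Y.contDiff_φ.contDiffAt).hasStrictFDerivAt' (hd a) (by simp)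
  have hopen : IsOpenMap Y.φ := isOpenMap_of_hasStrictFDerivAt_equiv hsd
  let h : A ≃ₜ A := e.toHomeomorphOfContinuousOpen Y.contDiff_φ.continuous hopen
  refine ⟨⟨e, Y.contDiff_φ, ?_⟩, fun a => rfl⟩
  exact h.contDiff_symm (f₀' := e') hd Y.contDiff_φ

end TwistSystem

/-! ### The twisting map of an exact triple as an abstract hyperbolic sine -/

namespace ESET

variable {𝔤 𝔞 𝔟 : Type*} [LieRing 𝔤] [LieAlgebra ℝ 𝔤]
  [NormedAddCommGroup 𝔞] [NormedSpace ℝ 𝔞] [FiniteDimensional ℝ 𝔞]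
  [NormedAddCommGroup 𝔟] [NormedSpace ℝ 𝔟] [FiniteDimensional ℝ 𝔟]
  (X : ESET 𝔤 𝔞 𝔟)

lemma commute_ρ (a a' : 𝔞) : Commute (X.ρ a) (X.ρ a') := by
  ext b
  apply X.inB_injective
  change X.inB (X.ρ a (X.ρ a' b)) = X.inB (X.ρ a' (X.ρ a b))
  have h : ⁅X.inA a, X.inA a'⁆ = 0 := X.a_abelian a a'
  rw [← lie_inA_inB, ← lie_inA_inB, ← lie_inA_inB, ← lie_inA_inB, leibniz_lie, h, zero_lie,
    zero_add]

/-- The exponential of `ρ(a)`. -/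
def expρ (a : 𝔞) : 𝔟 →L[ℝ] 𝔟 := NormedSpace.exp (X.ρ a)

lemma expρ_add (a a' : 𝔞) : X.expρ (a + a') = X.expρ a * X.expρ a' := by
  have : CompleteSpace 𝔟 := FiniteDimensional.complete ℝ 𝔟
  let _ : NormedAlgebra ℚ (𝔟 →L[ℝ] 𝔟) := NormedAlgebra.restrictScalars ℚ ℝ _
  rw [expρ, ρ_add, NormedSpace.exp_add_of_commute (X.commute_ρ a a')]; rfl

lemma expρ_zero : X.expρ 0 = 1 := by
  rw [expρ, show X.ρ 0 = 0 from map_zero X.ρL, NormedSpace.exp_zero]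

lemma commute_ρ_expρ (a a' : 𝔞) : Commute (X.ρ a) (X.expρ a') := by
  have : CompleteSpace 𝔟 := FiniteDimensional.complete ℝ 𝔟
  let _ : NormedAlgebra ℚ (𝔟 →L[ℝ] 𝔟) := NormedAlgebra.restrictScalars ℚ ℝ _
  exact (X.commute_ρ a a').exp_right

/-- Commutativity of 𝔞 gives exp ρ(x) = exp ρ(x-a) exp ρ(a), which reduces the claim to the
derivative of the exponential at 0. -/
lemma hasFDerivAt_expρ (a : 𝔞) : HasFDerivAt X.expρ
    (((ContinuousLinearMap.mul ℝ (𝔟 →L[ℝ] 𝔟)).flip (X.expρ a)).comp X.ρL) a := by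
  have : CompleteSpace 𝔟 := FiniteDimensional.complete ℝ 𝔟
  have h0 : HasFDerivAt (NormedSpace.exp : (𝔟 →L[ℝ] 𝔟) → (𝔟 →L[ℝ] 𝔟))
      (1 : (𝔟 →L[ℝ] 𝔟) →L[ℝ] (𝔟 →L[ℝ] 𝔟)) (X.ρL (a - a)) := by
    rw [sub_self, map_zero]; exact hasFDerivAt_exp_zero
  have h1 : HasFDerivAt (fun x => X.ρL (x - a)) X.ρL a := by
    have : (fun x => X.ρL (x - a)) = fun x => X.ρL x - X.ρL a := by ext1 x; rw [map_sub]
    rw [this]; exact X.ρL.hasFDerivAt.sub_const _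
  have h2 := (h0.comp a h1)
  have h3 := ((ContinuousLinearMap.mul ℝ (𝔟 →L[ℝ] 𝔟)).flip (X.expρ a)).hasFDerivAt.comp a h2
  have h4 : X.expρ = ((ContinuousLinearMap.mul ℝ (𝔟 →L[ℝ] 𝔟)).flip (X.expρ a)) ∘
      (NormedSpace.exp ∘ fun x => X.ρL (x - a)) := by
    ext1 x
    change X.expρ x = X.expρ (x - a) * X.expρ a
    rw [← expρ_add, sub_add_cancel]
  rw [← h4] at h3
  exact h3

lemma sinh_eq (a : 𝔞) : X.sinh a = (1 / 2 : ℝ) • (X.expρ a - X.expρ (-a)) := rfl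

lemma cosh_eq (a : 𝔞) : X.cosh a = (1 / 2 : ℝ) • (X.expρ a + X.expρ (-a)) := rfl

lemma sinh_neg (a : 𝔞) : X.sinh (-a) = -X.sinh a := by
  rw [sinh_eq, sinh_eq, neg_neg, ← smul_neg, neg_sub]

lemma commute_ρ_sinh (a a' : 𝔞) : Commute (X.ρ a) (X.sinh a') :=
  ((X.commute_ρ_expρ _ _).sub_right (X.commute_ρ_expρ _ _)).smul_right _

lemma commute_ρ_cosh (a a' : 𝔞) : Commute (X.ρ a) (X.cosh a') :=
  ((X.commute_ρ_expρ _ _).add_right (X.commute_ρ_expρ _ _)).smul_right _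

lemma hasFDerivAt_expρ_neg (a : 𝔞) : HasFDerivAt (fun a => X.expρ (-a))
    (-(((ContinuousLinearMap.mul ℝ (𝔟 →L[ℝ] 𝔟)).flip (X.expρ (-a))).comp X.ρL)) a := by
  have := (X.hasFDerivAt_expρ (-a)).comp a ((hasFDerivAt_id a).neg)
  refine this.congr_fderiv ?_
  ext1 v
  simp

lemma hasFDerivAt_sinh (a : 𝔞) : HasFDerivAt X.sinh
    (((ContinuousLinearMap.mul ℝ (𝔟 →L[ℝ] 𝔟)).flip (X.cosh a)).comp X.ρL) a := by
  refine (((X.hasFDerivAt_expρ a).sub (X.hasFDerivAt_expρ_neg a)).const_smul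
    (1 / 2 : ℝ)).congr_fderiv ?_
  ext1 v
  simp [cosh_eq]

lemma hasFDerivAt_cosh (a : 𝔞) : HasFDerivAt X.cosh
    (((ContinuousLinearMap.mul ℝ (𝔟 →L[ℝ] 𝔟)).flip (X.sinh a)).comp X.ρL) a := by
  refine (((X.hasFDerivAt_expρ a).add (X.hasFDerivAt_expρ_neg a)).const_smul
    (1 / 2 : ℝ)).congr_fderiv ?_
  ext1 v
  simp [sinh_eq, sub_eq_add_neg]

lemma sinh_zero : X.sinh 0 = 0 := by simp [sinh_eq]

lemma cosh_zero : X.cosh 0 = 1 := by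
  rw [cosh_eq, neg_zero, expρ_zero, ← two_smul ℝ, smul_smul]; norm_num

/-- The identity on which both uses of φ rest: it makes φ injective, and it splits the phase of a
symmetry into a function of s and a function of t. -/
lemma sinh_sub_sinh (a b : 𝔞) : X.sinh a - X.sinh b
    = (2 : ℝ) • (X.sinh ((1 / 2 : ℝ) • (a - b)) * X.cosh ((1 / 2 : ℝ) • (a + b))) := by
  simp only [sinh_eq, cosh_eq, smul_mul_assoc, mul_smul_comm, sub_mul, mul_add, ← expρ_add]
  rw [show (1 / 2 : ℝ) • (a - b) + (1 / 2 : ℝ) • (a + b) = a by module,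
    show (1 / 2 : ℝ) • (a - b) + -((1 / 2 : ℝ) • (a + b)) = -b by module,
    show -((1 / 2 : ℝ) • (a - b)) + (1 / 2 : ℝ) • (a + b) = b by module,
    show -((1 / 2 : ℝ) • (a - b)) + -((1 / 2 : ℝ) • (a + b)) = -a by module]
  module

lemma σB_ρ_apply (a : 𝔞) (b : 𝔟) : X.σB (X.ρ a b) = -X.ρ a (X.σB b) := by
  have h := congrArg (fun f : 𝔟 →L[ℝ] 𝔟 => f (X.σB b)) (X.σB_ρ a)
  have h2 : X.σB (X.σB b) = b := congrArg (fun f : 𝔟 →L[ℝ] 𝔟 => f b) X.σB_σB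
  change X.σB (X.ρ a (X.σB (X.σB b))) = X.ρ (-a) (X.σB b) at h
  rw [h2, ρ_neg] at h
  exact h

/-- The operators of `𝔟` which preserve `𝓛`. -/
def PreservesL (T : 𝔟 →L[ℝ] 𝔟) : Prop := ∀ l ∈ X.L, T l ∈ X.L

lemma preservesL_cosh (a : 𝔞) : X.PreservesL (X.cosh a) := fun _ hl => X.cosh_mem a hl

/-- The involution is -1 on 𝔞, so each ρ(a) anticommutes with it on 𝔟, and a product of two such
operators preserves the -1 eigenspace 𝓛. -/
lemma preservesL_ρ_mul_ρ (a a' : 𝔞) : X.PreservesL (X.ρ a * X.ρ a') := fun l hl => by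
  rw [mem_L_iff] at hl ⊢
  change X.σB (X.ρ a (X.ρ a' l)) = -X.ρ a (X.ρ a' l)
  simp only [σB_ρ_apply, hl, map_neg, neg_neg]

/-- The element `a` of `𝔞` with `Ω(a, l) = ξ(T l)` for all `l ∈ 𝓛`. -/
def dualVec : (𝔟 →L[ℝ] 𝔟) →L[ℝ] 𝔞 :=
  LinearMap.toContinuousLinearMap
    ((LinearEquiv.ofBijective X.pairing X.pairing_bijective).symm.toLinearMap ∘ₗ
      { toFun := fun T => X.ξ ∘ₗ X.inB ∘ₗ (T : 𝔟 →ₗ[ℝ] 𝔟) ∘ₗ X.L.subtype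
        map_add' := fun S T => by ext; simp
        map_smul' := fun c T => by ext; simp })

lemma pairing_dualVec (T : 𝔟 →L[ℝ] 𝔟) (l : X.L) :
    X.pairing (X.dualVec T) l = X.ξ (X.inB (T l)) :=
  LinearMap.congr_fun (LinearEquiv.apply_symm_apply
    (LinearEquiv.ofBijective X.pairing X.pairing_bijective)
    (X.ξ ∘ₗ X.inB ∘ₗ (T : 𝔟 →ₗ[ℝ] 𝔟) ∘ₗ X.L.subtype)) l

lemma twistingMap_eq (a : 𝔞) : X.twistingMap a = X.dualVec (X.sinh a) := rfl

lemma pairing_eq (a : 𝔞) (l : X.L) : X.pairing a l = X.ξ (X.inB (X.ρ a l)) := by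
  rw [← lie_inA_inB]; rfl

lemma dualVec_ρ (a : 𝔞) : X.dualVec (X.ρ a) = a := by
  apply X.pairing_injective
  ext l
  rw [pairing_dualVec, pairing_eq]

/-- As linear forms on 𝓛, ξ∘Q and ξ∘ρ(dualVec Q) coincide, so the two operators can be exchanged in
front of anything that preserves 𝓛. All axioms of the triple product that involve nesting reduce to
this exchange. -/
lemma dualVec_ρ_dualVec_mul (Q : 𝔟 →L[ℝ] 𝔟) {T : 𝔟 →L[ℝ] 𝔟} (hT : X.PreservesL T) :
    X.dualVec (X.ρ (X.dualVec Q) * T) = X.dualVec (Q * T) := by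
  apply X.pairing_injective
  ext l
  have h := X.pairing_eq (X.dualVec Q) ⟨T l, hT l l.2⟩
  rw [pairing_dualVec] at h
  rw [pairing_dualVec, pairing_dualVec]
  exact h.symm

/-- The midpoint of (2a, 2l) must have the form (a, l') with cosh(a)l' = l. -/
lemma cosh_surjective (hX : X.HasMidpointMap) (a : 𝔞) (l : X.L) : ∃ l' : X.L, X.cosh a l' = l := by
  obtain ⟨m, hm⟩ := hX
  have h := hm ((2 : ℝ) • a, (2 : ℝ) • l)
  simp only [symm, Prod.fst_zero, Prod.snd_zero, sub_zero] at h
  have h1 : (m ((2 : ℝ) • a, (2 : ℝ) • l)).1 = a :=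
    smul_right_injective _ (two_ne_zero (α := ℝ)) (congrArg Prod.fst h)
  have h2 := smul_right_injective _ (two_ne_zero (α := ℝ)) (congrArg Prod.snd h)
  refine ⟨(m ((2 : ℝ) • a, (2 : ℝ) • l)).2, ?_⟩
  rw [← congrArg Subtype.val h2]
  simp only [h1]

set_option maxSynthPendingDepth 3 in
/-- The triple product of `𝔞`. -/
def triple : 𝔞 →L[ℝ] 𝔞 →L[ℝ] 𝔞 →L[ℝ] 𝔞 :=
  LinearMap.toContinuousLinearMap
    { toFun := fun a => LinearMap.toContinuousLinearMap
        { toFun := fun a' => X.dualVec.comp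
            ((ContinuousLinearMap.mul ℝ (𝔟 →L[ℝ] 𝔟) (X.ρ a * X.ρ a')).comp X.ρL)
          map_add' := fun b c => by ext1; simp [ρ_add, mul_add]
          map_smul' := fun r b => by ext1; simp [ρ_smul] }
      map_add' := fun b c => by ext; simp [ρ_add, add_mul]
      map_smul' := fun r b => by ext; simp [ρ_smul] }

lemma triple_apply (a b c : 𝔞) : X.triple a b c = X.dualVec (X.ρ a * X.ρ b * X.ρ c) := rfl

/-- The transpose of `cosh a` with respect to the pairing of `𝔞` and `𝓛`. -/
def coshT (a : 𝔞) : 𝔞 →L[ℝ] 𝔞 :=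
  X.dualVec.comp (((ContinuousLinearMap.mul ℝ (𝔟 →L[ℝ] 𝔟)).flip (X.cosh a)).comp X.ρL)

lemma coshT_apply (a c : 𝔞) : X.coshT a c = X.dualVec (X.ρ c * X.cosh a) := rfl

lemma pairing_coshT (a c : 𝔞) (l : X.L) :
    X.pairing (X.coshT a c) l = X.pairing c ⟨X.cosh a l, X.cosh_mem a l.2⟩ := by
  rw [coshT_apply, pairing_dualVec, pairing_eq]; rfl

set_option maxSynthPendingDepth 3 in
/-- The triple product on `𝔞` and the twisting map. -/
def twistSystem (hX : X.HasMidpointMap) : TwistSystem 𝔞 where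
  mul := X.triple
  mul_comm a b c := by
    rw [triple_apply, triple_apply, (X.commute_ρ a b).eq]
  mul_right_comm a b c := by
    rw [triple_apply, triple_apply, mul_assoc, (X.commute_ρ b c).eq, mul_assoc]
  mul_mul a b c d e := by
    simp only [triple_apply]
    have h (T : 𝔟 →L[ℝ] 𝔟) : X.dualVec (X.ρ a * X.ρ b * X.ρ (X.dualVec T))
        = X.dualVec (T * (X.ρ a * X.ρ b)) := by
      rw [((X.commute_ρ a _).mul_left (X.commute_ρ b _)).eq,
        dualVec_ρ_dualVec_mul _ _ (X.preservesL_ρ_mul_ρ a b)]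
    have h2 (x : 𝔞) : Commute (X.ρ a * X.ρ b) (X.ρ x) :=
      (X.commute_ρ a x).mul_left (X.commute_ρ b x)
    rw [h, mul_assoc (X.ρ (X.dualVec _)), dualVec_ρ_dualVec_mul _ _ (X.preservesL_ρ_mul_ρ d e),
      ← (((h2 c).mul_right (h2 d)).mul_right (h2 e)).eq]
    simp only [mul_assoc]
  φ := X.twistingMap
  C := X.coshT
  φ_zero := by rw [twistingMap_eq, sinh_zero, map_zero]
  C_zero := by
    ext c; rw [coshT_apply, cosh_zero, mul_one, dualVec_ρ]; rfl
  hasFDerivAt_φ a := X.dualVec.hasFDerivAt.comp a (X.hasFDerivAt_sinh a)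
  -- The derivative of cosh contains sinh a, and the exchange rule replaces it by ρ(φ(a)).
  hasFDerivAt_C a := by
    have h : HasFDerivAt X.coshT _ a := (((ContinuousLinearMap.compL ℝ 𝔞 (𝔟 →L[ℝ] 𝔟) 𝔞 X.dualVec).comp
      (((ContinuousLinearMap.compL ℝ 𝔞 (𝔟 →L[ℝ] 𝔟) (𝔟 →L[ℝ] 𝔟)).flip X.ρL).comp
        (ContinuousLinearMap.mul ℝ (𝔟 →L[ℝ] 𝔟)).flip)).hasFDerivAt (x := X.cosh a)).comp a
          (X.hasFDerivAt_cosh a)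
    refine h.congr_fderiv ?_
    ext a' c
    change X.dualVec (X.ρ c * (X.ρ a' * X.sinh a)) = X.dualVec (X.ρ a' * X.ρ (X.twistingMap a) * X.ρ c)
    rw [twistingMap_eq, (X.commute_ρ a' _).eq, mul_assoc,
      dualVec_ρ_dualVec_mul _ _ (X.preservesL_ρ_mul_ρ a' c),
      ← ((X.commute_ρ_sinh a' a).mul_left (X.commute_ρ_sinh c a)).eq, ← mul_assoc,
      (X.commute_ρ a' c).eq]
  C_mul a b c d := by
    simp only [triple_apply, coshT_apply]
    rw [dualVec_ρ_dualVec_mul _ _ (X.preservesL_cosh a), mul_assoc (X.ρ (X.dualVec _)),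
      dualVec_ρ_dualVec_mul _ _ (X.preservesL_ρ_mul_ρ c d), mul_assoc, mul_assoc, mul_assoc,
      ← ((X.commute_ρ_cosh c a).mul_left (X.commute_ρ_cosh d a)).eq, mul_assoc]
  -- `coshT a` is the transpose of cosh a on 𝓛, hence injective because cosh a is surjective.
  C_injective a := by
    refine (injective_iff_map_eq_zero _).2 fun c hc => ?_
    apply X.pairing_injective
    ext l
    obtain ⟨l', hl'⟩ := X.cosh_surjective hX a l
    have h := X.pairing_coshT a c l'
    rw [hc] at h
    simp only [map_zero, hl'] at h ⊢
    exact h.symm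
  φ_sub a b := by
    rw [twistingMap_eq, twistingMap_eq, twistingMap_eq, coshT_apply,
      dualVec_ρ_dualVec_mul _ _ (X.preservesL_cosh _), ← map_sub, sinh_sub_sinh, map_smul]

end ESET

/-! ### Composition of Schwartz functions with tame maps -/

section Composition

variable {D E F : Type*} [NormedAddCommGroup D] [NormedSpace ℝ D]
  [NormedAddCommGroup E] [NormedSpace ℝ E]
  [NormedAddCommGroup F] [NormedSpace ℝ F] [NormedSpace ℂ F] [SMulCommClass ℝ ℂ F]

lemma exists_uniform_bound_iteratedFDeriv {g : D → E}
    (hbd : ∀ n : ℕ, ∃ (k : ℕ) (C : ℝ), ∀ x, ‖iteratedFDeriv ℝ n g x‖ ≤ C * (1 + ‖g x‖) ^ k) (n : ℕ) :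
    ∃ (k : ℕ) (C : ℝ), 0 ≤ C ∧ ∀ N ≤ n, ∀ x, ‖iteratedFDeriv ℝ N g x‖ ≤ C * (1 + ‖g x‖) ^ k := by
  choose k C hC using hbd
  refine ⟨(Finset.range (n + 1)).sup k, ∑ i ∈ Finset.range (n + 1), |C i|,
    Finset.sum_nonneg fun _ _ => abs_nonneg _, fun N hN x => (hC N x).trans ?_⟩
  have hN' : N ∈ Finset.range (n + 1) := by simpa [Nat.lt_succ_iff] using hN
  have h1 : C N ≤ ∑ i ∈ Finset.range (n + 1), |C i| :=
    (le_abs_self _).trans (Finset.single_le_sum (f := fun i => |C i|) (fun _ _ => abs_nonneg _) hN')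
  have h2 : (1 + ‖g x‖) ^ k N ≤ (1 + ‖g x‖) ^ (Finset.range (n + 1)).sup k :=
    pow_le_pow_right₀ (by simp) (Finset.le_sup hN')
  exact mul_le_mul h1 h2 (by positivity) (Finset.sum_nonneg fun _ _ => abs_nonneg _)

/-- Composition on the right with a smooth map whose derivatives are polynomially bounded by
its values, and which does not shrink its argument more than polynomially, is continuous on
Schwartz functions. -/
def SchwartzMap.compRight {g : D → E} (hg : ContDiff ℝ ∞ g)
    (hbd : ∀ n : ℕ, ∃ (k : ℕ) (C : ℝ), ∀ x, ‖iteratedFDeriv ℝ n g x‖ ≤ C * (1 + ‖g x‖) ^ k)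
    (hup : ∃ (k : ℕ) (C : ℝ), ∀ x, ‖x‖ ≤ C * (1 + ‖g x‖) ^ k) : 𝓢(E, F) →L[ℂ] 𝓢(D, F) :=
  SchwartzMap.mkCLM (fun f => f ∘ g) (fun _ _ _ => by simp) (fun _ _ _ => rfl)
    (fun f => (f.smooth ⊤).comp hg) <| by
  rintro ⟨k, n⟩
  obtain ⟨l, C, hC, hgrowth⟩ := exists_uniform_bound_iteratedFDeriv hbd n
  obtain ⟨kg, Cg, hCg⟩ := hup
  have hCg0 : 0 ≤ Cg := by
    have := (norm_nonneg _).trans (hCg 0)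
    exact nonneg_of_mul_nonneg_left this (by positivity)
  -- Decay required of f: the power kg·k absorbs ‖x‖^k, and l·n absorbs up to n derivatives of g.
  let k' := kg * k + l * n
  refine ⟨Finset.Iic (k', n), Cg ^ k * ((C + 1) ^ n * n.factorial * 2 ^ k'), by positivity, ?_⟩
  intro f x
  let S := ((Finset.Iic (k', n)).sup (schwartzSeminormFamily ℂ E F)) f
  have hp : 0 < 1 + ‖g x‖ := by positivity
  have h1 : 1 ≤ 1 + ‖g x‖ := by simp
  have hbound (i) (hi : i ≤ n) :
      ‖iteratedFDeriv ℝ i f (g x)‖ ≤ 2 ^ k' * S / (1 + ‖g x‖) ^ k' := by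
    rw [le_div_iff₀' (by positivity)]
    exact SchwartzMap.one_add_le_sup_seminorm_apply (m := (k', n)) le_rfl hi _ _
  -- The estimate for derivatives of a composition asks for a bound of the form D^N. Taking C + 1
  -- makes the base at least 1, so that it is at most its N-th power.
  have hgrowth' (N : ℕ) (hN₁ : 1 ≤ N) (hN₂ : N ≤ n) :
      ‖iteratedFDeriv ℝ N g x‖ ≤ ((C + 1) * (1 + ‖g x‖) ^ l) ^ N := by
    have h2 : 1 ≤ (C + 1) * (1 + ‖g x‖) ^ l :=
      one_le_mul_of_one_le_of_one_le (by linarith) (one_le_pow₀ h1)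
    calc ‖iteratedFDeriv ℝ N g x‖ ≤ C * (1 + ‖g x‖) ^ l := hgrowth N hN₂ x
      _ ≤ (C + 1) * (1 + ‖g x‖) ^ l := by gcongr; linarith
      _ ≤ _ := le_self_pow₀ h2 (by omega)
  have key := norm_iteratedFDeriv_comp_le (f.smooth ⊤) hg (mod_cast le_top) x hbound hgrowth'
  have hS : 0 ≤ S := apply_nonneg _ _
  calc ‖x‖ ^ k * ‖iteratedFDeriv ℝ n (f ∘ g) x‖
      ≤ (Cg * (1 + ‖g x‖) ^ kg) ^ k * (n.factorial * (2 ^ k' * S / (1 + ‖g x‖) ^ k')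
        * ((C + 1) * (1 + ‖g x‖) ^ l) ^ n) := by
        gcongr
        exact hCg x
    _ = Cg ^ k * ((C + 1) ^ n * n.factorial * 2 ^ k') * S := by
        rw [mul_pow, mul_pow, ← pow_mul, ← pow_mul]
        simp only [k', pow_add]
        field_simp

end Composition

/-! ### Density of test functions in the Schwartz space -/

section Cutoff

variable {V : Type*} [NormedAddCommGroup V] [NormedSpace ℝ V] [FiniteDimensional ℝ V]

lemma norm_iteratedFDeriv_comp_const_smul_le {F : Type*} [NormedAddCommGroup F] [NormedSpace ℝ F]
    {f : V → F} (hf : ContDiff ℝ ∞ f) (c : ℝ) (n : ℕ) (x : V) :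
    ‖iteratedFDeriv ℝ n (fun y => f (c • y)) x‖ ≤ |c| ^ n * ‖iteratedFDeriv ℝ n f (c • x)‖ := by
  rw [iteratedFDeriv_comp_const_smul c (hf.of_le (mod_cast le_top)), norm_smul, norm_pow, Real.norm_eq_abs]

/-- For n ≥ 1 the chain rule yields the factor εⁿ ≤ ε; for n = 0 the bound |χ(x) - 1| ≤ ‖x‖ yields ε
at the price of one power of ‖x‖. -/
lemma exists_cutoff_bound {χ : V → ℂ} (hχ : ContDiff ℝ ∞ χ) (hc : HasCompactSupport χ)
    (h1 : ∀ x, ‖χ x - 1‖ ≤ ‖x‖) (n : ℕ) :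
    ∃ C, 0 ≤ C ∧ ∀ ε, 0 ≤ ε → ε ≤ 1 → ∀ x,
      ‖iteratedFDeriv ℝ n (fun y => χ (ε • y) - 1) x‖ ≤ C * ε * (1 + ‖x‖) := by
  obtain ⟨C, hC⟩ := ((hχ.continuous_iteratedFDeriv (m := n) (mod_cast le_top)).bounded_above_of_compact_support
    (hc.iteratedFDeriv n))
  refine ⟨max C 1, by positivity, fun ε h0 hε x => ?_⟩
  have hχε : ContDiff ℝ ∞ fun y => χ (ε • y) := hχ.comp (contDiff_const_smul ε)
  rcases n with _ | n
  · rw [norm_iteratedFDeriv_zero]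
    refine (h1 _).trans ?_
    rw [norm_smul, Real.norm_of_nonneg h0]
    calc ε * ‖x‖ ≤ 1 * ε * (1 + ‖x‖) := by nlinarith [norm_nonneg x]
      _ ≤ _ := by gcongr; exact le_max_right _ _
  · have h2 : iteratedFDeriv ℝ (n + 1) (fun y => χ (ε • y) - 1) x
        = iteratedFDeriv ℝ (n + 1) (fun y => χ (ε • y)) x := by
      have := iteratedFDeriv_sub_apply (𝕜 := ℝ) (i := n + 1) (f := fun y => χ (ε • y)) (g := fun _ => (1 : ℂ)) (x := x)
        (hχε.of_le (mod_cast le_top)).contDiffAt contDiff_const.contDiffAt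
      rw [iteratedFDeriv_succ_const, Pi.zero_apply, sub_zero] at this
      exact this
    rw [h2]
    refine (norm_iteratedFDeriv_comp_const_smul_le hχ ε (n + 1) x).trans ?_
    rw [abs_of_nonneg h0]
    have hε1 : ε ^ (n + 1) ≤ ε := pow_le_of_le_one h0 hε (by omega)
    calc ε ^ (n + 1) * ‖iteratedFDeriv ℝ (n + 1) χ (ε • x)‖ ≤ ε * max C 1 := by
          gcongr; exact (hC _).trans (le_max_left _ _)
      _ ≤ max C 1 * ε * (1 + ‖x‖) := by
          have : 0 ≤ max C 1 * ε := by positivity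
          nlinarith [norm_nonneg x]

lemma exists_cutoff : ∃ χ : V → ℂ, ContDiff ℝ ∞ χ ∧ HasCompactSupport χ ∧ ∀ x, ‖χ x - 1‖ ≤ ‖x‖ := by
  let b : ContDiffBump (0 : V) := ⟨1, 2, one_pos, by norm_num⟩
  refine ⟨fun x => (b x : ℂ), Complex.ofRealCLM.contDiff.comp b.contDiff,
    b.hasCompactSupport.comp_left (g := fun r : ℝ => (r : ℂ)) (by simp), fun x => ?_⟩
  have h : ‖((b x : ℝ) : ℂ) - 1‖ = 1 - b x := by
    rw [← Complex.ofReal_one, ← Complex.ofReal_sub, Complex.norm_real, Real.norm_eq_abs,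
      abs_of_nonpos (by linarith [b.le_one (x := x)])]
    ring
  rw [h]
  rcases le_total ‖x‖ 1 with hx | hx
  · rw [b.one_of_mem_closedBall (by simpa using hx)]; simp
  · linarith [b.nonneg (x := x)]

/-- The truncations χ(εx)f converge to f: in the Leibniz formula each derivative of χ(εx) - 1 is
O(ε(1 + ‖x‖)), and the extra power of ‖x‖ is absorbed by a seminorm of f of weight k + 1. -/
theorem dense_testFunctions : Dense (testFunctions V : Set 𝓢(V, ℂ)) := by
  obtain ⟨χ, hχ, hc, h1⟩ := exists_cutoff (V := V)
  choose C hC0 hC using exists_cutoff_bound hχ hc h1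
  intro f
  let ε : ℕ → ℝ := fun N => ((N : ℝ) + 1)⁻¹
  have hε0 (N) : 0 < ε N := by positivity
  have hε1 (N) : ε N ≤ 1 := inv_le_one_of_one_le₀ (by simp)
  have hcs (N) : HasCompactSupport fun x => χ (ε N • x) * f x := by
    refine HasCompactSupport.mul_right ?_
    exact hc.comp_homeomorph (Homeomorph.smulOfNeZero (ε N) (hε0 N).ne')
  have hsm (N) : ContDiff ℝ ∞ fun x => χ (ε N • x) :=  hχ.comp (contDiff_const_smul (ε N))
  let u : ℕ → 𝓢(V, ℂ) := fun N => (hcs N).toSchwartzMap ((hsm N).mul (f.smooth ⊤))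
  refine mem_closure_of_tendsto (f := u) (b := Filter.atTop) ?_ (Filter.Eventually.of_forall hcs)
  rw [(schwartz_withSeminorms ℂ V ℂ).tendsto_nhds]
  rintro ⟨k, n⟩ δ hδ
  let K : ℝ := ∑ i ∈ Finset.range (n + 1), (n.choose i : ℝ) * C i *
    (SchwartzMap.seminorm ℂ k (n - i) f + SchwartzMap.seminorm ℂ (k + 1) (n - i) f)
  have hK : 0 ≤ K := by
    refine Finset.sum_nonneg fun i _ => ?_
    have := hC0 i
    positivity
  have hb (N) : SchwartzMap.seminorm ℂ k n (u N - f) ≤ ε N * K := by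
    refine SchwartzMap.seminorm_le_bound _ _ _ _ (mul_nonneg (hε0 N).le hK) fun x => ?_
    have he : ((u N - f : 𝓢(V, ℂ)) : V → ℂ) = fun x => (χ (ε N • x) - 1) * f x := by
      ext x
      change χ (ε N • x) * f x - f x = _
      ring
    rw [he]
    refine (mul_le_mul_of_nonneg_left (norm_iteratedFDeriv_mul_le ((hsm N).sub contDiff_const)
      (f.smooth ⊤) x (n := n) (mod_cast le_top)) (by positivity)).trans ?_
    rw [Finset.mul_sum, Finset.mul_sum]
    refine Finset.sum_le_sum fun i _ => ?_
    have a1 := hC i (ε N) (hε0 N).le (hε1 N) x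
    have a2 := SchwartzMap.le_seminorm ℂ k (n - i) f x
    have a3 := SchwartzMap.le_seminorm ℂ (k + 1) (n - i) f x
    have := hC0 i
    have := (hε0 N).le
    calc ‖x‖ ^ k * ((n.choose i : ℝ) * ‖iteratedFDeriv ℝ i (fun x => χ (ε N • x) - 1) x‖
          * ‖iteratedFDeriv ℝ (n - i) f x‖)
        ≤ ‖x‖ ^ k * ((n.choose i : ℝ) * (C i * ε N * (1 + ‖x‖))
          * ‖iteratedFDeriv ℝ (n - i) f x‖) := by gcongr
      _ = ε N * ((n.choose i : ℝ) * C i * (‖x‖ ^ k * ‖iteratedFDeriv ℝ (n - i) f x‖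
          + ‖x‖ ^ (k + 1) * ‖iteratedFDeriv ℝ (n - i) f x‖)) := by ring
      _ ≤ _ := by gcongr
  have ht : Filter.Tendsto (fun N => ε N * K) Filter.atTop (nhds (0 * K)) :=
    (tendsto_one_div_add_atTop_nhds_zero_nat.congr fun N => by simp [ε]).mul_const K
  rw [zero_mul] at ht
  filter_upwards [ht.eventually_lt_const hδ] with N hN
  exact (hb N).trans_lt hN

end Cutoff

/-! ### The partial Fourier transform as an automorphism of the Schwartz space -/

namespace SchwartzMap

lemma sup_seminorm_real_eq {V F : Type*} [NormedAddCommGroup V] [NormedSpace ℝ V]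
    [NormedAddCommGroup F] [NormedSpace ℂ F] (s : Finset (ℕ × ℕ)) (f : 𝓢(V, F)) :
    s.sup (schwartzSeminormFamily ℝ V F) f = s.sup (schwartzSeminormFamily ℂ V F) f := by
  rw [Seminorm.finset_sup_apply, Seminorm.finset_sup_apply]; rfl

lemma exists_sup_seminorm_apply_le {V V' F F' : Type*} [NormedAddCommGroup V] [NormedSpace ℝ V]
    [NormedAddCommGroup F] [NormedSpace ℝ F] [NormedAddCommGroup V'] [NormedSpace ℝ V']
    [NormedAddCommGroup F'] [NormedSpace ℝ F'] (B : 𝓢(V, F) →L[ℝ] 𝓢(V', F'))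
    (s : Finset (ℕ × ℕ)) : ∃ (s' : Finset (ℕ × ℕ)) (C : ℝ), 0 ≤ C ∧ ∀ f,
      s.sup (schwartzSeminormFamily ℝ V' F') (B f) ≤ C * s'.sup (schwartzSeminormFamily ℝ V F) f := by
  have hc : Continuous (s.sup (schwartzSeminormFamily ℝ V' F') : Seminorm ℝ 𝓢(V', F')) := by
    refine Seminorm.continuous_of_le ?_ (Seminorm.finset_sup_le_sum _ s)
    simp_rw [← FunLike.coeAddMonoidHom_apply, map_sum]
    have : ∀ i, Continuous (schwartzSeminormFamily ℝ V' F' i) :=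
      fun i => (schwartz_withSeminorms ℝ V' F').continuous_seminorm i
    simp only [FunLike.coeAddMonoidHom_apply]
    rw [Finset.sum_fn]
    exact continuous_finsetSum _ fun i _ => this i
  obtain ⟨s', C, -, h⟩ := Seminorm.bound_of_continuous (schwartz_withSeminorms ℝ V F)
    ((s.sup (schwartzSeminormFamily ℝ V' F')).comp (B : 𝓢(V, F) →ₗ[ℝ] 𝓢(V', F')))
    (hc.comp B.continuous)
  exact ⟨s', C, C.2, h⟩

section Fibre

variable {V E F : Type*} [NormedAddCommGroup V] [NormedSpace ℝ V] [NormedAddCommGroup E]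
  [NormedSpace ℝ E] [NormedAddCommGroup F] [NormedSpace ℂ F]

/-- The restriction of a Schwartz function on `V × E` to the fibre `{v} × E`. -/
def fibre (v : V) : 𝓢(V × E, F) →L[ℂ] 𝓢(E, F) :=
  compCLMOfAntilipschitz ℂ (K := 1) (g := fun w => (v, w))
    (by
      have h := (Function.HasTemperateGrowth.const (E := E) ((v, 0) : V × E)).add
        (ContinuousLinearMap.inr ℝ V E).hasTemperateGrowth
      have e : (fun w => (v, w)) = (fun _ : E => ((v, 0) : V × E)) + ⇑(ContinuousLinearMap.inr ℝ V E) := by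
        ext w <;> simp
      rwa [e])
    (AntilipschitzWith.of_le_mul_dist fun x y => by simp [Prod.dist_eq])

@[simp] lemma fibre_apply (v : V) (f : 𝓢(V × E, F)) (w : E) : fibre v f w = f (v, w) := rfl

/-- The restriction of a Schwartz function on `V × E` to `V × {0}`. -/
def zeroSection : 𝓢(V × E, F) →L[ℂ] 𝓢(V, F) :=
  compCLMOfAntilipschitz ℂ (K := 1) (g := fun v => (v, 0))
    (by
      have h := (ContinuousLinearMap.inl ℝ V E).hasTemperateGrowth
      have e : (fun v => (v, 0)) = ⇑(ContinuousLinearMap.inl ℝ V E) := by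
        ext w <;> simp
      rwa [e])
    (AntilipschitzWith.of_le_mul_dist fun x y => by simp [Prod.dist_eq])

/-- Supplies majorants that are integrable in the fibre variable w and uniform in v. -/
lemma exists_pow_mul_norm_le (j N : ℕ) :
    ∃ (s : Finset (ℕ × ℕ)) (C : ℝ), 0 ≤ C ∧ ∀ (f : 𝓢(V × E, F)) (v : V) (w : E),
      ‖v‖ ^ j * ‖f (v, w)‖ ≤
        C * s.sup (schwartzSeminormFamily ℝ (V × E) F) f * (1 + ‖w‖) ^ (-(N : ℝ)) := by
  refine ⟨Finset.Iic (j + N, 0), 2 ^ (j + N), by positivity, fun f v w => ?_⟩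
  rw [Real.rpow_neg (by positivity), ← div_eq_mul_inv, Real.rpow_natCast, le_div_iff₀ (by positivity)]
  have h := one_add_le_sup_seminorm_apply (𝕜 := ℝ) (m := (j + N, 0)) le_rfl le_rfl f (v, w)
  rw [norm_iteratedFDeriv_zero] at h
  refine le_trans ?_ h
  have h1 : ‖v‖ ≤ 1 + ‖(v, w)‖ := by linarith [norm_fst_le (v, w)]
  have h2 : 1 + ‖w‖ ≤ 1 + ‖(v, w)‖ := by linarith [norm_snd_le (v, w)]
  calc ‖v‖ ^ j * ‖f (v, w)‖ * (1 + ‖w‖) ^ N = ‖v‖ ^ j * (1 + ‖w‖) ^ N * ‖f (v, w)‖ := by ring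
    _ ≤ (1 + ‖(v, w)‖) ^ j * (1 + ‖(v, w)‖) ^ N * ‖f (v, w)‖ := by gcongr
    _ = _ := by rw [← pow_add]

end Fibre

section PartialFourier

open scoped FourierTransform

variable {V E : Type} [NormedAddCommGroup V] [NormedSpace ℝ V] [NormedAddCommGroup E]
  [InnerProductSpace ℝ E] [FiniteDimensional ℝ E] [MeasurableSpace E] [BorelSpace E]

/-- The Fourier transform in the second variable. -/
def fibreFourier {F : Type} [NormedAddCommGroup F] [NormedSpace ℂ F] (f : 𝓢(V × E, F)) (y : V × E) : F :=
  𝓕 (fun w => f (y.1, w)) y.2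

section

variable {F : Type} [NormedAddCommGroup F] [NormedSpace ℂ F]

lemma fibreFourier_eq (f : 𝓢(V × E, F)) (y : V × E) :
    fibreFourier f y = ∫ w, Complex.exp ((-2 * Real.pi * inner ℝ w y.2 : ℝ) * Complex.I) • f (y.1, w) :=
  Real.fourier_eq' _ _

lemma fibreFourier_eq_fibre (f : 𝓢(V × E, F)) (y : V × E) :
    fibreFourier f y = 𝓕 (fibre y.1 f) y.2 := rfl

lemma norm_exp_mul_I_smul (r : ℝ) (x : F) : ‖Complex.exp (r * Complex.I) • x‖ = ‖x‖ := by
  rw [norm_smul, Complex.norm_exp_ofReal_mul_I, one_mul]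

lemma exists_pow_fst_mul_norm_fibreFourier_le (j : ℕ) :
    ∃ (s : Finset (ℕ × ℕ)) (C : ℝ), 0 ≤ C ∧ ∀ (f : 𝓢(V × E, F)) (y : V × E),
      ‖y.1‖ ^ j * ‖fibreFourier f y‖ ≤ C * s.sup (schwartzSeminormFamily ℝ (V × E) F) f := by
  let N := (volume : Measure E).integrablePower
  have hI := Measure.integrable_pow_neg_integrablePower (volume : Measure E)
  obtain ⟨s, C, hC, h⟩ := exists_pow_mul_norm_le (V := V) (E := E) (F := F) j N
  refine ⟨s, C * ∫ w : E, (1 + ‖w‖) ^ (-(N : ℝ)), mul_nonneg hC (integral_nonneg fun w => by positivity),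
    fun f y => ?_⟩
  rw [fibreFourier_eq]
  calc _ ≤ ‖y.1‖ ^ j * ∫ w, ‖f (y.1, w)‖ := by
        gcongr
        refine (norm_integral_le_integral_norm _).trans_eq ?_
        simp only [norm_exp_mul_I_smul]
    _ = ∫ w, ‖y.1‖ ^ j * ‖f (y.1, w)‖ := (integral_const_mul _ _).symm
    _ ≤ ∫ w, C * s.sup (schwartzSeminormFamily ℝ (V × E) F) f * (1 + ‖w‖) ^ (-(N : ℝ)) := by
        refine integral_mono ((fibre y.1 f).integrable.norm.const_mul _) (hI.const_mul _) fun w => ?_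
        exact h f y.1 w
    _ = _ := by rw [integral_const_mul]; ring

/-- The differential in the direction of the second variable. -/
def sndFDeriv : 𝓢(V × E, F) →L[ℝ] 𝓢(V × E, E →L[ℝ] F) :=
  (postcompCLM ((ContinuousLinearMap.compL ℝ E (V × E) F).flip (ContinuousLinearMap.inr ℝ V E))).comp
    (fderivCLM ℝ (V × E) F)

lemma fderiv_fibre (f : 𝓢(V × E, F)) (v : V) (w : E) :
    fderiv ℝ (fibre v f) w = sndFDeriv f (v, w) := by
  have h : HasFDerivAt (fun w : E => ((v, w) : V × E)) (ContinuousLinearMap.inr ℝ V E) w :=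
    (hasFDerivAt_const (𝕜 := ℝ) v w).prodMk (hasFDerivAt_id w)
  exact ((f.hasFDerivAt (v, w)).comp w h).fderiv

/-- The Fourier transform turns the fibre derivative into multiplication by the frequency; the
factor 2π ≥ 1 is dropped. -/
lemma norm_mul_norm_fibreFourier_le (f : 𝓢(V × E, F)) (y : V × E) :
    ‖y.2‖ * ‖fibreFourier f y‖ ≤ ‖fibreFourier (sndFDeriv f) y‖ := by
  have h : 𝓕 (fun w => sndFDeriv f (y.1, w)) y.2
      = VectorFourier.fourierSMulRight (-innerSL ℝ) (𝓕 (fibre y.1 f : E → F)) y.2 := by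
    rw [← Real.fourier_fderiv (fibre y.1 f).integrable (fibre y.1 f).differentiable
      ((fderivCLM ℝ E F) (fibre y.1 f)).integrable]
    exact congrArg (fun g : E → E →L[ℝ] F => (𝓕 g : E → E →L[ℝ] F) y.2) (funext fun w => (fderiv_fibre f y.1 w).symm)
  -- Evaluated at the vector y.2 itself the transform of the derivative is 2πi‖y.2‖² times that of
  -- f; one of the two powers is then cancelled against the operator norm.
  have h2 : fibreFourier (sndFDeriv f) y y.2 = (2 * Real.pi * Complex.I * ‖y.2‖ ^ 2) • fibreFourier f y := by
    change (𝓕 (fun w => sndFDeriv f (y.1, w)) y.2) y.2 = _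
    have h0 : (-innerSL ℝ : E →L[ℝ] E →L[ℝ] ℝ) y.2 y.2 = -‖y.2‖ ^ 2 := by
      rw [← real_inner_self_eq_norm_sq]; rfl
    rw [h, VectorFourier.fourierSMulRight_apply, h0]
    change _ = (2 * Real.pi * Complex.I * ‖y.2‖ ^ 2) • 𝓕 (fibre y.1 f : E → F) y.2
    rw [← Complex.coe_smul, smul_smul]
    congr 1
    push_cast
    ring
  have h3 := (fibreFourier (sndFDeriv f) y).le_opNorm y.2
  rw [h2, norm_smul] at h3
  simp only [norm_mul, norm_pow, Complex.norm_I, Complex.norm_real, norm_norm, Complex.norm_two,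
    Real.norm_of_nonneg Real.pi_pos.le, mul_one] at h3
  rcases (norm_nonneg y.2).eq_or_lt with h0 | h0
  · rw [← h0, zero_mul]; positivity
  · have h4 : 1 ≤ 2 * Real.pi := by linarith [Real.pi_gt_three]
    have h5 : 2 * Real.pi * (‖y.2‖ * ‖fibreFourier f y‖) ≤ ‖fibreFourier (sndFDeriv f) y‖ := by
      rw [← mul_le_mul_iff_left₀ h0]
      calc _ = _ := by ring
        _ ≤ _ := h3
    nlinarith [mul_nonneg h0.le (norm_nonneg (fibreFourier f y))]

end

/-- The target space F is quantified inside the induction, because each power of the frequency is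
traded for a derivative with values in E →L F. -/
lemma exists_pow_snd_mul_norm_fibreFourier_le (k : ℕ) :
    ∀ {F : Type} [NormedAddCommGroup F] [NormedSpace ℂ F],
    ∃ (s : Finset (ℕ × ℕ)) (C : ℝ), 0 ≤ C ∧ ∀ (f : 𝓢(V × E, F)) (y : V × E),
      ‖y.2‖ ^ k * ‖fibreFourier f y‖ ≤ C * s.sup (schwartzSeminormFamily ℝ (V × E) F) f := by
  induction k with
  | zero =>
    intro F _ _
    simpa using exists_pow_fst_mul_norm_fibreFourier_le (V := V) (E := E) (F := F) 0
  | succ k ih =>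
    intro F _ _
    obtain ⟨s, C, hC, h⟩ := ih (F := E →L[ℝ] F)
    obtain ⟨s', C', hC', h'⟩ := exists_sup_seminorm_apply_le (sndFDeriv (V := V) (E := E) (F := F)) s
    refine ⟨s', C * C', by positivity, fun f y => ?_⟩
    calc ‖y.2‖ ^ (k + 1) * ‖fibreFourier f y‖ = ‖y.2‖ ^ k * (‖y.2‖ * ‖fibreFourier f y‖) := by ring
      _ ≤ ‖y.2‖ ^ k * ‖fibreFourier (sndFDeriv f) y‖ := by
          gcongr; exact norm_mul_norm_fibreFourier_le f y
      _ ≤ C * (C' * s'.sup (schwartzSeminormFamily ℝ (V × E) F) f) :=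
          (h _ _).trans (by gcongr; exact h' f)
      _ = _ := by ring

section

variable {F : Type} [NormedAddCommGroup F] [NormedSpace ℂ F]

lemma exists_pow_mul_norm_fibreFourier_le (k : ℕ) :
    ∃ (s : Finset (ℕ × ℕ)) (C : ℝ), 0 ≤ C ∧ ∀ (f : 𝓢(V × E, F)) (y : V × E),
      ‖y‖ ^ k * ‖fibreFourier f y‖ ≤ C * s.sup (schwartzSeminormFamily ℝ (V × E) F) f := by
  classical
  obtain ⟨s, C, hC, h⟩ := exists_pow_fst_mul_norm_fibreFourier_le (V := V) (E := E) (F := F) k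
  obtain ⟨s', C', hC', h'⟩ := exists_pow_snd_mul_norm_fibreFourier_le (V := V) (E := E) k (F := F)
  refine ⟨s ∪ s', C + C', by positivity, fun f y => ?_⟩
  have h1 : s.sup (schwartzSeminormFamily ℝ (V × E) F) f ≤ (s ∪ s').sup (schwartzSeminormFamily ℝ (V × E) F) f :=
    Finset.sup_mono (f := schwartzSeminormFamily ℝ (V × E) F) Finset.subset_union_left f
  have h2 : s'.sup (schwartzSeminormFamily ℝ (V × E) F) f ≤ (s ∪ s').sup (schwartzSeminormFamily ℝ (V × E) F) f :=
    Finset.sup_mono (f := schwartzSeminormFamily ℝ (V × E) F) Finset.subset_union_right f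
  have h3 : ‖y‖ ^ k ≤ ‖y.1‖ ^ k + ‖y.2‖ ^ k := by
    rcases max_choice ‖y.1‖ ‖y.2‖ with hm | hm <;> rw [Prod.norm_def, hm] <;> simp
  calc ‖y‖ ^ k * ‖fibreFourier f y‖ ≤ (‖y.1‖ ^ k + ‖y.2‖ ^ k) * ‖fibreFourier f y‖ := by gcongr
    _ = ‖y.1‖ ^ k * ‖fibreFourier f y‖ + ‖y.2‖ ^ k * ‖fibreFourier f y‖ := by ring
    _ ≤ C * (s ∪ s').sup (schwartzSeminormFamily ℝ (V × E) F) f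
        + C' * (s ∪ s').sup (schwartzSeminormFamily ℝ (V × E) F) f :=
      add_le_add ((h f y).trans (by gcongr)) ((h' f y).trans (by gcongr))
    _ = _ := by ring

/-- The bilinear form `(x, y) ↦ ⟪x.2, y.2⟫`. -/
def innerSnd : V × E →L[ℝ] V × E →L[ℝ] ℝ :=
  ((ContinuousLinearMap.compL ℝ (V × E) E ℝ).flip (ContinuousLinearMap.snd ℝ V E)).comp
    ((innerSL ℝ : E →L[ℝ] E →L[ℝ] ℝ).comp (ContinuousLinearMap.snd ℝ V E))

/-- The operator on the Schwartz space which corresponds to the differential under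
the partial Fourier transform. -/
def fourierFDeriv : 𝓢(V × E, F) →L[ℝ] 𝓢(V × E, V × E →L[ℝ] F) :=
  (postcompCLM ((ContinuousLinearMap.compL ℝ (V × E) (V × E) F).flip
      ((ContinuousLinearMap.inl ℝ V E).comp (ContinuousLinearMap.fst ℝ V E)))).comp
    (fderivCLM ℝ (V × E) F)
  + (postcompCLM (((-(2 * Real.pi * Complex.I : ℂ)) •
      ContinuousLinearMap.id ℂ (V × E →L[ℝ] F)).restrictScalars ℝ)).comp
    (smulRightCLM ℝ F innerSnd)

lemma fourierFDeriv_apply (f : 𝓢(V × E, F)) (x z : V × E) :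
    fourierFDeriv f x z = fderiv ℝ f x (z.1, 0)
      + (-(2 * Real.pi * Complex.I)) • (inner ℝ x.2 z.2 : ℝ) • f x := rfl

/-- The derivative of a partial Fourier transform is again one, of a Schwartz function with values
in a larger space: along V it falls on f, along E it brings down -2πi⟨w, ·⟩. Smoothness and all
seminorm bounds then follow by induction over all target spaces at once. -/
lemma hasFDerivAt_fibreFourier (f : 𝓢(V × E, F)) (y : V × E) :
    HasFDerivAt (fibreFourier f) (fibreFourier (fourierFDeriv f) y : V × E →L[ℝ] F) y := by
  let N := (volume : Measure E).integrablePower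
  have hI := Measure.integrable_pow_neg_integrablePower (volume : Measure E)
  obtain ⟨s, C, hC, h⟩ := exists_pow_mul_norm_le (V := V) (E := E) (F := V × E →L[ℝ] F) 0 N
  have hcont {F' : Type} [NormedAddCommGroup F'] [NormedSpace ℂ F'] (f : 𝓢(V × E, F')) (y : V × E) :
      Continuous fun w => Complex.exp ((-2 * Real.pi * inner ℝ w y.2 : ℝ) * Complex.I) • f (y.1, w) := by
    have : Continuous fun w => f (y.1, w) := (fibre y.1 f).continuous
    fun_prop
  have key := hasFDerivAt_integral_of_dominated_of_fderiv_le (𝕜 := ℝ) (μ := (volume : Measure E))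
    (F := fun y w => Complex.exp ((-2 * Real.pi * inner ℝ w y.2 : ℝ) * Complex.I) • f (y.1, w))
    (F' := fun y w => Complex.exp ((-2 * Real.pi * inner ℝ w y.2 : ℝ) * Complex.I)
      • fourierFDeriv f (y.1, w)) (x₀ := y)
    (bound := fun w => C * s.sup (schwartzSeminormFamily ℝ (V × E) (V × E →L[ℝ] F)) (fourierFDeriv f)
      * (1 + ‖w‖) ^ (-(N : ℝ))) (s := Set.univ) Filter.univ_mem
    (Filter.Eventually.of_forall fun y => (hcont f y).aestronglyMeasurable) ?_
    (hcont _ y).aestronglyMeasurable ?_ (hI.const_mul _) ?_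
  · refine (key.congr_fderiv (fibreFourier_eq _ y).symm).congr_of_eventuallyEq ?_
    exact Filter.Eventually.of_forall fun y => fibreFourier_eq f y
  · refine ((fibre y.1 f).integrable.norm).mono' (hcont f y).aestronglyMeasurable ?_
    exact Filter.Eventually.of_forall fun w => (norm_exp_mul_I_smul _ _).le
  · refine Filter.Eventually.of_forall fun w z _ => ?_
    refine (norm_exp_mul_I_smul _ (fourierFDeriv f (z.1, w))).trans_le ?_
    simpa using h (fourierFDeriv f) z.1 w
  · refine Filter.Eventually.of_forall fun w z _ => ?_
    have h1 : HasFDerivAt (fun z : V × E => f (z.1, w)) _ z :=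
      (f.hasFDerivAt (z.1, w)).comp z
        ((hasFDerivAt_fst (𝕜 := ℝ) (p := z)).prodMk (hasFDerivAt_const w z))
    have h2 : HasFDerivAt (fun z : V × E => (((-2 * Real.pi * inner ℝ w z.2 : ℝ) : ℂ) * Complex.I))
        (((-(2 * Real.pi * Complex.I : ℂ))) • (Complex.ofRealCLM.comp (innerSnd ((0 : V), w)))) z := by
      refine HasFDerivAt.congr_of_eventuallyEq (ContinuousLinearMap.hasFDerivAt _)
        (Filter.Eventually.of_forall fun z => ?_)
      change _ = -(2 * Real.pi * Complex.I : ℂ) * ((inner ℝ w z.2 : ℝ) : ℂ)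
      push_cast
      ring
    refine (h2.cexp.smul h1).congr_fderiv ?_
    refine ContinuousLinearMap.ext fun v => ?_
    change Complex.exp _ • fderiv ℝ f (z.1, w) (v.1, 0)
      + (Complex.exp _ * (-(2 * Real.pi * Complex.I : ℂ) * ((inner ℝ w v.2 : ℝ) : ℂ))) • f (z.1, w)
      = Complex.exp _ • fourierFDeriv f (z.1, w) v
    rw [fourierFDeriv_apply, smul_add, ← Complex.coe_smul, smul_smul, smul_smul,
      mul_assoc (Complex.exp _)]

end

lemma contDiff_fibreFourier (n : ℕ) : ∀ {F : Type} [NormedAddCommGroup F] [NormedSpace ℂ F]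
    (f : 𝓢(V × E, F)), ContDiff ℝ n (fibreFourier f) := by
  induction n with
  | zero =>
    intro F _ _ f
    exact contDiff_zero.2 (continuous_iff_continuousAt.2 fun y =>
      (hasFDerivAt_fibreFourier f y).continuousAt)
  | succ n ih =>
    intro F _ _ f
    exact contDiff_succ_iff_hasFDerivAt.2 ⟨_, ih (fourierFDeriv f), hasFDerivAt_fibreFourier f⟩

lemma exists_pow_mul_norm_iteratedFDeriv_fibreFourier_le (k n : ℕ) :
    ∀ {F : Type} [NormedAddCommGroup F] [NormedSpace ℂ F],
    ∃ (s : Finset (ℕ × ℕ)) (C : ℝ), 0 ≤ C ∧ ∀ (f : 𝓢(V × E, F)) (y : V × E),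
      ‖y‖ ^ k * ‖iteratedFDeriv ℝ n (fibreFourier f) y‖ ≤
        C * s.sup (schwartzSeminormFamily ℝ (V × E) F) f := by
  induction n with
  | zero =>
    intro F _ _
    simpa using exists_pow_mul_norm_fibreFourier_le (V := V) (E := E) (F := F) k
  | succ n ih =>
    intro F _ _
    obtain ⟨s, C, hC, h⟩ := ih (F := V × E →L[ℝ] F)
    obtain ⟨s', C', hC', h'⟩ := exists_sup_seminorm_apply_le (fourierFDeriv (V := V) (E := E) (F := F)) s
    refine ⟨s', C * C', by positivity, fun f y => ?_⟩
    have hd : fderiv ℝ (fibreFourier f) = fibreFourier (fourierFDeriv f) :=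
      funext fun y => (hasFDerivAt_fibreFourier f y).fderiv
    rw [← norm_iteratedFDeriv_fderiv, hd]
    refine (h _ _).trans ?_
    calc _ ≤ C * (C' * s'.sup (schwartzSeminormFamily ℝ (V × E) F) f) := by gcongr; exact h' f
      _ = _ := by ring

/-- The partial Fourier transform of complex Schwartz functions. -/
def fibreFourierCLM : 𝓢(V × E, ℂ) →L[ℂ] 𝓢(V × E, ℂ) :=
  mkCLM fibreFourier
    (fun f g y => by
      rw [fibreFourier_eq_fibre, fibreFourier_eq_fibre, fibreFourier_eq_fibre, map_add,
        FourierTransform.fourier_add, add_apply])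
    (fun a f y => by
      rw [fibreFourier_eq_fibre, fibreFourier_eq_fibre, map_smul,
        FourierTransform.fourier_smul, smul_apply]; rfl)
    (fun f => contDiff_infty.2 fun n => contDiff_fibreFourier n f)
    (fun ⟨k, n⟩ => by
      obtain ⟨s, C, hC, h⟩ := exists_pow_mul_norm_iteratedFDeriv_fibreFourier_le (V := V) (E := E) k n (F := ℂ)
      exact ⟨s, C, hC, fun f y => (sup_seminorm_real_eq s f) ▸ h f y⟩)

lemma fibreFourierCLM_apply (f : 𝓢(V × E, ℂ)) (y : V × E) :
    fibreFourierCLM f y = 𝓕 (fibre y.1 f) y.2 := rfl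

lemma fibre_fibreFourierCLM (f : 𝓢(V × E, ℂ)) (v : V) :
    fibre v (fibreFourierCLM f) = 𝓕 (fibre v f) := rfl

end PartialFourier

end SchwartzMap

namespace SchwartzMap

open scoped FourierTransform

section FibreFourierInverse

variable {V E : Type} [NormedAddCommGroup V] [NormedSpace ℝ V] [NormedAddCommGroup E]
  [InnerProductSpace ℝ E] [FiniteDimensional ℝ E] [MeasurableSpace E] [BorelSpace E]

/-- The inverse partial Fourier transform of complex Schwartz functions. -/
def fibreFourierInvCLM : 𝓢(V × E, ℂ) →L[ℂ] 𝓢(V × E, ℂ) :=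
  (compCLMOfContinuousLinearEquiv ℂ
    ((ContinuousLinearEquiv.refl ℝ V).prodCongr (ContinuousLinearEquiv.neg ℝ))).comp fibreFourierCLM

lemma fibreFourierInvCLM_apply (f : 𝓢(V × E, ℂ)) (y : V × E) :
    fibreFourierInvCLM f y = 𝓕⁻ (fibre y.1 f) y.2 := by
  rw [fourierInv_coe, Real.fourierInv_eq_fourier_neg]; rfl

/-- The partial Fourier transform as an automorphism of the Schwartz space. -/
def fibreFourierCLE : 𝓢(V × E, ℂ) ≃L[ℂ] 𝓢(V × E, ℂ) :=
  ContinuousLinearEquiv.equivOfInverse fibreFourierCLM fibreFourierInvCLM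
    (fun f => by
      ext ⟨v, w⟩
      rw [fibreFourierInvCLM_apply, fibre_fibreFourierCLM, FourierTransform.fourierInv_fourier_eq]
      rfl)
    (fun f => by
      ext ⟨v, w⟩
      have h : fibre v (fibreFourierInvCLM f) = 𝓕⁻ (fibre v f) := by
        ext w; exact fibreFourierInvCLM_apply f (v, w)
      rw [fibreFourierCLM_apply, h, FourierTransform.fourier_fourierInv_eq]
      rfl)

end FibreFourierInverse

section General

/-- The change of variables of Schwartz functions along a linear isomorphism. -/
def compCLE {V V' : Type*} [NormedAddCommGroup V] [NormedSpace ℝ V] [NormedAddCommGroup V']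
    [NormedSpace ℝ V'] (e : V ≃L[ℝ] V') : 𝓢(V', ℂ) ≃L[ℂ] 𝓢(V, ℂ) :=
  ContinuousLinearEquiv.equivOfInverse (compCLMOfContinuousLinearEquiv ℂ e)
    (compCLMOfContinuousLinearEquiv ℂ e.symm)
    (fun f => by ext x; simp) (fun f => by ext x; simp)

@[simp] lemma compCLE_apply {V V' : Type*} [NormedAddCommGroup V] [NormedSpace ℝ V]
    [NormedAddCommGroup V'] [NormedSpace ℝ V'] (e : V ≃L[ℝ] V') (f : 𝓢(V', ℂ)) (x : V) :
    compCLE e f x = f (e x) := rfl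

@[simp] lemma compCLE_symm_apply {V V' : Type*} [NormedAddCommGroup V] [NormedSpace ℝ V]
    [NormedAddCommGroup V'] [NormedSpace ℝ V'] (e : V ≃L[ℝ] V') (f : 𝓢(V, ℂ)) (x : V') :
    (compCLE e).symm f x = f (e.symm x) := rfl

lemma exists_integral_eq_smul {W E : Type*} [NormedAddCommGroup W] [NormedSpace ℝ W]
    [FiniteDimensional ℝ W] [MeasurableSpace W] [BorelSpace W] (μ : Measure W) [μ.IsAddHaarMeasure]
    [NormedAddCommGroup E] [NormedSpace ℝ E] [FiniteDimensional ℝ E] [MeasurableSpace E] [BorelSpace E]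
    (ν : Measure E) [ν.IsAddHaarMeasure] (e : W ≃L[ℝ] E) :
    ∃ c : ℝ, 0 < c ∧ ∀ f : W → ℂ, ∫ w, f w ∂μ = c * ∫ u, f (e.symm u) ∂ν := by
  have : (μ.map e).IsAddHaarMeasure := e.isAddHaarMeasure_map μ
  let c := (μ.map e).addHaarScalarFactor ν
  have hc : 0 < c := Measure.addHaarScalarFactor_pos_of_isAddHaarMeasure _ _
  refine ⟨c, hc, fun f => ?_⟩
  have h1 : ∫ w, f w ∂μ = ∫ u, f (e.symm u) ∂(μ.map e) := by
    have := integral_map_equiv (μ := μ) e.toHomeomorph.toMeasurableEquiv (fun u => f (e.symm u))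
    refine Eq.trans ?_ this.symm
    congr 1
    ext w
    exact congrArg f (e.symm_apply_apply w).symm
  rw [h1, Measure.isAddLeftInvariant_eq_smul (μ.map e) ν, integral_smul_nnreal_measure]
  simp [c, NNReal.smul_def]

variable {V W Ξ : Type*} [NormedAddCommGroup V] [NormedSpace ℝ V] [FiniteDimensional ℝ V]
  [NormedAddCommGroup W] [NormedSpace ℝ W] [FiniteDimensional ℝ W] [MeasurableSpace W] [BorelSpace W]
  [NormedAddCommGroup Ξ] [NormedSpace ℝ Ξ] [FiniteDimensional ℝ Ξ] [MeasurableSpace Ξ] [BorelSpace Ξ]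

/-- The integral of a Schwartz function over the second variable is a Schwartz function. -/
lemma exists_integral_snd (μ : Measure W) [μ.IsAddHaarMeasure] :
    ∃ I : 𝓢(V × W, ℂ) →L[ℂ] 𝓢(V, ℂ), ∀ f v, I f v = ∫ w, f (v, w) ∂μ := by
  -- The partial Fourier transform above is restricted to spaces in `Type` with a Euclidean fibre,
  -- so both factors are replaced by coordinate spaces.
  let eV := toEuclidean (E := V)
  let eW := toEuclidean (E := W)
  obtain ⟨c, -, hc⟩ := exists_integral_eq_smul μ volume eW
  refine ⟨(c : ℂ) • (compCLMOfContinuousLinearEquiv ℂ eV).comp (zeroSection.comp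
    (fibreFourierCLM.comp (compCLMOfContinuousLinearEquiv ℂ (eV.prodCongr eW).symm))),
    fun f v => ?_⟩
  rw [hc]
  -- Integration over the fibre is the Fourier transform at frequency zero.
  change (c : ℂ) * 𝓕 (fun w => f (eV.symm (eV v), eW.symm w)) 0 = _
  rw [Real.fourier_eq']
  simp

/-- Coordinates in which a perfect pairing is a multiple of the Euclidean inner product. -/
lemma exists_coordinates (b : Ξ →ₗ[ℝ] Module.Dual ℝ W) (hb : Function.Bijective b) :
    ∃ (n : ℕ) (eW : W ≃L[ℝ] EuclideanSpace ℝ (Fin n)) (eΞ : Ξ ≃L[ℝ] EuclideanSpace ℝ (Fin n)),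
      ∀ ξ w, b ξ w = 2 * Real.pi * inner ℝ (eW w) (eΞ ξ) := by
  let eW := toEuclidean (E := W)
  let E := EuclideanSpace ℝ (Fin (Module.finrank ℝ W))
  have hpi : (2 * Real.pi) ≠ 0 := by positivity
  let e1 : Ξ ≃ₗ[ℝ] Module.Dual ℝ W := LinearEquiv.ofBijective b hb
  let e2 : Module.Dual ℝ W ≃ₗ[ℝ] Module.Dual ℝ E := eW.symm.toLinearEquiv.dualMap
  let e3 : Module.Dual ℝ E ≃ₗ[ℝ] (E →L[ℝ] ℝ) := LinearMap.toContinuousLinearMap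
  let e4 : (E →L[ℝ] ℝ) ≃ₗ[ℝ] E := (InnerProductSpace.toDual ℝ E).symm.toLinearEquiv
  -- Division by 2π compensates the convention exp(-2πi⟨w, ξ⟩) of the Fourier transform.
  let e5 : E ≃ₗ[ℝ] E := LinearEquiv.smulOfNeZero ℝ E (2 * Real.pi)⁻¹ (inv_ne_zero hpi)
  let eΞ := (e1 ≪≫ₗ e2 ≪≫ₗ e3 ≪≫ₗ e4 ≪≫ₗ e5).toContinuousLinearEquiv
  refine ⟨_, eW, eΞ, fun ξ w => ?_⟩
  have h : eΞ ξ = (2 * Real.pi)⁻¹ • (InnerProductSpace.toDual ℝ E).symm (e3 (e2 (e1 ξ))) := rfl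
  rw [h, inner_smul_right, real_inner_comm, InnerProductSpace.toDual_symm_apply]
  have h2 : e3 (e2 (e1 ξ)) (eW w) = b ξ (eW.symm (eW w)) := rfl
  rw [h2, eW.symm_apply_apply, mul_inv_cancel_left₀ hpi]

/-- The partial Fourier transform for a perfect pairing, with its inversion formula and the
Plancherel formula. -/
theorem exists_pairingFourier (b : Ξ →ₗ[ℝ] Module.Dual ℝ W) (hb : Function.Bijective b)
    (μ : Measure W) [μ.IsAddHaarMeasure] (ν : Measure Ξ) [ν.IsAddHaarMeasure] :
    ∃ (T : 𝓢(V × W, ℂ) ≃L[ℂ] 𝓢(V × Ξ, ℂ)) (c : ℝ), 0 < c ∧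
      (∀ f y, T f y = ∫ w, Complex.exp (-(b y.2 w : ℝ) * Complex.I) * f (y.1, w) ∂μ) ∧
      (∀ g x, T.symm g x = c * ∫ ξ, Complex.exp ((b ξ x.2 : ℝ) * Complex.I) * g (x.1, ξ) ∂ν) ∧
      ∀ f g v, ∫ w, starRingEnd ℂ (f (v, w)) * g (v, w) ∂μ
        = c * ∫ ξ, starRingEnd ℂ (T f (v, ξ)) * T g (v, ξ) ∂ν := by
  let eV := toEuclidean (E := V)
  obtain ⟨n, eW, eΞ, he⟩ := exists_coordinates b hb
  obtain ⟨c, hc0, hc⟩ := exists_integral_eq_smul μ volume eW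
  obtain ⟨d, hd0, hd⟩ := exists_integral_eq_smul ν volume eΞ
  have hc0' : (c : ℂ) ≠ 0 := Complex.ofReal_ne_zero.2 hc0.ne'
  have hd0' : (d : ℂ) ≠ 0 := Complex.ofReal_ne_zero.2 hd0.ne'
  let T : 𝓢(V × W, ℂ) ≃L[ℂ] 𝓢(V × Ξ, ℂ) := ((compCLE (eV.prodCongr eW)).symm.trans
    fibreFourierCLE).trans ((compCLE (eV.prodCongr eΞ)).trans
      (ContinuousLinearEquiv.smulLeft (Units.mk0 (c : ℂ) hc0')))
  have hT (f : 𝓢(V × W, ℂ)) (v : V) (ξ : Ξ) : T f (v, ξ)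
      = c * 𝓕 (fibre (eV v) (compCLE (eV.prodCongr eW).symm f)) (eΞ ξ) := rfl
  have hfib (f : 𝓢(V × W, ℂ)) (v : V) (u) :
      fibre (eV v) (compCLE (eV.prodCongr eW).symm f) u = f (v, eW.symm u) := by
    rw [fibre_apply, compCLE_apply]
    exact congrArg f (Prod.ext (eV.symm_apply_apply v) rfl)
  -- c and d are the densities of μ and ν in Euclidean coordinates. T is c times the Euclidean
  -- transform, so its inverse carries c⁻¹, and a further d⁻¹ when written with ν; Plancherel leads
  -- to c·c⁻²·d⁻¹, the same constant.
  refine ⟨T, (c * d)⁻¹, by positivity, fun f y => ?_, fun g x => ?_, fun f g v => ?_⟩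
  · rw [hc, hT, fourier_coe, Real.fourier_eq']
    congr 2
    ext u
    rw [he, eW.apply_symm_apply, smul_eq_mul, hfib]
    congr 3
    push_cast; ring
  · have h1 : T.symm g x = (c : ℂ)⁻¹ * fibreFourierInvCLM (compCLE (eV.prodCongr eΞ).symm g)
        (eV x.1, eW x.2) := by
      have h2 : T.symm g x = fibreFourierInvCLM (compCLE (eV.prodCongr eΞ).symm ((c : ℂ)⁻¹ • g))
        (eV x.1, eW x.2) := rfl
      rw [h2, map_smul, map_smul, smul_apply, smul_eq_mul]
    rw [hd, h1, fibreFourierInvCLM_apply, fourierInv_coe, Real.fourierInv_eq']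
    push_cast
    rw [mul_inv, mul_assoc, inv_mul_cancel_left₀ hd0']
    congr 2
    ext u
    rw [he, eΞ.apply_symm_apply, smul_eq_mul, fibre_apply, compCLE_apply, real_inner_comm]
    congr 2
    · push_cast; ring_nf
    · exact Prod.ext (eV.symm_apply_apply x.1) rfl
  · have h := integral_sesq_fourier_fourier (fibre (eV v) (compCLE (eV.prodCongr eW).symm f))
      (fibre (eV v) (compCLE (eV.prodCongr eW).symm g)) (innerSL ℂ)
    simp only [hfib, innerSL_apply_apply, RCLike.inner_apply'] at h
    rw [hc, hd, ← h]
    simp only [hT, eΞ.apply_symm_apply, map_mul, Complex.conj_ofReal]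
    rw [← mul_assoc, ← integral_const_mul, ← integral_const_mul]
    congr 1
    ext u
    push_cast
    field_simp

end General

end SchwartzMap

/-! ### Composition of Schwartz kernels -/

namespace SchwartzMap

section ProductOfProjections

variable {V V₁ V₂ : Type*} [NormedAddCommGroup V] [NormedSpace ℝ V] [NormedAddCommGroup V₁]
  [NormedSpace ℝ V₁] [NormedAddCommGroup V₂] [NormedSpace ℝ V₂]

lemma exists_bound_comp_clm (P : V →L[ℝ] V₁) (f : 𝓢(V₁, ℂ)) (k i : ℕ) :
    ∃ C, 0 ≤ C ∧ ∀ x, (1 + ‖P x‖) ^ k * ‖iteratedFDeriv ℝ i (fun y => f (P y)) x‖ ≤ C := by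
  refine ⟨‖P‖ ^ i * (2 ^ k * ((Finset.Iic (k, i)).sup fun m => SchwartzMap.seminorm ℝ m.1 m.2) f),
    by positivity, fun x => ?_⟩
  have h1 : ‖iteratedFDeriv ℝ i (fun y => f (P y)) x‖ ≤ ‖P‖ ^ i * ‖iteratedFDeriv ℝ i f (P x)‖ := by
    have := P.iteratedFDeriv_comp_right (f.smooth ⊤) x (i := i) (mod_cast le_top)
    change ‖iteratedFDeriv ℝ i (f ∘ P) x‖ ≤ _
    rw [this]
    refine (ContinuousMultilinearMap.norm_compContinuousLinearMap_le _ _).trans_eq ?_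
    rw [Finset.prod_const, Finset.card_univ, Fintype.card_fin, mul_comm]
  have h2 := one_add_le_sup_seminorm_apply (𝕜 := ℝ) (m := (k, i)) le_rfl le_rfl f (P x)
  calc _ ≤ (1 + ‖P x‖) ^ k * (‖P‖ ^ i * ‖iteratedFDeriv ℝ i f (P x)‖) := by gcongr
    _ = ‖P‖ ^ i * ((1 + ‖P x‖) ^ k * ‖iteratedFDeriv ℝ i f (P x)‖) := by ring
    _ ≤ _ := by gcongr

/-- The product of the pull-backs of two Schwartz functions by linear maps which are jointly
proper. -/
def mulComp (P : V →L[ℝ] V₁) (Q : V →L[ℝ] V₂) (h : ∀ x, ‖x‖ ≤ ‖P x‖ + ‖Q x‖) (f : 𝓢(V₁, ℂ))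
    (g : 𝓢(V₂, ℂ)) : 𝓢(V, ℂ) where
  toFun x := f (P x) * g (Q x)
  smooth' := ((f.smooth ⊤).comp P.contDiff).mul ((g.smooth ⊤).comp Q.contDiff)
  decay' k n := by
    choose C hC0 hC using exists_bound_comp_clm P f k
    choose D hD0 hD using exists_bound_comp_clm Q g k
    refine ⟨∑ i ∈ Finset.range (n + 1), (n.choose i : ℝ) * (C i * D (n - i)), fun x => ?_⟩
    refine (mul_le_mul_of_nonneg_left (norm_iteratedFDeriv_mul_le ((f.smooth ⊤).comp P.contDiff)
      ((g.smooth ⊤).comp Q.contDiff) x (n := n) (mod_cast le_top)) (by positivity)).trans ?_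
    rw [Finset.mul_sum]
    refine Finset.sum_le_sum fun i _ => ?_
    -- The weight ‖x‖^k is distributed over the two factors, each of which decays in its own
    -- projection.
    have h1 : ‖x‖ ≤ (1 + ‖P x‖) * (1 + ‖Q x‖) := by
      nlinarith [h x, norm_nonneg (P x), norm_nonneg (Q x), mul_nonneg (norm_nonneg (P x)) (norm_nonneg (Q x))]
    have h2 := hC i x
    have h3 := hD (n - i) x
    have := hC0 i
    calc ‖x‖ ^ k * ((n.choose i : ℝ) * ‖iteratedFDeriv ℝ i (fun y => f (P y)) x‖
          * ‖iteratedFDeriv ℝ (n - i) (fun y => g (Q y)) x‖)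
        ≤ ((1 + ‖P x‖) * (1 + ‖Q x‖)) ^ k * ((n.choose i : ℝ) *
          ‖iteratedFDeriv ℝ i (fun y => f (P y)) x‖
          * ‖iteratedFDeriv ℝ (n - i) (fun y => g (Q y)) x‖) := by gcongr
      _ = (n.choose i : ℝ) * (((1 + ‖P x‖) ^ k * ‖iteratedFDeriv ℝ i (fun y => f (P y)) x‖) *
          ((1 + ‖Q x‖) ^ k * ‖iteratedFDeriv ℝ (n - i) (fun y => g (Q y)) x‖)) := by
        rw [mul_pow]; ring
      _ ≤ _ := by gcongr

end ProductOfProjections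

section Kernel

variable {A : Type*} [NormedAddCommGroup A] [NormedSpace ℝ A] [FiniteDimensional ℝ A]
  [MeasurableSpace A] [BorelSpace A] (μ : Measure A) [μ.IsAddHaarMeasure]

/-- The transposed kernel. -/
def swap : 𝓢(A × A, ℂ) ≃L[ℂ] 𝓢(A × A, ℂ) := compCLE (ContinuousLinearEquiv.prodComm ℝ A A)

lemma integrable_snd_kernel (K : 𝓢(A × A, ℂ)) (s : A) : Integrable (fun t => K (s, t)) μ :=
  (fibre s K).integrable

lemma memLp_snd_kernel (K : 𝓢(A × A, ℂ)) (s : A) : MemLp (fun t => K (s, t)) 2 μ :=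
  (fibre s K).memLp 2 μ

lemma memLp_fst_kernel (K : 𝓢(A × A, ℂ)) (t : A) : MemLp (fun s => K (s, t)) 2 μ :=
  memLp_snd_kernel μ (swap K) t

/-- The product `((s, t), m) ↦ K₁(s, m) K₂(m, t)`. -/
def kernelProduct (K₁ K₂ : 𝓢(A × A, ℂ)) : 𝓢((A × A) × A, ℂ) :=
  mulComp (((ContinuousLinearMap.fst ℝ A A).comp (ContinuousLinearMap.fst ℝ (A × A) A)).prod
      (ContinuousLinearMap.snd ℝ (A × A) A))
    ((ContinuousLinearMap.snd ℝ (A × A) A).prod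
      ((ContinuousLinearMap.snd ℝ A A).comp (ContinuousLinearMap.fst ℝ (A × A) A)))
    (fun x => by
      simp only [ContinuousLinearMap.prod_apply, ContinuousLinearMap.comp_apply,
        ContinuousLinearMap.coe_fst', ContinuousLinearMap.coe_snd', Prod.norm_def]
      have := norm_nonneg x.1.1
      have := norm_nonneg x.1.2
      have := norm_nonneg x.2
      refine max_le (max_le ?_ ?_) ?_
      · exact le_add_of_le_of_nonneg (le_max_left _ _) (by positivity)
      · exact le_add_of_nonneg_of_le (by positivity) (le_max_right _ _)
      · exact le_add_of_le_of_nonneg (le_max_right _ _) (by positivity)) K₁ K₂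

lemma exists_kernelComp (K₁ K₂ : 𝓢(A × A, ℂ)) :
    ∃ K : 𝓢(A × A, ℂ), ∀ s t, K (s, t) = ∫ m, K₁ (s, m) * K₂ (m, t) ∂μ := by
  obtain ⟨I, hI⟩ := exists_integral_snd (V := A × A) μ
  exact ⟨I (kernelProduct K₁ K₂), fun s t => hI _ _⟩

/-- The composition `(K₁ ∘ K₂)(s, t) = ∫ K₁(s, m) K₂(m, t) dm` of kernels. -/
def kernelComp (K₁ K₂ : 𝓢(A × A, ℂ)) : 𝓢(A × A, ℂ) := (exists_kernelComp μ K₁ K₂).choose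

lemma kernelComp_apply (K₁ K₂ : 𝓢(A × A, ℂ)) (s t : A) :
    kernelComp μ K₁ K₂ (s, t) = ∫ m, K₁ (s, m) * K₂ (m, t) ∂μ :=
  (exists_kernelComp μ K₁ K₂).choose_spec s t

lemma integrable_kernel_mul (K₁ K₂ : 𝓢(A × A, ℂ)) (s t : A) :
    Integrable (fun m => K₁ (s, m) * K₂ (m, t)) μ :=
  (memLp_snd_kernel μ K₁ s).integrable_mul (memLp_fst_kernel μ K₂ t)

lemma kernelComp_add_left (K₁ K₁' K₂ : 𝓢(A × A, ℂ)) :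
    kernelComp μ (K₁ + K₁') K₂ = kernelComp μ K₁ K₂ + kernelComp μ K₁' K₂ := by
  ext ⟨s, t⟩
  simp only [kernelComp_apply, add_apply, add_mul]
  exact integral_add (integrable_kernel_mul μ K₁ K₂ s t) (integrable_kernel_mul μ K₁' K₂ s t)

lemma kernelComp_add_right (K₁ K₂ K₂' : 𝓢(A × A, ℂ)) :
    kernelComp μ K₁ (K₂ + K₂') = kernelComp μ K₁ K₂ + kernelComp μ K₁ K₂' := by
  ext ⟨s, t⟩
  simp only [kernelComp_apply, add_apply, mul_add]
  exact integral_add (integrable_kernel_mul μ K₁ K₂ s t) (integrable_kernel_mul μ K₁ K₂' s t)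

lemma kernelComp_smul_left (c : ℂ) (K₁ K₂ : 𝓢(A × A, ℂ)) :
    kernelComp μ (c • K₁) K₂ = c • kernelComp μ K₁ K₂ := by
  ext ⟨s, t⟩
  simp only [kernelComp_apply, smul_apply, smul_mul_assoc]
  exact integral_smul _ _

lemma kernelComp_smul_right (c : ℂ) (K₁ K₂ : 𝓢(A × A, ℂ)) :
    kernelComp μ K₁ (c • K₂) = c • kernelComp μ K₁ K₂ := by
  ext ⟨s, t⟩
  simp only [kernelComp_apply, smul_apply, mul_smul_comm]
  exact integral_smul _ _

lemma exists_norm_le (K : 𝓢(A × A, ℂ)) : ∃ C, ∀ x, ‖K x‖ ≤ C :=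
  ⟨_, norm_le_seminorm ℂ K⟩

theorem kernelComp_assoc (K₁ K₂ K₃ : 𝓢(A × A, ℂ)) :
    kernelComp μ (kernelComp μ K₁ K₂) K₃ = kernelComp μ K₁ (kernelComp μ K₂ K₃) := by
  ext ⟨s, t⟩
  simp only [kernelComp_apply, ← integral_mul_const, ← integral_const_mul]
  rw [integral_integral_swap]
  · simp only [mul_assoc]
  -- For Fubini, the middle kernel is integrable in both variables and the outer two are bounded.
  · obtain ⟨C₁, h₁⟩ := exists_norm_le K₁
    obtain ⟨C₃, h₃⟩ := exists_norm_le K₃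
    have h2 : Integrable (fun x : A × A => swap K₂ x) (μ.prod μ) := (swap K₂).integrable
    have h3 := (h2.bdd_mul (f := fun x : A × A => K₁ (s, x.2)) (c := C₁)
      (K₁.continuous.comp (by fun_prop)).aestronglyMeasurable
      (Filter.Eventually.of_forall fun x => h₁ _)).mul_bdd (g := fun x : A × A => K₃ (x.1, t)) (c := C₃)
      (K₃.continuous.comp (by fun_prop)).aestronglyMeasurable
      (Filter.Eventually.of_forall fun x => h₃ _)
    exact h3

lemma integral_norm_sq_eq_norm_toLp_sq {V : Type*} [NormedAddCommGroup V] [NormedSpace ℝ V]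
    [FiniteDimensional ℝ V] [MeasurableSpace V] [BorelSpace V] (ν : Measure V) [ν.IsAddHaarMeasure]
    (f : 𝓢(V, ℂ)) : ∫ x, ‖f x‖ ^ 2 ∂ν = ‖f.toLp 2 ν‖ ^ 2 := by
  have h := inner_toL2_toL2_eq f f ν
  rw [inner_self_eq_norm_sq_to_K] at h
  simp only [inner_self_eq_norm_sq_to_K] at h
  have h2 : ((∫ x, ‖f x‖ ^ 2 ∂ν : ℝ) : ℂ) = ((‖f.toLp 2 ν‖ ^ 2 : ℝ) : ℂ) := by
    rw [← integral_complex_ofReal]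
    push_cast
    exact h.symm
  exact_mod_cast h2

lemma norm_integral_mul_sq_le {f g : A → ℂ} (hf : MemLp f 2 μ) (hg : MemLp g 2 μ) :
    ‖∫ m, f m * g m ∂μ‖ ^ 2 ≤ (∫ m, ‖f m‖ ^ 2 ∂μ) * ∫ m, ‖g m‖ ^ 2 ∂μ := by
  have h := integral_mul_norm_le_Lp_mul_Lq (μ := μ) (f := f) (g := g) Real.HolderConjugate.two_two
    (by simpa using hf) (by simpa using hg)
  simp only [Real.rpow_two] at h
  have h0 : ‖∫ m, f m * g m ∂μ‖ ≤ ∫ m, ‖f m‖ * ‖g m‖ ∂μ :=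
    (norm_integral_le_integral_norm _).trans_eq (by simp only [norm_mul])
  have hf0 : 0 ≤ ∫ m, ‖f m‖ ^ 2 ∂μ := integral_nonneg fun _ => by positivity
  have hg0 : 0 ≤ ∫ m, ‖g m‖ ^ 2 ∂μ := integral_nonneg fun _ => by positivity
  have h1 := h0.trans h
  rw [← Real.sqrt_eq_rpow, ← Real.sqrt_eq_rpow, ← Real.sqrt_mul hf0] at h1
  calc ‖∫ m, f m * g m ∂μ‖ ^ 2 ≤ Real.sqrt ((∫ m, ‖f m‖ ^ 2 ∂μ) * ∫ m, ‖g m‖ ^ 2 ∂μ) ^ 2 := by gcongr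
    _ = _ := Real.sq_sqrt (mul_nonneg hf0 hg0)

lemma integrable_norm_sq {V : Type*} [NormedAddCommGroup V] [NormedSpace ℝ V]
    [FiniteDimensional ℝ V] [MeasurableSpace V] [BorelSpace V] (ν : Measure V) [ν.IsAddHaarMeasure]
    (f : 𝓢(V, ℂ)) : Integrable (fun x => ‖f x‖ ^ 2) ν :=
  (memLp_two_iff_integrable_sq_norm f.continuous.aestronglyMeasurable).1 (f.memLp 2 ν)

/-- Submultiplicativity of the Hilbert–Schmidt norm: Cauchy–Schwarz in the middle variable for fixed
(s, t), then integration over s and t separately. -/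
theorem norm_toLp_kernelComp_le (K₁ K₂ : 𝓢(A × A, ℂ)) :
    ‖(kernelComp μ K₁ K₂).toLp 2 (μ.prod μ)‖
      ≤ ‖K₁.toLp 2 (μ.prod μ)‖ * ‖K₂.toLp 2 (μ.prod μ)‖ := by
  refine le_of_sq_le_sq ?_ (by positivity)
  rw [mul_pow, ← integral_norm_sq_eq_norm_toLp_sq, ← integral_norm_sq_eq_norm_toLp_sq,
    ← integral_norm_sq_eq_norm_toLp_sq]
  have hi := integrable_norm_sq (μ.prod μ) K₁
  have hi2 := integrable_norm_sq (μ.prod μ) (swap K₂)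
  have h1 : ∫ x, ‖K₁ x‖ ^ 2 ∂(μ.prod μ) = ∫ s, ∫ m, ‖K₁ (s, m)‖ ^ 2 ∂μ ∂μ := integral_prod _ hi
  have h2 : ∫ x, ‖K₂ x‖ ^ 2 ∂(μ.prod μ) = ∫ t, ∫ m, ‖K₂ (m, t)‖ ^ 2 ∂μ ∂μ :=
    integral_prod_symm _ (integrable_norm_sq (μ.prod μ) K₂)
  rw [h1, h2, ← integral_prod_mul]
  refine integral_mono (integrable_norm_sq _ _)
    (hi.integral_prod_left.mul_prod hi2.integral_prod_left) fun x => ?_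
  obtain ⟨s, t⟩ := x
  change ‖kernelComp μ K₁ K₂ (s, t)‖ ^ 2 ≤ _
  rw [kernelComp_apply]
  exact norm_integral_mul_sq_le μ (memLp_snd_kernel μ K₁ s) (memLp_fst_kernel μ K₂ t)

end Kernel

end SchwartzMap

/-! ### Conjugation, tempered distributions of bounded functions, tame maps -/

namespace SchwartzMap

/-- Complex conjugation of Schwartz functions. -/
def conj {V : Type*} [NormedAddCommGroup V] [NormedSpace ℝ V] : 𝓢(V, ℂ) →L[ℝ] 𝓢(V, ℂ) :=
  postcompCLM Complex.conjCLE.toContinuousLinearMap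

@[simp] lemma conj_apply {V : Type*} [NormedAddCommGroup V] [NormedSpace ℝ V] (f : 𝓢(V, ℂ)) (x : V) :
    conj f x = starRingEnd ℂ (f x) := rfl

lemma integrable_mul {V : Type*} [NormedAddCommGroup V] [NormedSpace ℝ V]
    [FiniteDimensional ℝ V] [MeasurableSpace V] [BorelSpace V] (ν : Measure V) [ν.IsAddHaarMeasure]
    (f g : 𝓢(V, ℂ)) : Integrable (fun x => f x * g x) ν :=
  (f.memLp 2 ν).integrable_mul (g.memLp 2 ν)

end SchwartzMap

/-- The tempered distribution of a bounded continuous function. -/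
lemma exists_temperedDistribution_of_bounded {V : Type*} [NormedAddCommGroup V] [NormedSpace ℝ V]
    [FiniteDimensional ℝ V] [MeasurableSpace V] [BorelSpace V] (ν : Measure V) [ν.IsAddHaarMeasure]
    {g : V → ℂ} (hg : Continuous g) (hb : ∃ C, ∀ x, ‖g x‖ ≤ C) :
    ∃ D : 𝓢'(V, ℂ), ∀ w : 𝓢(V, ℂ), D w = ∫ x, g x * w x ∂ν := by
  obtain ⟨C, hC⟩ := hb
  have hm : MemLp g ⊤ ν := memLp_top_of_bound hg.aestronglyMeasurable C (Filter.Eventually.of_forall hC)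
  refine ⟨Lp.toTemperedDistribution hm.toLp, fun w => ?_⟩
  rw [Lp.toTemperedDistribution_apply]
  refine integral_congr_ae ?_
  filter_upwards [hm.coeFn_toLp] with x hx
  rw [hx, smul_eq_mul, mul_comm]

lemma eq_zero_of_forall_integral_mul_eq_zero {V : Type*} [NormedAddCommGroup V] [NormedSpace ℝ V]
    [FiniteDimensional ℝ V] [MeasurableSpace V] [BorelSpace V] (ν : Measure V) [ν.IsAddHaarMeasure]
    {g : V → ℂ} (hg : Continuous g) (h : ∀ w : 𝓢(V, ℂ), ∫ x, g x * w x ∂ν = 0) : g = 0 := by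
  have hae : ∀ᵐ x ∂ν, g x = 0 := by
    refine ae_eq_zero_of_integral_contDiff_smul_eq_zero hg.locallyIntegrable fun f hf hc => ?_
    have hc' : HasCompactSupport (Complex.ofRealCLM ∘ f) := hc.comp_left rfl
    rw [← h (hc'.toSchwartzMap (Complex.ofRealCLM.contDiff.comp hf))]
    refine integral_congr_ae (Filter.Eventually.of_forall fun x => ?_)
    change f x • g x = g x * (f x : ℂ)
    rw [Complex.real_smul, mul_comm]
  exact Continuous.ae_eq_iff_eq ν hg continuous_zero |>.1 hae

/-- A smooth map whose derivatives are polynomially bounded by its values, and which does not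
shrink its argument more than polynomially. -/
structure IsTame {D E : Type*} [NormedAddCommGroup D] [NormedSpace ℝ D] [NormedAddCommGroup E]
    [NormedSpace ℝ E] (g : D → E) : Prop where
  contDiff : ContDiff ℝ ∞ g
  bound : ∀ n : ℕ, ∃ (k : ℕ) (C : ℝ), ∀ x, ‖iteratedFDeriv ℝ n g x‖ ≤ C * (1 + ‖g x‖) ^ k
  le_bound : ∃ (k : ℕ) (C : ℝ), ∀ x, ‖x‖ ≤ C * (1 + ‖g x‖) ^ k

/-! ### The twist on Schwartz functions and the Fourier transform of M along 𝓛 -/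

namespace ESET

section Twist

variable {𝔞 : Type*} [NormedAddCommGroup 𝔞] [NormedSpace ℝ 𝔞]

lemma scaledTwist_scaledTwist {ħ : ℝ} (hħ : 0 < ħ) {φ ψ : 𝔞 → 𝔞} (h : ∀ a, φ (ψ a) = a) (y : 𝔞 × 𝔞) :
    scaledTwist ħ φ (scaledTwist ħ ψ y) = y := by
  have h1 : ħ / 2 * (2 / ħ) = 1 := by field_simp
  have h2 : 2 / ħ * (ħ / 2) = 1 := by field_simp
  simp [scaledTwist, smul_smul, h1, h, h2]

lemma contDiff_scaledTwist {ħ : ℝ} {φ : 𝔞 → 𝔞} (h : ContDiff ℝ ∞ φ) : ContDiff ℝ ∞ (scaledTwist ħ φ) :=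
  contDiff_fst.prodMk ((h.comp (contDiff_snd.const_smul (ħ / 2))).const_smul (2 / ħ))

theorem isTame_scaledTwist {ħ : ℝ} (hħ : 0 < ħ) {φ : 𝔞 → 𝔞} (h : IsTame φ) :
    IsTame (scaledTwist ħ φ) := by
  let P : 𝔞 × 𝔞 →L[ℝ] 𝔞 := (ħ / 2) • ContinuousLinearMap.snd ℝ 𝔞 𝔞
  let Q : 𝔞 →L[ℝ] 𝔞 × 𝔞 := (2 / ħ) • ContinuousLinearMap.inr ℝ 𝔞 𝔞
  let R : 𝔞 × 𝔞 →L[ℝ] 𝔞 × 𝔞 := (ContinuousLinearMap.inl ℝ 𝔞 𝔞).comp (ContinuousLinearMap.fst ℝ 𝔞 𝔞)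
  -- Linear part in the first variable plus φ between two linear maps in the second; each summand is
  -- estimated separately.
  have hg : scaledTwist ħ φ = R + (Q ∘ φ) ∘ P := by
    ext y <;> simp [scaledTwist, R, P, Q]
  have hφg (y : 𝔞 × 𝔞) : 1 + ‖φ (P y)‖ ≤ (1 + ħ / 2) * (1 + ‖scaledTwist ħ φ y‖) := by
    have h1 : φ (P y) = (ħ / 2) • (scaledTwist ħ φ y).2 := by
      have h3 : ħ / 2 * (2 / ħ) = 1 := by field_simp
      simp [scaledTwist, P, smul_smul, h3]
    have h2 := norm_snd_le (scaledTwist ħ φ y)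
    rw [h1, norm_smul, Real.norm_of_nonneg (by positivity)]
    nlinarith [norm_nonneg (scaledTwist ħ φ y), mul_le_mul_of_nonneg_left h2 (by positivity : 0 ≤ ħ / 2)]
  have hle : ∃ (k : ℕ) (C : ℝ), 0 ≤ C ∧ ∀ x, ‖x‖ ≤ C * (1 + ‖scaledTwist ħ φ x‖) ^ k := by
    obtain ⟨k, C, hC⟩ := h.le_bound
    have hC0 : 0 ≤ C := nonneg_of_mul_nonneg_left ((norm_nonneg _).trans (hC 0)) (by positivity)
    refine ⟨k + 1, 1 + 2 / ħ * (C * (1 + ħ / 2) ^ k), by positivity, fun y => ?_⟩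
    have hp : 1 ≤ 1 + ‖scaledTwist ħ φ y‖ := by simp
    have h1 : ‖y.1‖ ≤ (1 + ‖scaledTwist ħ φ y‖) ^ (k + 1) := by
      have := norm_fst_le (scaledTwist ħ φ y)
      calc ‖y.1‖ ≤ 1 + ‖scaledTwist ħ φ y‖ := by change ‖y.1‖ ≤ _ at this; linarith
        _ ≤ _ := le_self_pow₀ hp (by omega)
    have h2 : ‖y.2‖ ≤ 2 / ħ * (C * (1 + ħ / 2) ^ k) * (1 + ‖scaledTwist ħ φ y‖) ^ (k + 1) := by
      have e : y.2 = (2 / ħ) • P y := by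
        have h3 : 2 / ħ * (ħ / 2) = 1 := by field_simp
        simp [P, smul_smul, h3]
      rw [e, norm_smul, Real.norm_of_nonneg (by positivity), mul_assoc]
      refine mul_le_mul_of_nonneg_left ((hC _).trans ?_) (by positivity)
      calc C * (1 + ‖φ (P y)‖) ^ k ≤ C * ((1 + ħ / 2) * (1 + ‖scaledTwist ħ φ y‖)) ^ k := by
            gcongr; exact hφg y
        _ = C * (1 + ħ / 2) ^ k * (1 + ‖scaledTwist ħ φ y‖) ^ k := by rw [mul_pow]; ring
        _ ≤ _ := by gcongr; omega
    have h3 : 0 ≤ 2 / ħ * (C * (1 + ħ / 2) ^ k) * (1 + ‖scaledTwist ħ φ y‖) ^ (k + 1) := by positivity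
    have h4 : 0 ≤ (1 + ‖scaledTwist ħ φ y‖) ^ (k + 1) := by positivity
    rw [add_mul, one_mul]
    exact max_le (by linarith) (by linarith)
  refine ⟨contDiff_scaledTwist h.contDiff, fun n => ?_, let ⟨k, C, _, h⟩ := hle; ⟨k, C, h⟩⟩
  obtain ⟨k, C, hC⟩ := h.bound n
  have hC0 : 0 ≤ C := nonneg_of_mul_nonneg_left ((norm_nonneg _).trans (hC 0)) (by positivity)
  obtain ⟨kR, CR, hCR⟩ := R.hasTemperateGrowth.2 n
  have hCR0 : 0 ≤ CR := nonneg_of_mul_nonneg_left ((norm_nonneg _).trans (hCR 0)) (by positivity)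
  obtain ⟨j, B, hB0, hB⟩ := hle
  refine ⟨j * kR + k, CR * (1 + B) ^ kR + ‖Q‖ * (C * (1 + ħ / 2) ^ k * ‖P‖ ^ n), fun y => ?_⟩
  have hp : 1 ≤ 1 + ‖scaledTwist ħ φ y‖ := by simp
  have hcQ : ContDiff ℝ ∞ (Q ∘ φ) := Q.contDiff.comp h.contDiff
  -- The linear part is bounded in terms of y itself, and `hle` converts powers of ‖y‖ into powers
  -- of the twisted point.
  have h1 : ‖iteratedFDeriv ℝ n R y‖ ≤ CR * (1 + B) ^ kR * (1 + ‖scaledTwist ħ φ y‖) ^ (j * kR + k) := by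
    have hy : 1 + ‖y‖ ≤ (1 + B) * (1 + ‖scaledTwist ħ φ y‖) ^ j := by
      have := one_le_pow₀ hp (n := j)
      nlinarith [hB y]
    calc _ ≤ CR * (1 + ‖y‖) ^ kR := hCR y
      _ ≤ CR * ((1 + B) * (1 + ‖scaledTwist ħ φ y‖) ^ j) ^ kR := by gcongr
      _ = CR * (1 + B) ^ kR * (1 + ‖scaledTwist ħ φ y‖) ^ (j * kR) := by rw [mul_pow, pow_mul]; ring
      _ ≤ _ := by gcongr; omega
  have h2 : ‖iteratedFDeriv ℝ n ((Q ∘ φ) ∘ P) y‖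
      ≤ ‖Q‖ * (C * (1 + ħ / 2) ^ k * ‖P‖ ^ n) * (1 + ‖scaledTwist ħ φ y‖) ^ (j * kR + k) := by
    rw [P.iteratedFDeriv_comp_right hcQ y (mod_cast le_top)]
    refine (ContinuousMultilinearMap.norm_compContinuousLinearMap_le _ _).trans ?_
    rw [Finset.prod_const, Finset.card_univ, Fintype.card_fin]
    have h3 := Q.norm_iteratedFDeriv_comp_left (h.contDiff.contDiffAt (x := P y)) (n := n) (mod_cast le_top)
    calc _ ≤ ‖Q‖ * (C * ((1 + ħ / 2) * (1 + ‖scaledTwist ħ φ y‖)) ^ k) * ‖P‖ ^ n := by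
          gcongr
          refine h3.trans ?_
          gcongr
          exact (hC _).trans (by gcongr; exact hφg y)
      _ = ‖Q‖ * (C * (1 + ħ / 2) ^ k * ‖P‖ ^ n) * (1 + ‖scaledTwist ħ φ y‖) ^ k := by
          rw [mul_pow]; ring
      _ ≤ _ := by gcongr; omega
  have h3 : iteratedFDeriv ℝ n (scaledTwist ħ φ) y
      = iteratedFDeriv ℝ n R y + iteratedFDeriv ℝ n ((Q ∘ φ) ∘ P) y := by
    rw [hg]
    exact iteratedFDeriv_add_apply R.contDiff.contDiffAt
      ((hcQ.comp P.contDiff).of_le (mod_cast le_top)).contDiffAt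
  rw [h3, add_mul]
  exact (norm_add_le _ _).trans (add_le_add h1 h2)

/-- Composition with `φ_ħ`. -/
def twistCLM {ħ : ℝ} (hħ : 0 < ħ) {φ : 𝔞 → 𝔞} (h : IsTame φ) : 𝓢(𝔞 × 𝔞, ℂ) →L[ℂ] 𝓢(𝔞 × 𝔞, ℂ) :=
  SchwartzMap.compRight (isTame_scaledTwist hħ h).contDiff (isTame_scaledTwist hħ h).bound
    (isTame_scaledTwist hħ h).le_bound

lemma twistCLM_apply {ħ : ℝ} (hħ : 0 < ħ) {φ : 𝔞 → 𝔞} (h : IsTame φ) (f : 𝓢(𝔞 × 𝔞, ℂ)) (y : 𝔞 × 𝔞) :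
    twistCLM hħ h f y = f (scaledTwist ħ φ y) := rfl

end Twist

variable {𝔤 𝔞 𝔟 : Type*} [LieRing 𝔤] [LieAlgebra ℝ 𝔤]
  [NormedAddCommGroup 𝔞] [NormedSpace ℝ 𝔞] [FiniteDimensional ℝ 𝔞]
  [NormedAddCommGroup 𝔟] [NormedSpace ℝ 𝔟] [FiniteDimensional ℝ 𝔟]
  [MeasurableSpace 𝔞] [BorelSpace 𝔞] [MeasurableSpace 𝔟] [BorelSpace 𝔟]
  (X : ESET 𝔤 𝔞 𝔟)
  (μa : Measure 𝔞) [μa.IsAddHaarMeasure] (μL : Measure X.L) [μL.IsAddHaarMeasure]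

/-- The only consequence of the midpoint map that is used afterwards. -/
theorem exists_isTame (hX : X.HasMidpointMap) :
    ∃ Φ : Diffeos 𝔞, (∀ a, (Φ : Equiv.Perm 𝔞) a = X.twistingMap a) ∧ IsTame (Φ : Equiv.Perm 𝔞) := by
  obtain ⟨Φ, hΦ⟩ := (X.twistSystem hX).exists_diffeo
  have e : ⇑(Φ : Equiv.Perm 𝔞) = (X.twistSystem hX).φ := funext hΦ
  refine ⟨Φ, hΦ, Φ.2.1, fun n => ?_, ?_⟩
  · obtain ⟨m, hm⟩ := (X.twistSystem hX).exists_norm_iteratedFDeriv_φ_le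
    obtain ⟨K, hK⟩ := hm n
    exact ⟨m, K, by rw [e]; exact hK⟩
  · obtain ⟨K, m, -, hK⟩ := (X.twistSystem hX).exists_norm_le
    exact ⟨m, K, by rw [e]; exact fun a => (hK a).1⟩

/-- The partial Fourier transform on Schwartz functions. -/
def fourier : 𝓢(X.M, ℂ) ≃L[ℂ] 𝓢(𝔞 × 𝔞, ℂ) :=
  (SchwartzMap.exists_pairingFourier (V := 𝔞) X.pairing X.pairing_bijective μL μa).choose

/-- The constant in the inversion and Plancherel formulas of the partial Fourier transform. -/
def fourierConst : ℝ :=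
  (SchwartzMap.exists_pairingFourier (V := 𝔞) X.pairing X.pairing_bijective μL μa).choose_spec.choose

lemma fourierConst_pos : 0 < X.fourierConst μa μL :=
  (SchwartzMap.exists_pairingFourier (V := 𝔞) X.pairing X.pairing_bijective μL μa).choose_spec.choose_spec.1

lemma fourier_apply (u : 𝓢(X.M, ℂ)) (y : 𝔞 × 𝔞) : X.fourier μa μL u y
    = ∫ l, Complex.exp (-(X.pairing y.2 l : ℝ) * Complex.I) * u (y.1, l) ∂μL :=
  (SchwartzMap.exists_pairingFourier (V := 𝔞) X.pairing X.pairing_bijective μL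
    μa).choose_spec.choose_spec.2.1 u y

lemma fourier_symm_apply (w : 𝓢(𝔞 × 𝔞, ℂ)) (x : X.M) : (X.fourier μa μL).symm w x
    = X.fourierConst μa μL * ∫ α, Complex.exp ((X.pairing α x.2 : ℝ) * Complex.I) * w (x.1, α) ∂μa :=
  (SchwartzMap.exists_pairingFourier (V := 𝔞) X.pairing X.pairing_bijective μL
    μa).choose_spec.choose_spec.2.2.1 w x

lemma integral_fibre_conj_mul (u v : 𝓢(X.M, ℂ)) (a : 𝔞) :
    ∫ l, starRingEnd ℂ (u (a, l)) * v (a, l) ∂μL = X.fourierConst μa μL *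
      ∫ α, starRingEnd ℂ (X.fourier μa μL u (a, α)) * X.fourier μa μL v (a, α) ∂μa :=
  (SchwartzMap.exists_pairingFourier (V := 𝔞) X.pairing X.pairing_bijective μL
    μa).choose_spec.choose_spec.2.2.2 u v a

lemma fourier_eq_partialFourier (u : 𝓢(X.M, ℂ)) (y : 𝔞 × 𝔞) :
    X.fourier μa μL u y = X.partialFourier μL u y := by
  rw [fourier_apply, partialFourier]
  simp only [pairing_apply]

lemma integral_conj_mul (u v : 𝓢(X.M, ℂ)) :
    ∫ x, starRingEnd ℂ (u x) * v x ∂(μa.prod μL) = X.fourierConst μa μL *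
      ∫ y, starRingEnd ℂ (X.fourier μa μL u y) * X.fourier μa μL v y ∂(μa.prod μa) := by
  have h1 := integral_prod _ (SchwartzMap.integrable_mul (μa.prod μL) (SchwartzMap.conj u) v)
  have h2 := integral_prod _ (SchwartzMap.integrable_mul (μa.prod μa)
    (SchwartzMap.conj (X.fourier μa μL u)) (X.fourier μa μL v))
  simp only [SchwartzMap.conj_apply] at h1 h2
  rw [h1, h2, ← integral_const_mul]
  exact integral_congr_ae (Filter.Eventually.of_forall fun a => X.integral_fibre_conj_mul μa μL u v a)

lemma fourier_conj (u : 𝓢(X.M, ℂ)) (a α : 𝔞) :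
    X.fourier μa μL (SchwartzMap.conj u) (a, α) = starRingEnd ℂ (X.fourier μa μL u (a, -α)) := by
  rw [fourier_apply, fourier_apply, ← integral_conj]
  refine integral_congr_ae (Filter.Eventually.of_forall fun l => ?_)
  simp only [map_mul, ← Complex.exp_conj, map_neg, Complex.conj_ofReal, Complex.conj_I,
    SchwartzMap.conj_apply, LinearMap.neg_apply, Complex.ofReal_neg]
  ring_nf

/-- The transposed partial Fourier transform on Schwartz functions. -/
def fourierT : 𝓢(𝔞 × 𝔞, ℂ) ≃L[ℂ] 𝓢(X.M, ℂ) :=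
  -- The transpose has the same phase as F, so it is the inverse of F after α ↦ -α, without the
  -- inversion constant; in this form it is visibly invertible.
  (SchwartzMap.compCLE ((ContinuousLinearEquiv.refl ℝ 𝔞).prodCongr (ContinuousLinearEquiv.neg ℝ))).trans
    ((ContinuousLinearEquiv.smulLeft (Units.mk0 ((X.fourierConst μa μL : ℂ)⁻¹)
      (inv_ne_zero (Complex.ofReal_ne_zero.2 (X.fourierConst_pos μa μL).ne')))).trans
    (X.fourier μa μL).symm)

lemma fourier_fourierT (w : 𝓢(𝔞 × 𝔞, ℂ)) (y : 𝔞 × 𝔞) :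
    X.fourier μa μL (X.fourierT μa μL w) y = (X.fourierConst μa μL : ℂ)⁻¹ * w (y.1, -y.2) := by
  change X.fourier μa μL ((X.fourier μa μL).symm _) y = _
  rw [ContinuousLinearEquiv.apply_symm_apply]; rfl

lemma fourierT_apply (w : 𝓢(𝔞 × 𝔞, ℂ)) (x : X.M) :
    X.fourierT μa μL w x = X.partialFourierTranspose μa w x := by
  have hc : (X.fourierConst μa μL : ℂ) ≠ 0 := Complex.ofReal_ne_zero.2 (X.fourierConst_pos μa μL).ne'
  have h := X.fourier_symm_apply μa μL (X.fourier μa μL (X.fourierT μa μL w)) x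
  rw [ContinuousLinearEquiv.symm_apply_apply] at h
  rw [h, partialFourierTranspose, ← integral_neg_eq_self, ← integral_const_mul]
  refine integral_congr_ae (Filter.Eventually.of_forall fun α => ?_)
  simp only [fourier_fourierT, ← pairing_apply, neg_neg, map_neg, LinearMap.neg_apply, Complex.ofReal_neg]
  field_simp

/-- Plancherel with the conjugate of u. It shows that F on functions agrees with the dual definition
of F on distributions. -/
lemma integral_fourier_mul (u : 𝓢(X.M, ℂ)) (w : 𝓢(𝔞 × 𝔞, ℂ)) :
    ∫ y, X.fourier μa μL u y * w y ∂(μa.prod μa)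
      = ∫ x, u x * X.fourierT μa μL w x ∂(μa.prod μL) := by
  have hc : (X.fourierConst μa μL : ℂ) ≠ 0 := Complex.ofReal_ne_zero.2 (X.fourierConst_pos μa μL).ne'
  rw [integral_prod _ (SchwartzMap.integrable_mul (μa.prod μL) u _),
    integral_prod _ (SchwartzMap.integrable_mul (μa.prod μa) (X.fourier μa μL u) w)]
  refine integral_congr_ae (Filter.Eventually.of_forall fun a => ?_)
  have h := X.integral_fibre_conj_mul μa μL (SchwartzMap.conj u) (X.fourierT μa μL w) a
  simp only [SchwartzMap.conj_apply, Complex.conj_conj, fourier_conj, fourier_fourierT] at h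
  dsimp only
  rw [h, ← integral_neg_eq_self, ← integral_const_mul]
  refine integral_congr_ae (Filter.Eventually.of_forall fun α => ?_)
  dsimp only
  field_simp

end ESET

/-! ### The transported norm -/

namespace TransportSpace

variable {V : Type*} [NormedAddCommGroup V] [NormedSpace ℝ V] [FiniteDimensional ℝ V]
  [MeasurableSpace V] [BorelSpace V] (μ : Measure V) [μ.IsAddHaarMeasure]
  (τ : 𝓢(V, ℂ) →ₗ[ℂ] 𝓢'(V, ℂ)) (hτ : Function.Injective τ)

lemma inner_eq_inner_toLp (a b : TransportSpace μ τ hτ) :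
    inner ℂ a b = inner ℂ ((T μ τ hτ a).toLp 2 μ) ((T μ τ hτ b).toLp 2 μ) :=
  integral_eq_inner μ τ hτ a b

lemma norm_eq (a : TransportSpace μ τ hτ) : ‖a‖ = ‖(T μ τ hτ a).toLp 2 μ‖ := by
  rw [@norm_eq_sqrt_re_inner ℂ, @norm_eq_sqrt_re_inner ℂ, inner_eq_inner_toLp]

/-- The norm of 𝓔 is the L² norm of T, which is weaker than the Schwartz topology; so subspaces
dense in 𝓢 give subspaces dense in 𝓔. -/
lemma continuous_T_symm : Continuous (T μ τ hτ).symm := by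
  have h : Isometry ((SchwartzMap.toLpCLM ℂ ℂ 2 μ).toLinearMap ∘ₗ (T μ τ hτ).toLinearMap) :=
    AddMonoidHomClass.isometry_of_norm _ fun a => (norm_eq μ τ hτ a).symm
  rw [h.isEmbedding.continuous_iff]
  refine (SchwartzMap.toLpCLM ℂ ℂ 2 μ).continuous.congr fun f => ?_
  exact congrArg (SchwartzMap.toLpCLM ℂ ℂ 2 μ) ((T μ τ hτ).apply_symm_apply f).symm

lemma T_incl (h : ∀ u : 𝓢(V, ℂ), SchwartzMap.toTemperedDistributionCLM V ℂ μ u ∈ LinearMap.range τ)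
    {u f : 𝓢(V, ℂ)} (hf : τ f = SchwartzMap.toTemperedDistributionCLM V ℂ μ u) :
    T μ τ hτ (incl μ τ hτ h u) = f := by
  rw [← LinearEquiv.eq_symm_apply]
  exact Subtype.ext hf.symm

end TransportSpace

/-! ### The map τ, and its inverse on Schwartz functions -/

namespace ESET

variable {𝔤 𝔞 𝔟 : Type*} [LieRing 𝔤] [LieAlgebra ℝ 𝔤]
  [NormedAddCommGroup 𝔞] [NormedSpace ℝ 𝔞] [FiniteDimensional ℝ 𝔞]
  [NormedAddCommGroup 𝔟] [NormedSpace ℝ 𝔟] [FiniteDimensional ℝ 𝔟]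
  [MeasurableSpace 𝔞] [BorelSpace 𝔞] [MeasurableSpace 𝔟] [BorelSpace 𝔟]
  (X : ESET 𝔤 𝔞 𝔟)
  (μa : Measure 𝔞) [μa.IsAddHaarMeasure] (μL : Measure X.L) [μL.IsAddHaarMeasure]
  (Φ : Diffeos 𝔞) (hΦ : IsTame (Φ : Equiv.Perm 𝔞)) {ħ : ℝ} (hħ : 0 < ħ)

/-- The function `(φ_ħ⁻¹)^⋆ F u`. -/
def twistedFourier (ħ : ℝ) (u : 𝓢(X.M, ℂ)) (y : 𝔞 × 𝔞) : ℂ :=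
  X.fourier μa μL u (scaledTwist ħ (Φ : Equiv.Perm 𝔞).symm y)

lemma continuous_twistedFourier (ħ : ℝ) (u : 𝓢(X.M, ℂ)) :
    Continuous (X.twistedFourier μa μL Φ ħ u) :=
  (X.fourier μa μL u).continuous.comp (contDiff_scaledTwist Φ.2.2).continuous

lemma exists_twistedFourier_le (ħ : ℝ) (u : 𝓢(X.M, ℂ)) :
    ∃ C, ∀ y, ‖X.twistedFourier μa μL Φ ħ u y‖ ≤ C :=
  ⟨_, fun _ => SchwartzMap.norm_le_seminorm ℂ (X.fourier μa μL u) _⟩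

/-- The twisted transform of u is bounded and continuous, hence a tempered distribution on 𝔞 × 𝔞;
precomposition with the inverse of Fᵗ is F⁻¹ by duality. -/
lemma exists_quantization (ħ : ℝ) (u : 𝓢(X.M, ℂ)) : ∃ D : 𝓢'(X.M, ℂ), ∀ v : 𝓢(X.M, ℂ),
    D v = ∫ y, X.twistedFourier μa μL Φ ħ u y * (X.fourierT μa μL).symm v y ∂(μa.prod μa) := by
  obtain ⟨D, hD⟩ := exists_temperedDistribution_of_bounded (μa.prod μa)
    (X.continuous_twistedFourier μa μL Φ ħ u) (X.exists_twistedFourier_le μa μL Φ ħ u)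
  exact ⟨PointwiseConvergenceCLM.precomp ℂ
    ((X.fourierT μa μL).symm : 𝓢(X.M, ℂ) →L[ℂ] 𝓢(𝔞 × 𝔞, ℂ)) D, fun v => hD _⟩

lemma integrable_twistedFourier_mul (ħ : ℝ) (u : 𝓢(X.M, ℂ)) (w : 𝓢(𝔞 × 𝔞, ℂ)) :
    Integrable (fun y => X.twistedFourier μa μL Φ ħ u y * w y) (μa.prod μa) := by
  obtain ⟨C, hC⟩ := X.exists_twistedFourier_le μa μL Φ ħ u
  exact w.integrable.bdd_mul (X.continuous_twistedFourier μa μL Φ ħ u).aestronglyMeasurable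
    (Filter.Eventually.of_forall hC)

/-- The map `τ = F⁻¹ ∘ (φ_ħ⁻¹)^⋆ ∘ F`. -/
def quantization (ħ : ℝ) : 𝓢(X.M, ℂ) →ₗ[ℂ] 𝓢'(X.M, ℂ) where
  toFun u := (X.exists_quantization μa μL Φ ħ u).choose
  map_add' u u' := by
    ext v
    rw [(X.exists_quantization μa μL Φ ħ (u + u')).choose_spec v, add_apply,
      (X.exists_quantization μa μL Φ ħ u).choose_spec v,
      (X.exists_quantization μa μL Φ ħ u').choose_spec v,
      ← integral_add (X.integrable_twistedFourier_mul μa μL Φ ħ u _)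
        (X.integrable_twistedFourier_mul μa μL Φ ħ u' _)]
    simp only [twistedFourier, map_add, add_apply, add_mul]
  map_smul' c u := by
    ext v
    rw [(X.exists_quantization μa μL Φ ħ (c • u)).choose_spec v, RingHom.id_apply, smul_apply,
      (X.exists_quantization μa μL Φ ħ u).choose_spec v, ← integral_smul]
    simp only [twistedFourier, map_smul, smul_apply, smul_eq_mul, mul_assoc]

lemma quantization_apply (ħ : ℝ) (u v : 𝓢(X.M, ℂ)) : X.quantization μa μL Φ ħ u v
    = ∫ y, X.twistedFourier μa μL Φ ħ u y * (X.fourierT μa μL).symm v y ∂(μa.prod μa) :=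
  (X.exists_quantization μa μL Φ ħ u).choose_spec v

lemma quantization_fourierT (ħ : ℝ) (u : 𝓢(X.M, ℂ)) (w : 𝓢(𝔞 × 𝔞, ℂ)) :
    X.quantization μa μL Φ ħ u (X.fourierT μa μL w)
    = ∫ y, X.twistedFourier μa μL Φ ħ u y * w y ∂(μa.prod μa) := by
  rw [quantization_apply, ContinuousLinearEquiv.symm_apply_apply]

/-- Every w in 𝓢(𝔞 × 𝔞) is available as a test function, so the continuous function (φ_ħ⁻¹)^⋆Fu
vanishes, and Fu with it because φ_ħ is inverted by φ_ħ⁻¹. -/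
theorem quantization_injective {ħ : ℝ} (hħ : 0 < ħ) : Function.Injective (X.quantization μa μL Φ ħ) := by
  refine (injective_iff_map_eq_zero _).2 fun u hu => ?_
  have h0 : X.twistedFourier μa μL Φ ħ u = 0 :=
    eq_zero_of_forall_integral_mul_eq_zero (μa.prod μa) (X.continuous_twistedFourier μa μL Φ ħ u)
      fun w => by rw [← quantization_fourierT, hu]; rfl
  refine (X.fourier μa μL).injective ?_
  rw [map_zero]
  ext y
  have h1 := congrFun h0 (scaledTwist ħ (Φ : Equiv.Perm 𝔞) y)
  rw [twistedFourier, scaledTwist_scaledTwist hħ (Equiv.symm_apply_apply _)] at h1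
  exact h1

theorem hasPartialFourier_quantization (ħ : ℝ) (u : 𝓢(X.M, ℂ)) :
    X.HasPartialFourier μa (X.quantization μa μL Φ ħ u) fun y =>
      X.partialFourier μL u (scaledTwist ħ (Φ : Equiv.Perm 𝔞).symm y) := by
  intro w v hv
  have h : v = X.fourierT μa μL w := by
    ext x; rw [hv, fourierT_apply]
  rw [h, quantization_fourierT]
  simp only [twistedFourier, fourier_eq_partialFourier]

/-- The Schwartz function `T u`. -/
def dequantize : 𝓢(X.M, ℂ) →L[ℂ] 𝓢(X.M, ℂ) :=
  ((X.fourier μa μL).symm : _ →L[ℂ] 𝓢(X.M, ℂ)).comp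
    ((twistCLM hħ hΦ).comp (X.fourier μa μL : 𝓢(X.M, ℂ) →L[ℂ] 𝓢(𝔞 × 𝔞, ℂ)))

lemma fourier_dequantize (u : 𝓢(X.M, ℂ)) :
    X.fourier μa μL (X.dequantize μa μL Φ hΦ hħ u) = twistCLM hħ hΦ (X.fourier μa μL u) :=
  (X.fourier μa μL).apply_symm_apply _

/-- The inclusion 𝓢 ⊆ 𝓔. Tameness enters through `dequantize`: Fu∘φ_ħ is again Schwartz, and τ
undoes the twist. -/
theorem quantization_dequantize (u : 𝓢(X.M, ℂ)) :
    X.quantization μa μL Φ ħ (X.dequantize μa μL Φ hΦ hħ u)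
      = SchwartzMap.toTemperedDistributionCLM X.M ℂ (μa.prod μL) u := by
  ext v
  obtain ⟨w, rfl⟩ := (X.fourierT μa μL).surjective v
  rw [quantization_fourierT]
  refine Eq.trans ?_
    (SchwartzMap.toTemperedDistributionCLM_apply_apply (μa.prod μL) u (X.fourierT μa μL w)).symm
  simp only [smul_eq_mul, mul_comm (X.fourierT μa μL w _)]
  rw [← integral_fourier_mul]
  simp only [twistedFourier, fourier_dequantize, twistCLM_apply]
  simp only [scaledTwist_scaledTwist hħ (Equiv.apply_symm_apply _)]

theorem toTemperedDistribution_mem_range (hΦ : IsTame (Φ : Equiv.Perm 𝔞)) {ħ : ℝ} (hħ : 0 < ħ)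
    (u : 𝓢(X.M, ℂ)) :
    SchwartzMap.toTemperedDistributionCLM X.M ℂ (μa.prod μL) u
      ∈ LinearMap.range (X.quantization μa μL Φ ħ) :=
  ⟨_, X.quantization_dequantize μa μL Φ hΦ hħ u⟩

/-- A compactly supported w is the twist of w∘φ_ħ⁻¹, which is smooth with compact support because
φ_ħ is a diffeomorphism, whatever the growth of the derivatives of φ⁻¹. So the twist has dense
range, and F is an automorphism of Schwartz spaces. -/
theorem denseRange_dequantize : DenseRange (X.dequantize μa μL Φ hΦ hħ) := by
  have h1 : DenseRange (twistCLM hħ hΦ) := by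
    refine dense_testFunctions.mono ?_
    rintro w (hw : HasCompactSupport w)
    have hs : ∀ y, scaledTwist ħ (Φ : Equiv.Perm 𝔞).symm (scaledTwist ħ (Φ : Equiv.Perm 𝔞) y) = y :=
      scaledTwist_scaledTwist hħ (Equiv.symm_apply_apply _)
    have hs' : ∀ y, scaledTwist ħ (Φ : Equiv.Perm 𝔞) (scaledTwist ħ (Φ : Equiv.Perm 𝔞).symm y) = y :=
      scaledTwist_scaledTwist hħ (Equiv.apply_symm_apply _)
    have hd : ContDiff ℝ ∞ (scaledTwist ħ (Φ : Equiv.Perm 𝔞).symm) := contDiff_scaledTwist Φ.2.2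
    have hc : HasCompactSupport (w ∘ scaledTwist ħ (Φ : Equiv.Perm 𝔞).symm) :=
      hw.comp_homeomorph (⟨⟨scaledTwist ħ (Φ : Equiv.Perm 𝔞).symm, scaledTwist ħ (Φ : Equiv.Perm 𝔞),
        hs', hs⟩, hd.continuous, (contDiff_scaledTwist Φ.2.1).continuous⟩ : 𝔞 × 𝔞 ≃ₜ 𝔞 × 𝔞)
    refine ⟨hc.toSchwartzMap ((w.smooth ⊤).comp hd), ?_⟩
    ext y
    exact congrArg w (hs y)
  exact (X.fourier μa μL).symm.surjective.denseRange.comp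
    (h1.comp (X.fourier μa μL).surjective.denseRange (twistCLM hħ hΦ).continuous)
    (X.fourier μa μL).symm.continuous

end ESET

/-! ### The Weyl product as composition of kernels -/

lemma SchwartzMap.integrable_comp_affine {V W : Type*} [NormedAddCommGroup V] [NormedSpace ℝ V]
    [FiniteDimensional ℝ V] [MeasurableSpace V] [BorelSpace V] [NormedAddCommGroup W] [NormedSpace ℝ W]
    (ν : Measure V) [ν.IsAddHaarMeasure] (f : 𝓢(W, ℂ)) (e : V ≃L[ℝ] W) (c : W) :
    Integrable (fun x => f (e x + c)) ν := by
  have h : Integrable (compCLE e (compSubConstCLM ℂ (-c) f)) ν := SchwartzMap.integrable _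
  refine h.congr (Filter.Eventually.of_forall fun x => ?_)
  simp

namespace ESET

variable {𝔤 𝔞 𝔟 : Type*} [LieRing 𝔤] [LieAlgebra ℝ 𝔤]
  [NormedAddCommGroup 𝔞] [NormedSpace ℝ 𝔞] [FiniteDimensional ℝ 𝔞]
  [NormedAddCommGroup 𝔟] [NormedSpace ℝ 𝔟] [FiniteDimensional ℝ 𝔟]
  (X : ESET 𝔤 𝔞 𝔟)

lemma exists_integral_comp {V : Type*} [NormedAddCommGroup V] [NormedSpace ℝ V]
    [FiniteDimensional ℝ V] [MeasurableSpace V] [BorelSpace V] (μ : Measure V) [μ.IsAddHaarMeasure]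
    (e : V ≃L[ℝ] V) : ∃ c : ℝ, 0 < c ∧ ∀ f : V → ℂ, ∫ y, f y ∂μ = c * ∫ y, f (e y) ∂μ := by
  obtain ⟨c, hc, h⟩ := SchwartzMap.exists_integral_eq_smul μ μ e.symm
  exact ⟨c, hc, fun f => h f⟩

lemma Ω_eq (x y : X.M) : X.Ω x y = X.pairing x.1 y.2 - X.pairing y.1 x.2 := by
  have h1 : ⁅X.inA x.1, X.inA y.1⁆ = 0 := X.a_abelian _ _
  have h2 : ⁅X.inB (x.2 : 𝔟), X.inB (y.2 : 𝔟)⁆ = 0 := X.b_abelian _ _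
  rw [Ω, add_lie, lie_add, lie_add, h1, h2, zero_add, add_zero, map_add, lie_inB_inA]
  rfl

lemma continuous_pairing {V : Type*} [TopologicalSpace V] {f : V → 𝔞} {g : V → X.L}
    (hf : Continuous f) (hg : Continuous g) : Continuous fun x => X.pairing (f x) (g x) := by
  let b : 𝔞 →L[ℝ] X.L →L[ℝ] ℝ :=
    LinearMap.toContinuousLinearMap (LinearMap.toContinuousLinearMap.toLinearMap ∘ₗ X.pairing)
  exact (b.continuous.comp hf).clm_apply hg

lemma norm_exp_neg_mul_I (r : ℝ) : ‖Complex.exp (-(r : ℂ) * Complex.I)‖ = 1 := by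
  rw [← Complex.ofReal_neg, Complex.norm_exp_ofReal_mul_I]

variable [MeasurableSpace 𝔞] [BorelSpace 𝔞] [MeasurableSpace 𝔟] [BorelSpace 𝔟]
  (μa : Measure 𝔞) [μa.IsAddHaarMeasure] (μL : Measure X.L) [μL.IsAddHaarMeasure]
  {ħ : ℝ} (hħ : 0 < ħ)

/-- The coordinates `(s, t) ↦ ((s + t) / 2, (s - t) / ħ)`. -/
def midCoord : (𝔞 × 𝔞) ≃L[ℝ] (𝔞 × 𝔞) :=
  LinearEquiv.toContinuousLinearEquiv
    { toFun := fun x => ((1 / 2 : ℝ) • (x.1 + x.2), ħ⁻¹ • (x.1 - x.2))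
      invFun := fun y => (y.1 + (ħ / 2) • y.2, y.1 - (ħ / 2) • y.2)
      map_add' := fun x y => by ext <;> simp <;> module
      map_smul' := fun c x => by ext <;> simp <;> module
      left_inv := fun x => by
        have h : ħ / 2 * ħ⁻¹ = 1 / 2 := by field_simp
        ext <;> simp only [smul_smul, h] <;> module
      right_inv := fun x => by
        have h : ħ⁻¹ * ħ = 1 := by field_simp
        ext
        · simp only; module
        · simp only
          rw [show x.1 + (ħ / 2) • x.2 - (x.1 - (ħ / 2) • x.2) = ħ • x.2 by module, smul_smul, h,
            one_smul] }

lemma midCoord_symm_apply (q p : 𝔞) :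
    (midCoord hħ).symm (q, p) = (q + (ħ / 2) • p, q - (ħ / 2) • p) := rfl

/-- The kernel of the operator with Weyl symbol `u`. -/
def kernel : 𝓢(X.M, ℂ) ≃L[ℂ] 𝓢(𝔞 × 𝔞, ℂ) :=
  (X.fourier μa μL).trans (SchwartzMap.compCLE (midCoord hħ))

lemma kernel_eq (u : 𝓢(X.M, ℂ)) (x : 𝔞 × 𝔞) :
    X.kernel μa μL hħ u x = X.fourier μa μL u (midCoord hħ x) := rfl

lemma kernel_apply (u : 𝓢(X.M, ℂ)) (s t : 𝔞) :
    X.kernel μa μL hħ u (s, t) = X.fourier μa μL u ((1 / 2 : ℝ) • (s + t), ħ⁻¹ • (s - t)) := rfl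

lemma kernel_symm_apply (K : 𝓢(𝔞 × 𝔞, ℂ)) (x : X.M) : (X.kernel μa μL hħ).symm K x
    = X.fourierConst μa μL * ∫ p, Complex.exp ((X.pairing p x.2 : ℝ) * Complex.I)
      * K (x.1 + (ħ / 2) • p, x.1 - (ħ / 2) • p) ∂μa := by
  have h : (X.kernel μa μL hħ).symm K
      = (X.fourier μa μL).symm ((SchwartzMap.compCLE (midCoord hħ)).symm K) := rfl
  rw [h, fourier_symm_apply]
  simp only [SchwartzMap.compCLE_symm_apply, midCoord_symm_apply]

lemma exists_integral_midCoord : ∃ c : ℝ, 0 < c ∧ ∀ f : 𝔞 × 𝔞 → ℂ,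
    ∫ y, f y ∂(μa.prod μa) = c * ∫ y, f (midCoord hħ y) ∂(μa.prod μa) :=
  exists_integral_comp (μa.prod μa) (midCoord hħ)

lemma exists_kernelConst : ∃ c : ℝ, 0 < c ∧ ∀ u v : 𝓢(X.M, ℂ),
    ∫ x, starRingEnd ℂ (u x) * v x ∂(μa.prod μL) = c *
      ∫ y, starRingEnd ℂ (X.kernel μa μL hħ u y) * X.kernel μa μL hħ v y ∂(μa.prod μa) := by
  obtain ⟨c, hc, h⟩ := exists_integral_midCoord μa hħ
  refine ⟨X.fourierConst μa μL * c, mul_pos (X.fourierConst_pos μa μL) hc, fun u v => ?_⟩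
  rw [integral_conj_mul, h, ← mul_assoc, ← Complex.ofReal_mul]
  simp only [kernel_eq]

/-- The ratio between the `L²` inner products of symbols and kernels. -/
def kernelConst : ℝ := (X.exists_kernelConst μa μL hħ).choose

lemma kernelConst_pos : 0 < X.kernelConst μa μL hħ := (X.exists_kernelConst μa μL hħ).choose_spec.1

lemma inner_toLp_eq (u v : 𝓢(X.M, ℂ)) :
    inner ℂ (u.toLp 2 (μa.prod μL)) (v.toLp 2 (μa.prod μL)) = X.kernelConst μa μL hħ *
      inner ℂ ((X.kernel μa μL hħ u).toLp 2 (μa.prod μa)) ((X.kernel μa μL hħ v).toLp 2 (μa.prod μa)) := by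
  have h1 := SchwartzMap.inner_toL2_toL2_eq u v (μa.prod μL)
  have h2 := SchwartzMap.inner_toL2_toL2_eq (X.kernel μa μL hħ u) (X.kernel μa μL hħ v) (μa.prod μa)
  simp only [RCLike.inner_apply'] at h1 h2
  rw [h1, h2]
  exact (X.exists_kernelConst μa μL hħ).choose_spec.2 u v

lemma norm_toLp_eq (u : 𝓢(X.M, ℂ)) : ‖u.toLp 2 (μa.prod μL)‖
    = Real.sqrt (X.kernelConst μa μL hħ) * ‖(X.kernel μa μL hħ u).toLp 2 (μa.prod μa)‖ := by
  rw [@norm_eq_sqrt_re_inner ℂ, @norm_eq_sqrt_re_inner ℂ, X.inner_toLp_eq μa μL hħ,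
    ← Real.sqrt_mul (X.kernelConst_pos μa μL hħ).le]
  congr 1
  exact Complex.re_ofReal_mul _ _

/-- The affine coordinates which turn the Weyl product into the composition of kernels. -/
def weylCoord : (𝔞 × 𝔞) ≃L[ℝ] (𝔞 × 𝔞) :=
  LinearEquiv.toContinuousLinearEquiv
    { toFun := fun x => ((2 / ħ) • (x.1 - x.2), x.1 + x.2)
      invFun := fun y => ((1 / 2 : ℝ) • ((ħ / 2) • y.1 + y.2), (1 / 2 : ℝ) • (y.2 - (ħ / 2) • y.1))
      map_add' := fun x y => by ext <;> simp <;> module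
      map_smul' := fun c x => by ext <;> simp <;> module
      left_inv := fun x => by
        have h : ħ / 2 * (2 / ħ) = 1 := by field_simp
        ext <;> simp only [smul_smul, h] <;> module
      right_inv := fun x => by
        have h : 2 / ħ * (ħ / 2) = 1 := by field_simp
        ext
        · simp only
          rw [show (1 / 2 : ℝ) • ((ħ / 2) • x.1 + x.2) - (1 / 2 : ℝ) • (x.2 - (ħ / 2) • x.1)
            = (ħ / 2) • x.1 by module, smul_smul, h, one_smul]
        · simp only; module }

lemma weylCoord_symm_apply (p m : 𝔞) : (weylCoord hħ).symm (p, m)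
    = ((1 / 2 : ℝ) • ((ħ / 2) • p + m), (1 / 2 : ℝ) • (m - (ħ / 2) • p)) := rfl

lemma exists_integral_weylCoord : ∃ c : ℝ, 0 < c ∧ ∀ f : 𝔞 × 𝔞 → ℂ,
    ∫ y, f y ∂(μa.prod μa) = c * ∫ y, f ((weylCoord hħ).symm y) ∂(μa.prod μa) :=
  exists_integral_comp (μa.prod μa) (weylCoord hħ).symm

/-- The reduction of the Weyl product to an integral over `𝔞 × 𝔞`. -/
lemma integral_weyl_eq (ħ : ℝ) (u v : 𝓢(X.M, ℂ)) (q : 𝔞) (l : X.L) :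
    ∫ p : X.M × X.M, u p.1 * v p.2 * Complex.exp
      (-(2 / ħ * (X.Ω (q, l) p.1 + X.Ω p.1 p.2 + X.Ω p.2 (q, l)) : ℝ) * Complex.I)
        ∂((μa.prod μL).prod (μa.prod μL))
    = ∫ r, ∫ r', X.fourier μa μL u (r, (2 / ħ) • (q - r')) * X.fourier μa μL v (r', (2 / ħ) • (r - q))
        * Complex.exp (-(X.pairing ((2 / ħ) • (r' - r)) l : ℝ) * Complex.I) ∂μa ∂μa := by
  -- The phase is linear in each 𝓛-component, so the integrals over k and k' are partial Fourier
  -- transforms of u and v.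
  have hphase (r : 𝔞) (k : X.L) (r' : 𝔞) (k' : X.L) :
      Complex.exp (-(2 / ħ * (X.Ω (q, l) (r, k) + X.Ω (r, k) (r', k') + X.Ω (r', k') (q, l)) : ℝ)
        * Complex.I) = Complex.exp (-(X.pairing ((2 / ħ) • (q - r')) k : ℝ) * Complex.I)
        * Complex.exp (-(X.pairing ((2 / ħ) • (r - q)) k' : ℝ) * Complex.I)
        * Complex.exp (-(X.pairing ((2 / ħ) • (r' - r)) l : ℝ) * Complex.I) := by
    rw [← Complex.exp_add, ← Complex.exp_add]
    congr 1
    simp only [Ω_eq, map_smul, map_sub, LinearMap.smul_apply, LinearMap.sub_apply, smul_eq_mul]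
    push_cast
    ring
  have hΩ : Continuous fun p : X.M × X.M => Complex.exp
      (-(2 / ħ * (X.Ω (q, l) p.1 + X.Ω p.1 p.2 + X.Ω p.2 (q, l)) : ℝ) * Complex.I) := by
    have h (f g : X.M × X.M → X.M) (hf : Continuous f) (hg : Continuous g) :
        Continuous fun p => X.Ω (f p) (g p) := by
      simp only [Ω_eq]
      exact (X.continuous_pairing hf.fst hg.snd).sub (X.continuous_pairing hg.fst hf.snd)
    have h1 := h (fun _ => (q, l)) (fun p => p.1) (by fun_prop) (by fun_prop)
    have h2 := h (fun p => p.1) (fun p => p.2) (by fun_prop) (by fun_prop)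
    have h3 := h (fun p => p.2) (fun _ => (q, l)) (by fun_prop) (by fun_prop)
    fun_prop
  have hint : Integrable (fun p : X.M × X.M => u p.1 * v p.2 * Complex.exp
      (-(2 / ħ * (X.Ω (q, l) p.1 + X.Ω p.1 p.2 + X.Ω p.2 (q, l)) : ℝ) * Complex.I))
        ((μa.prod μL).prod (μa.prod μL)) :=
    (Integrable.mul_prod (u.integrable (μ := μa.prod μL)) (v.integrable (μ := μa.prod μL))).mul_bdd
      (c := 1) hΩ.aestronglyMeasurable (Filter.Eventually.of_forall fun p => (norm_exp_neg_mul_I _).le)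
  have hinner (r : 𝔞) (k : X.L) : ∫ z : X.M, u (r, k) * v z * Complex.exp
      (-(2 / ħ * (X.Ω (q, l) (r, k) + X.Ω (r, k) z + X.Ω z (q, l)) : ℝ) * Complex.I) ∂(μa.prod μL)
      = ∫ r', (Complex.exp (-(X.pairing ((2 / ħ) • (q - r')) k : ℝ) * Complex.I) * u (r, k)) *
        (X.fourier μa μL v (r', (2 / ħ) • (r - q))
          * Complex.exp (-(X.pairing ((2 / ħ) • (r' - r)) l : ℝ) * Complex.I)) ∂μa := by
    have hi : Integrable (fun z : X.M => u (r, k) * v z * Complex.exp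
        (-(2 / ħ * (X.Ω (q, l) (r, k) + X.Ω (r, k) z + X.Ω z (q, l)) : ℝ) * Complex.I))
        (μa.prod μL) :=
      ((v.integrable (μ := μa.prod μL)).const_mul _).mul_bdd (c := 1)
        (hΩ.comp (g := fun p : X.M × X.M => _) (f := fun z : X.M => (((r, k), z) : X.M × X.M))
          (by fun_prop)).aestronglyMeasurable
        (Filter.Eventually.of_forall fun p => (norm_exp_neg_mul_I _).le)
    rw [integral_prod _ hi]
    congr 1
    ext r'
    rw [fourier_apply, ← integral_mul_const, ← integral_const_mul]
    congr 1
    ext k'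
    rw [hphase]
    ring
  rw [integral_prod _ hint, integral_prod _ hint.integral_prod_left]
  congr 1
  ext r
  simp only [hinner]
  rw [integral_integral_swap]
  · congr 1
    ext r'
    rw [integral_mul_const, X.fourier_apply μa μL u (r, _), mul_assoc]
  · have h1 : Integrable (fun k => u (r, k)) μL := (SchwartzMap.fibre r u).integrable
    have h2 : Integrable (fun r' => X.fourier μa μL v (r', (2 / ħ) • (r - q))) μa :=
      SchwartzMap.integrable_snd_kernel μa (SchwartzMap.swap (X.fourier μa μL v)) _
    have h3 : Continuous fun p : X.L × 𝔞 =>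
        Complex.exp (-(X.pairing ((2 / ħ) • (q - p.2)) p.1 : ℝ) * Complex.I)
        * Complex.exp (-(X.pairing ((2 / ħ) • (p.2 - r)) l : ℝ) * Complex.I) := by
      have h4 := X.continuous_pairing (f := fun p : X.L × 𝔞 => (2 / ħ) • (q - p.2))
        (g := fun p => p.1) (by fun_prop) (by fun_prop)
      have h5 := X.continuous_pairing (f := fun p : X.L × 𝔞 => (2 / ħ) • (p.2 - r))
        (g := fun p => l) (by fun_prop) (by fun_prop)
      fun_prop
    refine ((h1.mul_prod h2).mul_bdd (c := 1) h3.aestronglyMeasurable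
      (Filter.Eventually.of_forall fun p => ?_)).congr (Filter.Eventually.of_forall fun p => ?_)
    · rw [norm_mul, norm_exp_neg_mul_I, norm_exp_neg_mul_I, one_mul]
    · simp only [Function.uncurry]
      ring

lemma integrable_kernel_mul_exp {ħ : ℝ} (hħ : 0 < ħ) (K₁ K₂ : 𝓢(𝔞 × 𝔞, ℂ)) (q : 𝔞) (l : X.L) :
    Integrable (fun y : 𝔞 × 𝔞 => Complex.exp ((X.pairing y.1 l : ℝ) * Complex.I) *
      (K₁ (q + (ħ / 2) • y.1, y.2 + q) * K₂ (y.2 + q, q - (ħ / 2) • y.1))) (μa.prod μa) := by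
  obtain ⟨C, hC⟩ := SchwartzMap.exists_norm_le K₂
  let e : (𝔞 × 𝔞) ≃L[ℝ] (𝔞 × 𝔞) := (ContinuousLinearEquiv.smulLeft (Units.mk0 (ħ / 2)
    (by positivity))).prodCongr (ContinuousLinearEquiv.refl ℝ 𝔞)
  have h1 : Integrable (fun r : 𝔞 × 𝔞 => K₁ (q + (ħ / 2) • r.1, r.2 + q)) (μa.prod μa) := by
    refine (SchwartzMap.integrable_comp_affine (μa.prod μa) K₁ e (q, q)).congr
      (Filter.Eventually.of_forall fun r => ?_)
    change K₁ ((ħ / 2) • r.1 + q, r.2 + q) = _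
    rw [add_comm]
  have h2 : Continuous fun r : 𝔞 × 𝔞 => K₂ (r.2 + q, q - (ħ / 2) • r.1) :=
    K₂.continuous.comp (by fun_prop)
  have h3 : Integrable (fun r : 𝔞 × 𝔞 => K₁ (q + (ħ / 2) • r.1, r.2 + q) *
      K₂ (r.2 + q, q - (ħ / 2) • r.1)) (μa.prod μa) :=
    h1.mul_bdd (c := C) h2.aestronglyMeasurable (Filter.Eventually.of_forall fun r => hC _)
  have h5 := X.continuous_pairing (f := fun p : 𝔞 × 𝔞 => p.1)
    (g := fun p => l) (by fun_prop) (by fun_prop)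
  have h6 : Continuous fun r : 𝔞 × 𝔞 => Complex.exp ((X.pairing r.1 l : ℝ) * Complex.I) := by
    fun_prop
  exact h3.bdd_mul (c := 1) h6.aestronglyMeasurable
    (Filter.Eventually.of_forall fun r => (Complex.norm_exp_ofReal_mul_I _).le)

/-- The substitution (r, r') = (q, q) + `weylCoord`⁻¹(p, m) turns the transforms of u and v into
their kernels at (q + ħp/2, m + q) and (m + q, q - ħp/2). The integral over m is then the
composition of kernels, and the integral over p is the inverse of the kernel map. -/
lemma exists_weylConst : ∃ c : ℝ, ∀ u v : 𝓢(X.M, ℂ), ∀ x : X.M,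
    ∫ p : X.M × X.M, u p.1 * v p.2 * Complex.exp
      (-(2 / ħ * (X.Ω x p.1 + X.Ω p.1 p.2 + X.Ω p.2 x) : ℝ) * Complex.I)
        ∂((μa.prod μL).prod (μa.prod μL))
    = c * (X.kernel μa μL hħ).symm (SchwartzMap.kernelComp μa (X.kernel μa μL hħ u)
      (X.kernel μa μL hħ v)) x := by
  obtain ⟨J, hJ, h⟩ := exists_integral_weylCoord μa hħ
  have hc : (X.fourierConst μa μL : ℂ) ≠ 0 := Complex.ofReal_ne_zero.2 (X.fourierConst_pos μa μL).ne'
  -- J is the Jacobian of the substitution; the inverse of the kernel map carries the constant of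
  -- Fourier inversion, which is divided out.
  refine ⟨J / X.fourierConst μa μL, fun u v x => ?_⟩
  obtain ⟨q, l⟩ := x
  let H : 𝔞 × 𝔞 → ℂ := fun r => X.fourier μa μL u (r.1, (2 / ħ) • (q - r.2))
    * X.fourier μa μL v (r.2, (2 / ħ) • (r.1 - q))
    * Complex.exp (-(X.pairing ((2 / ħ) • (r.2 - r.1)) l : ℝ) * Complex.I)
  obtain ⟨C, hC⟩ := SchwartzMap.exists_norm_le (X.fourier μa μL v)
  have hH : Integrable H (μa.prod μa) := by
    let e : (𝔞 × 𝔞) ≃L[ℝ] (𝔞 × 𝔞) := (ContinuousLinearEquiv.refl ℝ 𝔞).prodCongr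
      (ContinuousLinearEquiv.smulLeft (Units.mk0 (-(2 / ħ)) (by
        have : 2 / ħ ≠ 0 := by positivity
        simpa using this)))
    have h1 : Integrable (fun r : 𝔞 × 𝔞 => X.fourier μa μL u (r.1, (2 / ħ) • (q - r.2)))
        (μa.prod μa) := by
      refine (SchwartzMap.integrable_comp_affine (μa.prod μa) (X.fourier μa μL u) e
        (0, (2 / ħ) • q)).congr (Filter.Eventually.of_forall fun r => ?_)
      change X.fourier μa μL u (r.1 + 0, (-(2 / ħ)) • r.2 + (2 / ħ) • q) = _
      congr 2
      · simp
      · module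
    refine (h1.mul_bdd (c := C) ?_ ?_).mul_bdd (c := 1) ?_ ?_
    · exact ((X.fourier μa μL v).continuous.comp (by fun_prop)).aestronglyMeasurable
    · exact Filter.Eventually.of_forall fun r => hC _
    · have h5 := X.continuous_pairing (f := fun p : 𝔞 × 𝔞 => (2 / ħ) • (p.2 - p.1))
        (g := fun p => l) (by fun_prop) (by fun_prop)
      exact Continuous.aestronglyMeasurable (by fun_prop)
    · exact Filter.Eventually.of_forall fun r => (norm_exp_neg_mul_I _).le
  have hK (p m : 𝔞) : H ((weylCoord hħ).symm (p, m) + (q, q))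
      = Complex.exp ((X.pairing p l : ℝ) * Complex.I) *
        (X.kernel μa μL hħ u (q + (ħ / 2) • p, m + q) * X.kernel μa μL hħ v (m + q, q - (ħ / 2) • p)) := by
    have hω : ħ⁻¹ = 2 / ħ * (1 / 2) := by field_simp
    have e0 : ((weylCoord hħ).symm (p, m) + (q, q)).2 - ((weylCoord hħ).symm (p, m) + (q, q)).1
        = -((ħ / 2) • p) := by
      rw [weylCoord_symm_apply]
      simp only [Prod.mk_add_mk]
      module
    have e1 : -(X.pairing ((2 / ħ) • (((weylCoord hħ).symm (p, m) + (q, q)).2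
        - ((weylCoord hħ).symm (p, m) + (q, q)).1)) l) = X.pairing p l := by
      have hω2 : 2 / ħ * (ħ / 2) = 1 := by field_simp
      rw [e0, smul_neg, smul_smul, hω2, one_smul, map_neg, LinearMap.neg_apply, neg_neg]
    simp only [H]
    rw [← Complex.ofReal_neg, e1, mul_comm, kernel_apply, kernel_apply, weylCoord_symm_apply, hω]
    congr 3
    · simp only [Prod.mk_add_mk]
      congr 1 <;> module
    · simp only [Prod.mk_add_mk]
      congr 1 <;> module
  have hi : Integrable (fun y : 𝔞 × 𝔞 => H ((weylCoord hħ).symm y + (q, q))) (μa.prod μa) :=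
    (X.integrable_kernel_mul_exp μa hħ (X.kernel μa μL hħ u) (X.kernel μa μL hħ v) q l).congr
      (Filter.Eventually.of_forall fun y => (hK y.1 y.2).symm)
  rw [integral_weyl_eq]
  have h1 : ∫ r, ∫ r', H (r, r') ∂μa ∂μa = ∫ y, H y ∂(μa.prod μa) := (integral_prod _ hH).symm
  refine h1.trans ?_
  rw [← integral_add_right_eq_self H (q, q), h (fun y => H (y + (q, q))), integral_prod _ hi,
    kernel_symm_apply]
  push_cast
  rw [← mul_assoc, div_mul_cancel₀ _ hc]
  congr 2
  ext p
  simp only [hK]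
  rw [integral_const_mul, SchwartzMap.kernelComp_apply]
  congr 1
  exact integral_add_right_eq_self (fun m => X.kernel μa μL hħ u (q + (ħ / 2) • p, m)
    * X.kernel μa μL hħ v (m, q - (ħ / 2) • p)) q

/-- The Weyl product of Schwartz functions. -/
def weyl (κ : ℝ) (u v : 𝓢(X.M, ℂ)) : 𝓢(X.M, ℂ) :=
  ((κ * (X.exists_weylConst μa μL hħ).choose : ℝ) : ℂ) • (X.kernel μa μL hħ).symm
    (SchwartzMap.kernelComp μa (X.kernel μa μL hħ u) (X.kernel μa μL hħ v))

lemma weyl_apply (κ : ℝ) (u v : 𝓢(X.M, ℂ)) (x : X.M) :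
    X.weyl μa μL hħ κ u v x = weylProduct (μa.prod μL) X.Ω ħ κ u v x := by
  rw [weylProduct, (X.exists_weylConst μa μL hħ).choose_spec u v x, weyl, smul_apply, smul_eq_mul,
    Complex.ofReal_mul, mul_assoc]

lemma kernel_weyl (κ : ℝ) (u v : 𝓢(X.M, ℂ)) : X.kernel μa μL hħ (X.weyl μa μL hħ κ u v)
    = ((κ * (X.exists_weylConst μa μL hħ).choose : ℝ) : ℂ) •
      SchwartzMap.kernelComp μa (X.kernel μa μL hħ u) (X.kernel μa μL hħ v) := by
  rw [weyl, map_smul, ContinuousLinearEquiv.apply_symm_apply]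

/-- The Weyl product as a bilinear map. -/
def weylBilin (κ : ℝ) : 𝓢(X.M, ℂ) →ₗ[ℂ] 𝓢(X.M, ℂ) →ₗ[ℂ] 𝓢(X.M, ℂ) :=
  LinearMap.mk₂ ℂ (X.weyl μa μL hħ κ)
    (fun u u' v => by
      simp only [weyl, map_add, SchwartzMap.kernelComp_add_left, smul_add])
    (fun c u v => by
      simp only [weyl, map_smul, SchwartzMap.kernelComp_smul_left, smul_comm c])
    (fun u v v' => by
      simp only [weyl, map_add, SchwartzMap.kernelComp_add_right, smul_add])
    (fun c u v => by
      simp only [weyl, map_smul, SchwartzMap.kernelComp_smul_right, smul_comm c])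

theorem weyl_assoc (κ : ℝ) (u v w : 𝓢(X.M, ℂ)) : X.weyl μa μL hħ κ (X.weyl μa μL hħ κ u v) w
    = X.weyl μa μL hħ κ u (X.weyl μa μL hħ κ v w) := by
  apply (X.kernel μa μL hħ).injective
  simp only [kernel_weyl, SchwartzMap.kernelComp_smul_left, SchwartzMap.kernelComp_smul_right,
    SchwartzMap.kernelComp_assoc]

/-- L² norms of symbols are fixed multiples of Hilbert–Schmidt norms of kernels, and the latter are
submultiplicative. -/
theorem exists_norm_weyl_le (κ : ℝ) : ∃ C : ℝ, ∀ u v : 𝓢(X.M, ℂ),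
    ‖(X.weyl μa μL hħ κ u v).toLp 2 (μa.prod μL)‖
      ≤ C * ‖u.toLp 2 (μa.prod μL)‖ * ‖v.toLp 2 (μa.prod μL)‖ := by
  let c := X.kernelConst μa μL hħ
  have hc : 0 < Real.sqrt c := Real.sqrt_pos.2 (X.kernelConst_pos μa μL hħ)
  let k : ℂ := ((κ * (X.exists_weylConst μa μL hħ).choose : ℝ) : ℂ)
  refine ⟨‖k‖ / Real.sqrt c, fun u v => ?_⟩
  have h1 : ‖(X.kernel μa μL hħ (X.weyl μa μL hħ κ u v)).toLp 2 (μa.prod μa)‖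
      ≤ ‖k‖ * (‖(X.kernel μa μL hħ u).toLp 2 (μa.prod μa)‖ *
        ‖(X.kernel μa μL hħ v).toLp 2 (μa.prod μa)‖) := by
    rw [kernel_weyl]
    have h2 : SchwartzMap.toLp (k • SchwartzMap.kernelComp μa (X.kernel μa μL hħ u)
        (X.kernel μa μL hħ v)) 2 (μa.prod μa) = k • (SchwartzMap.kernelComp μa (X.kernel μa μL hħ u)
        (X.kernel μa μL hħ v)).toLp 2 (μa.prod μa) :=
      map_smul (SchwartzMap.toLpCLM ℂ ℂ 2 (μa.prod μa)) k _
    rw [h2, norm_smul]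
    gcongr
    exact SchwartzMap.norm_toLp_kernelComp_le μa _ _
  rw [X.norm_toLp_eq μa μL hħ, X.norm_toLp_eq μa μL hħ u, X.norm_toLp_eq μa μL hħ v]
  calc _ ≤ Real.sqrt c * (‖k‖ * (‖(X.kernel μa μL hħ u).toLp 2 (μa.prod μa)‖ *
        ‖(X.kernel μa μL hħ v).toLp 2 (μa.prod μa)‖)) := by gcongr
    _ = _ := by
      change _ = ‖k‖ / Real.sqrt c * (Real.sqrt c * _) * (Real.sqrt c * _)
      field_simp

end ESET

/-! ### Symmetries as unitary conjugations of kernels -/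

section Reflection

variable {A : Type*} [NormedAddCommGroup A] [NormedSpace ℝ A] [FiniteDimensional ℝ A]
  [MeasurableSpace A] [BorelSpace A] (μ : Measure A) [μ.IsAddHaarMeasure]

/-- The kernel `K'` is the conjugate of `K` by the composition of the reflection `s ↦ c - s` and
of the multiplication by `w`. -/
def IsReflection (c : A) (w : A → ℂ) (K K' : 𝓢(A × A, ℂ)) : Prop :=
  ∀ s t, K' (s, t) = w s * starRingEnd ℂ (w t) * K (c - s, c - t)

namespace IsReflection

variable {c : A} {w : A → ℂ} {K₁ K₁' K₂ K₂' : 𝓢(A × A, ℂ)}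

lemma smul (r : ℂ) (h : IsReflection c w K₁ K₁') : IsReflection c w (r • K₁) (r • K₁') := fun s t => by
  rw [smul_apply, smul_apply, h s t, smul_eq_mul, smul_eq_mul]
  ring

lemma conj_mul_self {z : ℂ} (hz : ‖z‖ = 1) : starRingEnd ℂ z * z = 1 := by
  rw [Complex.conj_mul', hz]; simp

/-- Conjugation by a unitary operator respects composition: substitute m ↦ c - m in the middle
variable, where the phases cancel because |w(m)| = 1. -/
lemma kernelComp (hw : ∀ s, ‖w s‖ = 1) (h₁ : IsReflection c w K₁ K₁') (h₂ : IsReflection c w K₂ K₂') :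
    IsReflection c w (SchwartzMap.kernelComp μ K₁ K₂) (SchwartzMap.kernelComp μ K₁' K₂') :=
  fun s t => by
  rw [SchwartzMap.kernelComp_apply, SchwartzMap.kernelComp_apply,
    ← integral_sub_left_eq_self (fun m => K₁ (c - s, m) * K₂ (m, c - t)) μ c, ← integral_const_mul]
  congr 1
  ext m
  rw [h₁ s m, h₂ m t]
  linear_combination (w s * starRingEnd ℂ (w t) * K₁ (c - s, c - m) * K₂ (c - m, c - t))
    * conj_mul_self (hw m)

lemma integral_reflection {V : Type*} [NormedAddCommGroup V] [NormedSpace ℝ V]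
    [FiniteDimensional ℝ V] [MeasurableSpace V] [BorelSpace V] (ν : Measure V) [ν.IsAddHaarMeasure]
    (f : V → ℂ) (v : V) : ∫ x, f (v - x) ∂ν = ∫ x, f x ∂ν :=
  integral_sub_left_eq_self f ν v

lemma integral_conj_mul (hw : ∀ s, ‖w s‖ = 1) (h₁ : IsReflection c w K₁ K₁')
    (h₂ : IsReflection c w K₂ K₂') :
    ∫ y, starRingEnd ℂ (K₁' y) * K₂' y ∂(μ.prod μ) = ∫ y, starRingEnd ℂ (K₁ y) * K₂ y ∂(μ.prod μ) := by
  rw [← integral_reflection (μ.prod μ) (fun y => starRingEnd ℂ (K₁ y) * K₂ y) (c, c)]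
  congr 1
  ext ⟨s, t⟩
  have hs : ((c, c) : A × A) - (s, t) = (c - s, c - t) := rfl
  rw [hs, h₁ s t, h₂ s t, map_mul, map_mul, Complex.conj_conj]
  linear_combination (starRingEnd ℂ (K₁ (c - s, c - t)) * K₂ (c - s, c - t)) *
    (starRingEnd ℂ (w t) * w t * conj_mul_self (hw s) + conj_mul_self (hw t))

end IsReflection

end Reflection

namespace ESET

variable {𝔤 𝔞 𝔟 : Type*} [LieRing 𝔤] [LieAlgebra ℝ 𝔤]
  [NormedAddCommGroup 𝔞] [NormedSpace ℝ 𝔞] [FiniteDimensional ℝ 𝔞]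
  [NormedAddCommGroup 𝔟] [NormedSpace ℝ 𝔟] [FiniteDimensional ℝ 𝔟]
  (X : ESET 𝔤 𝔞 𝔟)

/-- The phase function of the operator which implements the symmetry at `x`. -/
def symmetryPhase (ħ : ℝ) (x : X.M) (s : 𝔞) : ℂ :=
  Complex.exp (-(2 / ħ * X.ξ (X.inB (X.sinh (s - x.1) x.2)) : ℝ) * Complex.I)

lemma norm_symmetryPhase (ħ : ℝ) (x : X.M) (s : 𝔞) : ‖X.symmetryPhase ħ x s‖ = 1 :=
  norm_exp_neg_mul_I _

/-- The reason for the definition of φ: it writes the phase of a symmetry at the midpoint (s+t)/2 as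
a difference f(s) - f(t), by the sum-to-product rule at s - a and t - a. -/
lemma pairing_twistingMap_cosh (x : X.M) (s t : 𝔞) :
    X.pairing (X.twistingMap ((1 / 2 : ℝ) • (s - t)))
      ((2 : ℝ) • ⟨X.cosh (x.1 - (1 / 2 : ℝ) • (s + t)) x.2, X.cosh_mem _ x.2.2⟩)
    = X.ξ (X.inB (X.sinh (s - x.1) x.2)) - X.ξ (X.inB (X.sinh (t - x.1) x.2)) := by
  have h := congrArg (fun f : 𝔟 →L[ℝ] 𝔟 => X.ξ (X.inB (f x.2)))
    (X.sinh_sub_sinh (s - x.1) (t - x.1))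
  simp only [_root_.sub_apply, map_sub] at h
  rw [h, twistingMap_eq, pairing_dualVec]
  have h1 : (1 / 2 : ℝ) • (s - x.1 - (t - x.1)) = (1 / 2 : ℝ) • (s - t) := by module
  have h2 : (1 / 2 : ℝ) • (s - x.1 + (t - x.1)) = -(x.1 - (1 / 2 : ℝ) • (s + t)) := by module
  rw [h1, h2, cosh_neg, Submodule.coe_smul, map_smul]
  rfl

lemma twistingMap_neg (a : 𝔞) : X.twistingMap (-a) = -X.twistingMap a := by
  rw [twistingMap_eq, twistingMap_eq, sinh_neg, map_neg]

variable [MeasurableSpace 𝔞] [BorelSpace 𝔞] [MeasurableSpace 𝔟] [BorelSpace 𝔟]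
  (μa : Measure 𝔞) [μa.IsAddHaarMeasure] (μL : Measure X.L) [μL.IsAddHaarMeasure]

/-- On the fibre over a, the symmetry is l ↦ C - l: the translation becomes a phase and the sign
reverses the frequency. -/
lemma fourier_pullback (x : X.M) (u : testFunctions X.M) (a α : 𝔞) :
    X.fourier μa μL (pullback (X.symmetry x) u : 𝓢(X.M, ℂ)) (a, α)
    = Complex.exp (-(X.pairing α ((2 : ℝ) • ⟨X.cosh (x.1 - a) x.2, X.cosh_mem _ x.2.2⟩) : ℝ)
        * Complex.I) * X.fourier μa μL (u : 𝓢(X.M, ℂ)) ((2 : ℝ) • x.1 - a, -α) := by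
  let C : X.L := (2 : ℝ) • ⟨X.cosh (x.1 - a) x.2, X.cosh_mem _ x.2.2⟩
  have h (l : X.L) : (pullback (X.symmetry x) u : 𝓢(X.M, ℂ)) (a, l)
      = (u : 𝓢(X.M, ℂ)) ((2 : ℝ) • x.1 - a, C - l) := rfl
  rw [fourier_apply, fourier_apply, ← integral_const_mul]
  simp only [h]
  rw [← integral_sub_left_eq_self (fun l => Complex.exp (-(X.pairing α l : ℝ) * Complex.I)
    * (u : 𝓢(X.M, ℂ)) ((2 : ℝ) • x.1 - a, C - l)) μL C]
  congr 1
  ext l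
  rw [sub_sub_cancel, ← mul_assoc, ← Complex.exp_add]
  congr 2
  rw [map_sub, map_neg, LinearMap.neg_apply]
  push_cast
  ring

/-- After the twist the frequency is (2/ħ)φ((s-t)/2), so the phase of the pulled-back function
factors as w(s) times the conjugate of w(t). Oddness of φ turns the reversed frequency into that of
the reflected pair (2a-s, 2a-t). -/
theorem isReflection_kernel_dequantize {Φ : Diffeos 𝔞} (hΦ : IsTame (Φ : Equiv.Perm 𝔞))
    (hφ : ∀ a, (Φ : Equiv.Perm 𝔞) a = X.twistingMap a) {ħ : ℝ} (hħ : 0 < ħ)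
    (x : X.M) (u : testFunctions X.M) :
    IsReflection ((2 : ℝ) • x.1) (X.symmetryPhase ħ x)
      (X.kernel μa μL hħ (X.dequantize μa μL Φ hΦ hħ u))
      (X.kernel μa μL hħ (X.dequantize μa μL Φ hΦ hħ (pullback (X.symmetry x) u : 𝓢(X.M, ℂ)))) := by
  intro s t
  have hs : (ħ / 2) • ħ⁻¹ • (s - t) = (1 / 2 : ℝ) • (s - t) := by
    rw [smul_smul]; congr 1; field_simp
  have hs' : (ħ / 2) • ħ⁻¹ • ((2 : ℝ) • x.1 - s - ((2 : ℝ) • x.1 - t)) = -((1 / 2 : ℝ) • (s - t)) := by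
    rw [← hs]; module
  have hm : (1 / 2 : ℝ) • ((2 : ℝ) • x.1 - s + ((2 : ℝ) • x.1 - t))
      = (2 : ℝ) • x.1 - (1 / 2 : ℝ) • (s + t) := by module
  rw [kernel_apply, kernel_apply, fourier_dequantize, fourier_dequantize, twistCLM_apply,
    twistCLM_apply, scaledTwist, scaledTwist]
  simp only [hφ, hs, hs', hm, twistingMap_neg, smul_neg]
  rw [fourier_pullback, X.pairing.map_smul (2 / ħ), LinearMap.smul_apply, pairing_twistingMap_cosh]
  congr 1
  rw [symmetryPhase, symmetryPhase, ← Complex.exp_conj, ← Complex.exp_add]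
  congr 1
  simp only [smul_eq_mul, map_mul, map_neg, Complex.conj_ofReal, Complex.conj_I]
  push_cast
  ring

theorem inner_toLp_eq_of_isReflection {ħ : ℝ} (hħ : 0 < ħ) {c : 𝔞} {w : 𝔞 → ℂ} (hw : ∀ s, ‖w s‖ = 1)
    {u u' v v' : 𝓢(X.M, ℂ)}
    (hu : IsReflection c w (X.kernel μa μL hħ u) (X.kernel μa μL hħ u'))
    (hv : IsReflection c w (X.kernel μa μL hħ v) (X.kernel μa μL hħ v')) :
    inner ℂ (u'.toLp 2 (μa.prod μL)) (v'.toLp 2 (μa.prod μL))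
      = inner ℂ (u.toLp 2 (μa.prod μL)) (v.toLp 2 (μa.prod μL)) := by
  have h1 := SchwartzMap.inner_toL2_toL2_eq (X.kernel μa μL hħ u) (X.kernel μa μL hħ v) (μa.prod μa)
  have h2 := SchwartzMap.inner_toL2_toL2_eq (X.kernel μa μL hħ u') (X.kernel μa μL hħ v') (μa.prod μa)
  simp only [RCLike.inner_apply'] at h1 h2
  rw [X.inner_toLp_eq μa μL hħ, X.inner_toLp_eq μa μL hħ u, h1, h2,
    IsReflection.integral_conj_mul μa hw hu hv]

lemma isReflection_kernel_weyl {ħ : ℝ} (hħ : 0 < ħ) (κ : ℝ) {c : 𝔞} {w : 𝔞 → ℂ}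
    (hw : ∀ s, ‖w s‖ = 1) {u u' v v' : 𝓢(X.M, ℂ)}
    (hu : IsReflection c w (X.kernel μa μL hħ u) (X.kernel μa μL hħ u'))
    (hv : IsReflection c w (X.kernel μa μL hħ v) (X.kernel μa μL hħ v')) :
    IsReflection c w (X.kernel μa μL hħ (X.weyl μa μL hħ κ u v))
      (X.kernel μa μL hħ (X.weyl μa μL hħ κ u' v')) := by
  rw [kernel_weyl, kernel_weyl]
  exact (IsReflection.kernelComp μa hw hu hv).smul _

end ESET

/-! ### Extension of products and group actions to completions -/

open UniformSpace in
/-- A bounded bilinear associative product extends to the completion. -/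
theorem exists_completion_product {E : Type*} [NormedAddCommGroup E] [NormedSpace ℂ E]
    (B : E →ₗ[ℂ] E →ₗ[ℂ] E) {C : ℝ} (hC : ∀ a b, ‖B a b‖ ≤ C * ‖a‖ * ‖b‖)
    (hB : ∀ a b c, B (B a b) c = B a (B b c)) :
    ∃ m : Completion E →L[ℂ] Completion E →L[ℂ] Completion E,
      (∀ a b : E, m a b = (B a b : E)) ∧ ∀ a b c, m (m a b) c = m a (m b c) := by
  let ι : E →L[ℂ] Completion E := Completion.toComplL
  have hd : DenseRange ι := Completion.denseRange_coe
  have hu : IsUniformInducing ι := Completion.isUniformInducing_coe E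
  let f : E →L[ℂ] E →L[ℂ] Completion E :=
    LinearMap.mkContinuous₂ (B.compr₂ (ι : E →ₗ[ℂ] Completion E)) C fun a b =>
      (Completion.norm_coe (B a b)).le.trans (hC a b)
  -- The first variable is extended, and then the second after exchanging the two.
  let f₁ : Completion E →L[ℂ] E →L[ℂ] Completion E := f.extend ι
  let m : Completion E →L[ℂ] Completion E →L[ℂ] Completion E := (f₁.flip.extend ι).flip
  have hm (a b : E) : m a b = (B a b : E) := by
    have h1 : f₁ a = f a := f.extend_eq hd hu a
    have h2 : f₁.flip.extend ι b = f₁.flip b := f₁.flip.extend_eq hd hu b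
    change f₁.flip.extend ι b a = _
    rw [h2]
    change f₁ a b = _
    rw [h1]
    rfl
  refine ⟨m, hm, fun a b c => ?_⟩
  induction a, b, c using Completion.induction_on₃ with
  | hp => exact isClosed_eq (by fun_prop) (by fun_prop)
  | ih a b c => rw [hm, hm, hm, hm, hB]

open UniformSpace in
/-- An automorphism of a dense subspace extends to a unitary automorphism of the completion. -/
theorem exists_completion_automorphism {D E : Type*} [AddCommGroup D] [Module ℂ D]
    [NormedAddCommGroup E] [InnerProductSpace ℂ E] (j : D →ₗ[ℂ] E) (hj : DenseRange j)
    (S : D ≃ₗ[ℂ] D) (B : E → E → E) (m : Completion E →L[ℂ] Completion E →L[ℂ] Completion E)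
    (hm : ∀ a b : E, m a b = (B a b : E)) (R : E → E → Prop)
    (hR : ∀ a a' b b', R a a' → R b b' → inner ℂ a' b' = inner ℂ a b)
    (hB : ∀ a a' b b', R a a' → R b b' → R (B a b) (B a' b')) (hS : ∀ u, R (j u) (j (S u))) :
    ∃ V : Completion E ≃ₗᵢ[ℂ] Completion E, (∀ u, V (j u : E) = (j (S u) : E)) ∧
      ∀ a b, V (m a b) = m (V a) (V b) := by
  let e : D →ₗ[ℂ] Completion E := (Completion.toComplL : E →L[ℂ] Completion E).toLinearMap ∘ₗ j
  have he : DenseRange e := Completion.denseRange_coe.comp hj (Completion.continuous_coe E)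
  have hn (u : D) : ‖e (S u)‖ = ‖e u‖ := by
    refine (Completion.norm_coe (j (S u))).trans (Eq.trans ?_ (Completion.norm_coe (j u)).symm)
    rw [@norm_eq_sqrt_re_inner ℂ, @norm_eq_sqrt_re_inner ℂ, hR _ _ _ _ (hS u) (hS u)]
  let V := S.extendOfIsometry e e he he hn
  have hV (u : D) : V (j u : E) = (j (S u) : E) := S.extendOfIsometry_eq e e he he hn u
  -- V is prescribed only on the image of D, which need not contain products. The relation R
  -- identifies V on further vectors: V a and a' have the same inner products with the dense set of
  -- all V(j u).
  have hVR (a a' : E) (h : R a a') : V a = (a' : E) := by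
    refine (V.surjective.denseRange.comp he V.continuous).eq_of_inner_left ℂ fun u => ?_
    change inner ℂ (V a) (V (j u : E)) = inner ℂ (a' : Completion E) (V (j u : E))
    rw [V.inner_map_map, hV, Completion.inner_coe, Completion.inner_coe, hR _ _ _ _ h (hS u)]
  refine ⟨V, hV, fun a b => ?_⟩
  induction a using he.induction_on with
  | hp => exact isClosed_eq (by fun_prop) (by fun_prop)
  | ih u =>
    induction b using he.induction_on with
    | hp => exact isClosed_eq (by fun_prop) (by fun_prop)
    | ih v =>
      have h1 : m (e u) (e v) = (B (j u) (j v) : E) := hm _ _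
      have h2 : m (V (e u)) (V (e v)) = (B (j (S u)) (j (S v)) : E) := by
        rw [← hm, ← hV, ← hV]; rfl
      rw [h1, h2]
      exact hVR _ _ (hB _ _ _ _ (hS u) (hS v))

/-- The extension of unitary algebra automorphisms from generators to a unitary representation. -/
theorem exists_unitary_representation {Γ D H : Type*} [Group Γ] [NormedAddCommGroup H]
    [NormedSpace ℂ H] (act : Γ → D → D) (hone : ∀ u, act 1 u = u)
    (hmul : ∀ g h u, act (g * h) u = act g (act h u)) (j : D → H) (hj : DenseRange j)
    (m : H →L[ℂ] H →L[ℂ] H) (s : Set Γ)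
    (hs : ∀ g ∈ s, ∃ V : H ≃ₗᵢ[ℂ] H, (∀ u, V (j u) = j (act g u)) ∧ ∀ a b, V (m a b) = m (V a) (V b)) :
    ∃ U : Subgroup.closure s →* (H ≃ₗᵢ[ℂ] H), (∀ g u, U g (j u) = j (act g u)) ∧
      ∀ g a b, U g (m a b) = m (U g a) (U g b) := by
  -- The operator extending a group element is unique by density, so it may be built by induction on
  -- words in the generators, and multiplicativity of the choice follows afterwards.
  have key (g : Γ) (hg : g ∈ Subgroup.closure s) : ∃ V : H ≃ₗᵢ[ℂ] H,
      (∀ u, V (j u) = j (act g u)) ∧ ∀ a b, V (m a b) = m (V a) (V b) := by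
    induction hg using Subgroup.closure_induction with
    | mem g hg => exact hs g hg
    | one => exact ⟨1, fun u => by rw [hone]; rfl, fun a b => rfl⟩
    | mul g h _ _ hg hh =>
      obtain ⟨V, hV, hV'⟩ := hg
      obtain ⟨W, hW, hW'⟩ := hh
      refine ⟨V * W, fun u => ?_, fun a b => ?_⟩
      · rw [LinearIsometryEquiv.coe_mul, Function.comp_apply, hW, hV, hmul]
      · simp only [LinearIsometryEquiv.coe_mul, Function.comp_apply, hW', hV']
    | inv g _ hg =>
      obtain ⟨V, hV, hV'⟩ := hg
      refine ⟨V⁻¹, fun u => ?_, fun a b => ?_⟩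
      · rw [LinearIsometryEquiv.coe_inv, LinearIsometryEquiv.symm_apply_eq, hV, ← hmul,
          mul_inv_cancel, hone]
      · rw [LinearIsometryEquiv.coe_inv, LinearIsometryEquiv.symm_apply_eq, hV']
        simp only [LinearIsometryEquiv.apply_symm_apply]
  have huniq (V W : H ≃ₗᵢ[ℂ] H) (h : ∀ u, V (j u) = W (j u)) : V = W :=
    LinearIsometryEquiv.ext fun a => congrFun (hj.equalizer V.continuous W.continuous (funext h)) a
  let U (g : Subgroup.closure s) : H ≃ₗᵢ[ℂ] H := (key g g.2).choose
  have hU (g u) : U g (j u) = j (act g u) := (key g g.2).choose_spec.1 u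
  refine ⟨{ toFun := U, map_one' := huniq _ _ fun u => ?_, map_mul' := fun g h => huniq _ _ fun u => ?_ },
    hU, fun g => (key g g.2).choose_spec.2⟩
  · rw [hU]; exact congrArg j (hone u)
  · rw [hU, LinearIsometryEquiv.coe_mul, Function.comp_apply, hU, hU, Subgroup.coe_mul, hmul]

namespace ESET

variable {𝔤 𝔞 𝔟 : Type*} [LieRing 𝔤] [LieAlgebra ℝ 𝔤]
  [NormedAddCommGroup 𝔞] [NormedSpace ℝ 𝔞] [FiniteDimensional ℝ 𝔞]
  [NormedAddCommGroup 𝔟] [NormedSpace ℝ 𝔟] [FiniteDimensional ℝ 𝔟]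
  (X : ESET 𝔤 𝔞 𝔟)

lemma symmetry_mul_self (x : X.M) : X.symmetry x * X.symmetry x = 1 :=
  Subtype.ext (Equiv.ext fun y => X.symm_symm x y)

lemma symmetry_inv (x : X.M) : (X.symmetry x)⁻¹ = X.symmetry x :=
  inv_eq_of_mul_eq_one_right (X.symmetry_mul_self x)

lemma pullback_one (u : testFunctions X.M) : pullback 1 u = u := rfl

lemma pullback_mul (g h : Diffeos X.M) (u : testFunctions X.M) :
    pullback (g * h) u = pullback h (pullback g u) := rfl

/-- The pull-back by a symmetry, as a linear automorphism. -/
def symmetryEquiv (x : X.M) : testFunctions X.M ≃ₗ[ℂ] testFunctions X.M where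
  toFun := pullback (X.symmetry x)
  invFun := pullback (X.symmetry x)
  map_add' _ _ := rfl
  map_smul' _ _ := rfl
  left_inv u := by rw [← pullback_mul, symmetry_mul_self, pullback_one]
  right_inv u := by rw [← pullback_mul, symmetry_mul_self, pullback_one]

end ESET
end

/-! ### Proof of the proposition -/

set_option maxHeartbeats 2000000 in
theorem proposition6p1 {𝔤 𝔞 𝔟 : Type*} [LieRing 𝔤] [LieAlgebra ℝ 𝔤]
    [NormedAddCommGroup 𝔞] [NormedSpace ℝ 𝔞] [FiniteDimensional ℝ 𝔞]
    [NormedAddCommGroup 𝔟] [NormedSpace ℝ 𝔟] [FiniteDimensional ℝ 𝔟]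
    [MeasurableSpace 𝔞] [BorelSpace 𝔞] [MeasurableSpace 𝔟] [BorelSpace 𝔟]
    (X : ESET 𝔤 𝔞 𝔟) (hX : X.HasMidpointMap)
    (μa : Measure 𝔞) [μa.IsAddHaarMeasure] (μL : Measure X.L) [μL.IsAddHaarMeasure]
    (ħ κ : ℝ) (hħ : 0 < ħ) (hκ : 0 < κ) :
    -- the twisting map is a diffeomorphism; `τ u = F⁻¹ ((φ_ħ⁻¹)^⋆ (F u))` defines a linear injection
    ∃ (Φ : Diffeos 𝔞) (τ : 𝓢(X.M, ℂ) →ₗ[ℂ] 𝓢'(X.M, ℂ)) (hτ : Function.Injective τ),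
      (∀ a, (Φ : Equiv.Perm 𝔞) a = X.twistingMap a) ∧
      (∀ u : 𝓢(X.M, ℂ), X.HasPartialFourier μa (τ u) fun y =>
        X.partialFourier μL u (ESET.scaledTwist ħ (Φ : Equiv.Perm 𝔞).symm y)) ∧
      -- (i) the inclusions `𝓓 ⊆ 𝓢 ⊆ 𝓔 ⊆ 𝓗` and their density
      ∃ hS : ∀ u : 𝓢(X.M, ℂ),
          SchwartzMap.toTemperedDistributionCLM X.M ℂ (μa.prod μL) u ∈ LinearMap.range τ,
        let E := TransportSpace (μa.prod μL) τ hτ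
        let H := TransportSpace.Hilb (μa.prod μL) τ hτ
        let T : E ≃ₗ[ℂ] 𝓢(X.M, ℂ) := TransportSpace.T (μa.prod μL) τ hτ
        let incl : 𝓢(X.M, ℂ) →ₗ[ℂ] E := TransportSpace.incl (μa.prod μL) τ hτ hS
        Dense (testFunctions X.M : Set 𝓢(X.M, ℂ)) ∧
        DenseRange incl ∧
        DenseRange (fun u : testFunctions X.M => incl u) ∧
        Function.Injective (fun a : E => (a : H)) ∧
        DenseRange (fun a : E => (a : H)) ∧
        -- (ii) invariance of the inner product under the symmetries, unitary action
        (∀ (x : X.M) (u v : testFunctions X.M),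
          inner ℂ (incl (pullback (X.symmetry x) u)) (incl (pullback (X.symmetry x) v)) =
            inner ℂ (incl u) (incl v)) ∧
        ∃ U : X.transvectionGroup →* (H ≃ₗᵢ[ℂ] H),
          (∀ (g : X.transvectionGroup) (u : testFunctions X.M),
            U g (incl u : E) = (incl (pullback (g : Diffeos X.M)⁻¹ u) : E)) ∧
          -- (iii) the product of `𝓔` extends to an associative, jointly continuous product of `𝓗`
          ∃ m : H →L[ℂ] H →L[ℂ] H,
            (∀ a b : E, ∃ c : E,
              (∀ x, T c x = weylProduct (μa.prod μL) X.Ω ħ κ (T a) (T b) x) ∧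
              m a b = (c : H)) ∧
            (∀ a b c : H, m (m a b) c = m a (m b c)) ∧
            -- (iv) the action is by algebra automorphisms
            ∀ (g : X.transvectionGroup) (a b : H), U g (m a b) = m (U g a) (U g b) := by
  obtain ⟨Φ, hφ, hΦ⟩ := X.exists_isTame hX
  let τ := X.quantization μa μL Φ ħ
  have hτ : Function.Injective τ := X.quantization_injective μa μL Φ hħ
  have hS := X.toTemperedDistribution_mem_range μa μL Φ hΦ hħ
  refine ⟨Φ, τ, hτ, hφ, X.hasPartialFourier_quantization μa μL Φ ħ, hS, ?_⟩
  intro E H T incl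
  let P : 𝓢(X.M, ℂ) →L[ℂ] 𝓢(X.M, ℂ) := X.dequantize μa μL Φ hΦ hħ
  have hT (u : 𝓢(X.M, ℂ)) : T (incl u) = P u :=
    TransportSpace.T_incl _ τ hτ hS (X.quantization_dequantize μa μL Φ hΦ hħ u)
  have hincl (u : 𝓢(X.M, ℂ)) : incl u = T.symm (P u) := (T.eq_symm_apply).2 (hT u)
  have hcont : Continuous T.symm := TransportSpace.continuous_T_symm _ τ hτ
  have hP : DenseRange P := X.denseRange_dequantize μa μL Φ hΦ hħ
  have hdense : DenseRange (fun u => T.symm (P u)) :=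
    T.symm.surjective.denseRange.comp hP hcont
  have hdS : DenseRange incl := by
    convert hdense using 1
    exact funext hincl
  have hdD : DenseRange (fun u : testFunctions X.M => incl u) := by
    have h : DenseRange ((fun u => T.symm (P u)) ∘ ((↑) : testFunctions X.M → 𝓢(X.M, ℂ))) :=
      hdense.comp (dense_testFunctions.denseRange_val) (hcont.comp P.continuous)
    convert h using 1
    exact funext fun u => hincl u
  have hinner (a b : E) : inner ℂ a b = inner ℂ ((T a).toLp 2 (μa.prod μL)) ((T b).toLp 2 (μa.prod μL)) :=
    TransportSpace.inner_eq_inner_toLp _ τ hτ a b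
  have hnorm (a : E) : ‖a‖ = ‖(T a).toLp 2 (μa.prod μL)‖ := TransportSpace.norm_eq _ τ hτ a
  -- The graph of the symmetry s_x on 𝓔, read on kernels. Unlike the pull-back it makes sense for
  -- products of test functions, which need not be test functions.
  let R (x : X.M) (a a' : E) : Prop := IsReflection ((2 : ℝ) • x.1) (X.symmetryPhase ħ x)
    (X.kernel μa μL hħ (T a)) (X.kernel μa μL hħ (T a'))
  have hR (x : X.M) (a a' b b' : E) (ha : R x a a') (hb : R x b b') :
      inner ℂ a' b' = inner ℂ a b := by
    rw [hinner, hinner]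
    exact X.inner_toLp_eq_of_isReflection μa μL hħ (X.norm_symmetryPhase ħ x) ha hb
  have hRS (x : X.M) (u : testFunctions X.M) : R x (incl u) (incl (pullback (X.symmetry x) u)) := by
    simp only [R, hT]
    exact X.isReflection_kernel_dequantize μa μL hΦ hφ hħ x u
  let B : E →ₗ[ℂ] E →ₗ[ℂ] E :=
    ((X.weylBilin μa μL hħ κ).compl₁₂ T.toLinearMap T.toLinearMap).compr₂ T.symm.toLinearMap
  have hTB (a b : E) : T (B a b) = X.weyl μa μL hħ κ (T a) (T b) := T.apply_symm_apply _
  obtain ⟨C, hC⟩ := X.exists_norm_weyl_le μa μL hħ κ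
  have hBC (a b : E) : ‖B a b‖ ≤ C * ‖a‖ * ‖b‖ := by
    rw [hnorm, hnorm a, hnorm b, hTB]
    exact hC _ _
  have hBassoc (a b c : E) : B (B a b) c = B a (B b c) := by
    apply T.injective
    rw [hTB, hTB, hTB, hTB, ESET.weyl_assoc]
  obtain ⟨m, hm, hmassoc⟩ := exists_completion_product B hBC hBassoc
  let j : testFunctions X.M →ₗ[ℂ] E := incl ∘ₗ (testFunctions X.M).subtype
  have hj : DenseRange (fun u : testFunctions X.M => ((incl u : E) : H)) :=
    UniformSpace.Completion.denseRange_coe.comp hdD (UniformSpace.Completion.continuous_coe E)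
  have hsymm (x : X.M) : ∃ V : H ≃ₗᵢ[ℂ] H,
      (∀ u : testFunctions X.M, V (incl u : E) = (incl (pullback (X.symmetry x)⁻¹ u) : E)) ∧
      ∀ a b, V (m a b) = m (V a) (V b) := by
    rw [X.symmetry_inv]
    refine exists_completion_automorphism j hdD (X.symmetryEquiv x) (fun a b => B a b) m hm (R x)
      (hR x) (fun a a' b b' ha hb => ?_) (hRS x)
    simp only [R, hTB]
    exact X.isReflection_kernel_weyl μa μL hħ κ (X.norm_symmetryPhase ħ x) ha hb
  obtain ⟨U, hU, hUm⟩ := exists_unitary_representation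
    (fun (g : Diffeos X.M) (u : testFunctions X.M) => pullback g⁻¹ u)
    (fun u => by rw [inv_one, X.pullback_one]) (fun g h u => by rw [mul_inv_rev, X.pullback_mul])
    (fun u : testFunctions X.M => ((incl u : E) : H)) hj m
    -- It suffices to treat the generators, and each of these is a product of two symmetries that
    -- have already been extended to unitary automorphisms.
    {g | ∃ x y : X.M, g = X.symmetry x * X.symmetry y} (by
      rintro _ ⟨x, y, rfl⟩
      obtain ⟨V, hV, hVm⟩ := hsymm x
      obtain ⟨W, hW, hWm⟩ := hsymm y
      refine ⟨V * W, fun u => ?_, fun a b => ?_⟩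
      · rw [LinearIsometryEquiv.coe_mul, Function.comp_apply, hW, hV, mul_inv_rev, X.pullback_mul]
      · simp only [LinearIsometryEquiv.coe_mul, Function.comp_apply, hWm, hVm])
  refine ⟨dense_testFunctions, hdS, hdD, UniformSpace.Completion.coe_injective E,
    UniformSpace.Completion.denseRange_coe, fun x u v => hR x _ _ _ _ (hRS x u) (hRS x v), U, hU, m,
    fun a b => ⟨B a b, fun x => ?_, hm a b⟩, hmassoc, hUm⟩
  rw [hTB, ESET.weyl_apply]
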